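/- All curve germs are analytic. An irreducible plane curve germ $(X,0)=(V(h),0)\subset(\mathbb C^2,0)$ is given by an irreducible $h\in\mathbb C\{x,y\}$; its multiplicity $m(X,0)$ is the order of $h$, and its Milnor number is $\mu(X,0)=\dim_{\mathbb C}\mathbb C\{x,y\}/\langle \partial h/\partial x,\partial h/\partial y\rangle$. If $m(X,0)=m\ge 2$, then after a linear change of coordinates $X$ has a (primitive) Puiseux parametrization $\varphi(u)=(u^m,\varphi_1(u))$ with $\varphi_1=a_1u^{\alpha_1}+a_2u^{\alpha_2}+\cdots$ convergent, $a_i\neq0$, $m<\alpha_1<\alpha_2<\cdots$ and $\gcd(m,\alpha_1,\alpha_2,\dots)=1$. Its characteristic exponents are $m$ together with those $\alpha_j$ for which $\gcd(m,\alpha_1,\dots,\alpha_j)<\gcd(m,\alpha_1,\dots,\alpha_{j-1})$; their number is denoted $ce(X,0)$. The germ $X$, with $m(X,0)=m$ and $ce(X,0)=k$, is called $\mu_{m,k}$-minimal if $\mu(X,0)\le\mu(Y,0)$ for every irreducible plane curve germ $(Y,0)$ with $m(Y,0)=m$ and $ce(Y,0)=k$. Let $(X,0)$ be a $\mu_{m,k}$-minimal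 irreducible plane curve germ of multiplicity $m\ge2$ with $k$ characteristic exponents. Then: (a) If $m$ is composite and $k\ge4$, then $$\mu(X,0)=m(m-2+d_1)+\sum_{j=1}^{k-3}d_j(d_{j+1}-1),$$ where $m=p_1p_2\cdots p_r$ is the prime factorization with $p_1\le p_2\le\cdots\le p_r$, and $d_i=p_1p_2\cdots p_{k-1-i}$ for $1\le i\le k-2$. (b) If $(Y,0)$ is an irreducible plane curve germ of multiplicity $m$ with $k'$ characteristic exponents and $k<k'$, then $\mu(X,0)<\mu(Y,0)$. (c) Let $\varphi$ be a Puiseux parametrization of $(X,0)$ (composed with a linear change of coordinates of $\mathbb C^2$), and let $(u,t)\mapsto(\varphi_t(u),t)$ be a holomorphic one-parameter unfolding of $\varphi=\varphi_0$. For a sufficiently small disc $B$ around $0\in\mathbb C$, let $(X_t,0)$ be the germ at the origin of $\varphi_t(B)$. If, for all sufficiently small $t$, $(X_t,0)$ is an irreducible plane curve germ of multiplicity $m$, then $ce(X_t,0)\le ce(X,0)=k$ for all sufficiently small $t$. -/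

import Mathlib

open Filter Topology

noncomputable section

namespace PlaneCurve

/-! ### Convergent power series -/

/-- A complex power series converges absolutely in some polydisc around the origin. -/
def IsConvergent {σ : Type} (f : MvPowerSeries σ ℂ) : Prop :=
  ∃ r : ℝ, 0 < r ∧ Summable fun n : σ →₀ ℕ => ‖MvPowerSeries.coeff n f‖ * r ^ n.degree

theorem IsConvergent.anti {σ : Type} {f : MvPowerSeries σ ℂ} {r s : ℝ} (hs : 0 < s) (hsr : s ≤ r)
    (h : Summable fun n : σ →₀ ℕ => ‖MvPowerSeries.coeff n f‖ * r ^ n.degree) :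
    Summable fun n : σ →₀ ℕ => ‖MvPowerSeries.coeff n f‖ * s ^ n.degree :=
  h.of_nonneg_of_le (fun n => by positivity) fun n => by gcongr

theorem IsConvergent.add {σ : Type} {f g : MvPowerSeries σ ℂ} (hf : IsConvergent f)
    (hg : IsConvergent g) : IsConvergent (f + g) := by
  obtain ⟨r, hr, hf⟩ := hf
  obtain ⟨s, hs, hg⟩ := hg
  have ht : 0 < min r s := lt_min hr hs
  refine ⟨min r s, ht, ((anti ht (min_le_left _ _) hf).add
    (anti ht (min_le_right _ _) hg)).of_nonneg_of_le (fun n => by positivity) fun n => ?_⟩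
  rw [← add_mul, map_add]
  gcongr
  exact norm_add_le _ _

theorem summable_antidiagonal {ι : Type} [AddCommMonoid ι] [Finset.HasAntidiagonal ι] {a b : ι → ℝ}
    (ha : Summable a) (hb : Summable b) (ha0 : ∀ i, 0 ≤ a i) (hb0 : ∀ i, 0 ≤ b i) :
    Summable fun n => ∑ p ∈ Finset.HasAntidiagonal.antidiagonal n, a p.1 * b p.2 :=
  summable_sum_mul_antidiagonal_of_summable_mul (ha.mul_of_nonneg hb ha0 hb0)

theorem IsConvergent.mul {σ : Type} {f g : MvPowerSeries σ ℂ} (hf : IsConvergent f)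
    (hg : IsConvergent g) : IsConvergent (f * g) := by
  classical
  obtain ⟨r, hr, hf⟩ := hf
  obtain ⟨s, hs, hg⟩ := hg
  obtain ⟨t, ht, htr, hts⟩ : ∃ t : ℝ, 0 < t ∧ t ≤ r ∧ t ≤ s :=
    ⟨min r s, lt_min hr hs, min_le_left _ _, min_le_right _ _⟩
  have key := summable_antidiagonal (anti ht htr hf) (anti ht hts hg)
    (fun n => mul_nonneg (norm_nonneg _) (pow_nonneg ht.le _))
    (fun n => mul_nonneg (norm_nonneg _) (pow_nonneg ht.le _))
  refine ⟨t, ht, Summable.of_nonneg_of_le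
    (fun n => mul_nonneg (norm_nonneg _) (pow_nonneg ht.le _)) (fun n => ?_) key⟩
  have h1 : ∀ p ∈ Finset.HasAntidiagonal.antidiagonal n,
      ‖MvPowerSeries.coeff p.1 f * MvPowerSeries.coeff p.2 g‖ * t ^ n.degree =
        (‖MvPowerSeries.coeff p.1 f‖ * t ^ p.1.degree) *
          (‖MvPowerSeries.coeff p.2 g‖ * t ^ p.2.degree) := by
    intro p hp
    rw [← Finset.HasAntidiagonal.mem_antidiagonal.mp hp, map_add, pow_add, norm_mul]
    ring
  rw [MvPowerSeries.coeff_mul, ← Finset.sum_congr rfl h1, ← Finset.sum_mul]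
  exact mul_le_mul_of_nonneg_right (norm_sum_le _ _) (pow_nonneg ht.le _)

theorem isConvergent_algebraMap {σ : Type} (c : ℂ) :
    IsConvergent (algebraMap ℂ (MvPowerSeries σ ℂ) c) := by
  classical
  refine ⟨1, one_pos, summable_of_ne_finset_zero (s := {0}) fun n hn => ?_⟩
  have hn' : n ≠ 0 := by simpa using hn
  simp [MvPowerSeries.algebraMap_apply, MvPowerSeries.coeff_C, hn']

theorem IsConvergent.pderiv {σ : Type} {f : MvPowerSeries σ ℂ} (hf : IsConvergent f) (i : σ) :
    IsConvergent (MvPowerSeries.pderiv ℂ i f) := by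
  classical
  obtain ⟨r, hr, hf⟩ := hf
  have hinj : Function.Injective fun n : σ →₀ ℕ => n + Finsupp.single i 1 :=
    fun a b h => add_right_cancel h
  refine ⟨r / 2, half_pos hr, ((hf.comp_injective hinj).mul_left r⁻¹).of_nonneg_of_le
    (fun n => by positivity) fun n => ?_⟩
  have h1 : ((n i : ℝ) + 1) ≤ 2 ^ n.degree := by
    have h2 : n i ≤ n.degree := Finsupp.le_degree i n
    have h3 : n.degree + 1 ≤ 2 ^ n.degree := Nat.lt_two_pow_self
    exact_mod_cast (Nat.succ_le_succ h2).trans h3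
  have h4 : ‖((n i : ℂ) + 1)‖ = (n i : ℝ) + 1 := by
    exact_mod_cast Complex.norm_natCast (n i + 1)
  simp only [Function.comp_apply, MvPowerSeries.coeff_pderiv, norm_mul, h4, map_add,
    Finsupp.degree_single, pow_add, pow_one, div_pow]
  calc _ = ‖MvPowerSeries.coeff (n + Finsupp.single i 1) f‖ * r ^ n.degree *
        (((n i : ℝ) + 1) / 2 ^ n.degree) := by ring
    _ ≤ ‖MvPowerSeries.coeff (n + Finsupp.single i 1) f‖ * r ^ n.degree * 1 := by
        gcongr
        exact div_le_one_of_le₀ h1 (by positivity)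
    _ = _ := by field_simp

/-- The ring `ℂ{x, y}` of convergent power series in two variables. -/
def ConvSeries : Subalgebra ℂ (MvPowerSeries (Fin 2) ℂ) where
  carrier := {f | IsConvergent f}
  mul_mem' := IsConvergent.mul
  add_mem' := IsConvergent.add
  algebraMap_mem' := isConvergent_algebraMap

/-- The sum of a power series at a point (used only near the origin, for convergent series). -/
def evalAt {σ : Type} [Fintype σ] (f : MvPowerSeries σ ℂ) (p : σ → ℂ) : ℂ :=
  ∑' n : σ →₀ ℕ, MvPowerSeries.coeff n f * ∏ i, p i ^ n i

/-- Partial derivatives on `ℂ{x, y}`. -/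
def partialDeriv (i : Fin 2) (h : ConvSeries) : ConvSeries :=
  ⟨MvPowerSeries.pderiv ℂ i h.1, IsConvergent.pderiv h.2 i⟩

/-! ### Invariants of an irreducible plane curve germ

An irreducible analytic plane curve germ `(X, 0) = (V(h), 0)` is given by an irreducible
`h ∈ ℂ{x, y}` (unique up to a unit). -/

/-- The multiplicity of `V(h)` is `m`: the lowest degree of a monomial of `h` is `m`. -/
def HasMultiplicity (h : ConvSeries) (m : ℕ) : Prop :=
  MvPowerSeries.order h.1 = m

/-- The Milnor number `dim_ℂ ℂ{x, y} / (∂h/∂x, ∂h/∂y)`, possibly infinite. -/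
def milnorNumber (h : ConvSeries) : ℕ∞ :=
  Cardinal.toENat (Module.rank ℂ
    (ConvSeries ⧸ Ideal.span {partialDeriv 0 h, partialDeriv 1 h}))

/-- The curve `u ↦ L (u ^ m, y(u))`, where `L` is a linear change of coordinates of `ℂ²`. -/
def puiseuxCurve (m : ℕ) (L : GL (Fin 2) ℂ) (y : PowerSeries ℂ) : Fin 2 → PowerSeries ℂ :=
  fun i => PowerSeries.C (L i 0) * PowerSeries.X ^ m + PowerSeries.C (L i 1) * y

/-- The greatest common divisor of `m` and of all exponents `α < n` that occur in `y`. -/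
def gcdBelow (m : ℕ) (y : PowerSeries ℂ) (n : ℕ) : ℕ := by
  classical
  exact Nat.gcd m (((Finset.range n).filter fun α => PowerSeries.coeff α y ≠ 0).gcd id)

/-- The characteristic exponents of `(u ^ m, y(u))`: the number `m`, and the exponents of `y`
at which the greatest common divisor of `m` and the exponents so far drops. -/
def charExponents (m : ℕ) (y : PowerSeries ℂ) : Set ℕ :=
  insert m {α | gcdBelow m y (α + 1) < gcdBelow m y α}

/-- In the linear coordinates given by `L`, the irreducible germ `V(h)` of multiplicity `m` has
the Puiseux parametrization `(u ^ m, y(u))`, where `y` is convergent with all exponents `> m`, and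
the parametrization is primitive, that is `m` and the exponents of `y` have no common divisor. -/
structure IsPuiseuxParametrization (h : ConvSeries) (m : ℕ) (L : GL (Fin 2) ℂ)
    (y : PowerSeries ℂ) : Prop where
  multiplicity : HasMultiplicity h m
  convergent : IsConvergent (σ := Unit) y
  exponents : ∀ α ≤ m, PowerSeries.coeff α y = 0
  primitive : ∃ n, gcdBelow m y n = 1
  vanishes : MvPowerSeries.subst (puiseuxCurve m L y : Fin 2 → MvPowerSeries Unit ℂ) h.1 = 0

/-- `V(h)` has exactly `k` characteristic exponents, `ce(V(h), 0) = k`. -/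
def HasNumCharExponents (h : ConvSeries) (k : ℕ) : Prop :=
  ∃ (m : ℕ) (L : GL (Fin 2) ℂ) (y : PowerSeries ℂ),
    IsPuiseuxParametrization h m L y ∧ (charExponents m y).ncard = k

/-- The class of irreducible plane curve germs of multiplicity `m` with `k` characteristic
exponents. -/
def Branches (m k : ℕ) : Set ConvSeries :=
  {h | Irreducible h ∧ HasMultiplicity h m ∧ HasNumCharExponents h k}

/-- `V(h)` has the least Milnor number among the irreducible plane curve germs of multiplicity `m`
with `k` characteristic exponents. -/
def IsMuMinimal (m k : ℕ) (h : ConvSeries) : Prop :=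
  h ∈ Branches m k ∧ ∀ g ∈ Branches m k, milnorNumber h ≤ milnorNumber g

/-- The nested divisors `d_i = p₁ p₂ ⋯ p_{k-1-i}` of `m = p₁ p₂ ⋯ p_r`, `p₁ ≤ p₂ ≤ ⋯ ≤ p_r` prime
(used for `1 ≤ i ≤ k - 2`). -/
def nestedDivisor (m k i : ℕ) : ℕ :=
  (m.primeFactorsList.take (k - 1 - i)).prod

/-! ### Unfoldings -/

/-- `F (u, t) = φ_t(u)` is (the first component of) a one-parameter unfolding
`(u, t) ↦ (φ_t(u), t)` of the germ of the convergent curve `φ`. -/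
def IsUnfolding (φ : Fin 2 → PowerSeries ℂ) (F : ℂ × ℂ → Fin 2 → ℂ) : Prop :=
  AnalyticAt ℂ F (0, 0) ∧
    ∀ᶠ u in 𝓝 (0 : ℂ), ∀ i, F (u, 0) i = evalAt (σ := Unit) (φ i) fun _ => u

/-- As germs of sets at the origin of `ℂ²`, `S` and `V(h)` coincide. -/
def IsGermOf (S : Set (Fin 2 → ℂ)) (h : ConvSeries) : Prop :=
  ∀ᶠ p in 𝓝 (0 : Fin 2 → ℂ), p ∈ S ↔ evalAt h.1 p = 0

end PlaneCurve

end

open PlaneCurve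

/-!
The Milnor number of an irreducible germ depends only on its Puiseux parametrization
`u ↦ L (u ^ m, y(u))`. Write `D(n)` for the greatest common divisor of `m` and of the exponents of
`y` below `n`; then `μ = ∑_{n ≥ 2} (D(n) - 1)` (`milnorNumber_eq_gcdSum`). To see this, let
`ζ` be a primitive `m`-th root of unity. The equation of the branch pulls back under `x = u ^ m` to
`∏_j (y - y(ζ ^ j u))`, so that its intersection number with its polar curve is
`∑_{j ≠ 0} ord (y(u) - y(ζ ^ j u)) = ∑_{n ≥ 1} (D(n) - 1)` (`colength_polar`, `contactSum_eq`), and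
Teissier's formula, proved by writing the polar curve as a product of branches with the
Newton–Puiseux theorem `exists_ramify_splits`, replaces the equation by its `x`-derivative at the
cost of `m - 1` (`colength_jacobian_add`). Finite colengths are the same for formal and for
convergent power series, by Nakayama's lemma (`colength_conv`).

The values of `D` form a chain of divisors `1 = f 0 ∣ f 1 ∣ ⋯ ∣ f g = m`, with one step for each
characteristic exponent other than `m`. As `D` drops only at multiples of the new value, the sum is
at least `(m - 1) ^ 2 + ∑_{j < g} f j (f (j + 1) - 1)` (`exists_chain_le_gcdSum`), and every chain
is realized with equality by a polynomial parametrization (`exists_branch_of_chain`). So a minimal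
germ corresponds to a chain of minimal weight. The products of the smallest prime factors of `m`
give a chain that is minimal term by term, whence the formula; and the weight decreases strictly if
the end of a chain is replaced by a single step, whence the comparison of different numbers of
characteristic exponents.

For unfoldings, `μ` is also the colength of the ideal generated by the difference quotients
`(φ_i(v) - φ_i(u)) / (v - u)` of any primitive parametrization `φ`
(`milnorNumber_eq_colength_doubleIdeal`). This ideal is given by two power series, whose
coefficients, for the Taylor series of `φ_t` at the preimage of the origin, depend continuously on
`t`; as the colength is upper semicontinuous (`eventually_colength_le`), the Milnor number of `X_t`
is at most that of `X` for small `t`. By minimality, `X_t` cannot have more characteristic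
exponents than `X`.
-/

noncomputable section

namespace PlaneCurve

open Asymptotics

/-! ### Power series in two variables and substitutions -/

open MvPowerSeries in
theorem hasSubst_pair {τ : Type} {a b : MvPowerSeries τ ℂ} (ha : constantCoeff a = 0)
    (hb : constantCoeff b = 0) : HasSubst ![a, b] :=
  hasSubst_of_constantCoeff_zero (by simp [Fin.forall_fin_two, ha, hb])

/-- The ring `ℂ⟦x, y⟧` of formal power series in two variables. -/
abbrev Ser2 : Type := MvPowerSeries (Fin 2) ℂ

/-- The substitution homomorphism `g ↦ g(a, b)`. -/
def substPair {τ : Type} {a b : MvPowerSeries τ ℂ} (ha : MvPowerSeries.constantCoeff a = 0)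
    (hb : MvPowerSeries.constantCoeff b = 0) : Ser2 →ₐ[ℂ] MvPowerSeries τ ℂ :=
  MvPowerSeries.substAlgHom (hasSubst_pair ha hb)

/-- The exponent of the monomial `x ^ i * y ^ j`. -/
def biexp (i j : ℕ) : Fin 2 →₀ ℕ := Finsupp.single 0 i + Finsupp.single 1 j

@[simp] theorem biexp_zero (i j : ℕ) : biexp i j 0 = i := by simp [biexp]
@[simp] theorem biexp_one (i j : ℕ) : biexp i j 1 = j := by simp [biexp]
@[simp] theorem degree_biexp (i j : ℕ) : (biexp i j).degree = i + j := by simp [biexp]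

theorem eq_biexp (d : Fin 2 →₀ ℕ) : d = biexp (d 0) (d 1) := by
  ext i; fin_cases i <;> simp

theorem biexp_inj {i j k l : ℕ} : biexp i j = biexp k l ↔ i = k ∧ j = l := by
  refine ⟨fun h => ⟨by simpa using DFunLike.congr_fun h 0, by simpa using DFunLike.congr_fun h 1⟩, ?_⟩
  rintro ⟨rfl, rfl⟩; rfl

theorem ser2_ext {f g : Ser2}
    (h : ∀ i j, MvPowerSeries.coeff (biexp i j) f = MvPowerSeries.coeff (biexp i j) g) : f = g := by
  ext d; rw [eq_biexp d]; exact h _ _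

/-- The power series with coefficient `c i j` at `x ^ i * y ^ j`. -/
def ofCoeff (c : ℕ → ℕ → ℂ) : Ser2 := fun d => c (d 0) (d 1)

@[simp] theorem coeff_ofCoeff (c : ℕ → ℕ → ℂ) (i j : ℕ) :
    MvPowerSeries.coeff (biexp i j) (ofCoeff c) = c i j := by
  change c (biexp i j 0) (biexp i j 1) = _
  simp

theorem monomial_biexp (i j : ℕ) (c : ℂ) : MvPowerSeries.monomial (biexp i j) c =
    MvPowerSeries.C c * MvPowerSeries.X 0 ^ i * MvPowerSeries.X 1 ^ j := by
  rw [MvPowerSeries.X_pow_eq, MvPowerSeries.X_pow_eq, ← MvPowerSeries.monomial_zero_eq_C_apply,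
    MvPowerSeries.monomial_mul_monomial, MvPowerSeries.monomial_mul_monomial]
  simp [biexp]

/-- The series `a(x)`, `a(y)` in two variables. -/
def ser1 (i : Fin 2) (a : PowerSeries ℂ) : Ser2 := PowerSeries.toMvPowerSeries i a

open MvPowerSeries in
theorem substPair_ser1_zero {τ : Type} {a b : MvPowerSeries τ ℂ} (ha : constantCoeff a = 0)
    (hb : constantCoeff b = 0) (f : PowerSeries ℂ) : substPair ha hb (ser1 0 f) = f.subst a := by
  rw [substPair, coe_substAlgHom, ser1, PowerSeries.subst_toMvPowerSeries (hasSubst_pair ha hb)]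
  rfl

open MvPowerSeries in
theorem substPair_ser1_one {τ : Type} {a b : MvPowerSeries τ ℂ} (ha : constantCoeff a = 0)
    (hb : constantCoeff b = 0) (f : PowerSeries ℂ) : substPair ha hb (ser1 1 f) = f.subst b := by
  rw [substPair, coe_substAlgHom, ser1, PowerSeries.subst_toMvPowerSeries (hasSubst_pair ha hb)]
  rfl

open MvPowerSeries in
theorem constantCoeff_ser1 {i : Fin 2} {a : PowerSeries ℂ} (ha : PowerSeries.constantCoeff a = 0) :
    constantCoeff (ser1 i a) = 0 := by
  rw [ser1, PowerSeries.toMvPowerSeries_eq_subst]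
  exact PowerSeries.constantCoeff_subst_eq_zero (by simp) _ ha

open MvPowerSeries in
@[simp] theorem substPair_X_zero {τ : Type} {a b : MvPowerSeries τ ℂ} (ha : constantCoeff a = 0)
    (hb : constantCoeff b = 0) : substPair ha hb (X 0) = a := by
  rw [substPair, substAlgHom_X]; rfl

open MvPowerSeries in
@[simp] theorem substPair_X_one {τ : Type} {a b : MvPowerSeries τ ℂ} (ha : constantCoeff a = 0)
    (hb : constantCoeff b = 0) : substPair ha hb (X 1) = b := by
  rw [substPair, substAlgHom_X]; rfl

open MvPowerSeries in
/-- Substitutions compose. -/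
theorem substAlgHom_substPair {σ τ : Type} {a b : MvPowerSeries σ ℂ} (ha : constantCoeff a = 0)
    (hb : constantCoeff b = 0) {c : σ → MvPowerSeries τ ℂ} (hc : HasSubst c) {a' b' : MvPowerSeries τ ℂ}
    (ha' : constantCoeff a' = 0) (hb' : constantCoeff b' = 0)
    (h0 : substAlgHom hc a = a') (h1 : substAlgHom hc b = b') (g : Ser2) :
    substAlgHom hc (substPair ha hb g) = substPair ha' hb' g := by
  have key : (fun s => subst c (![a, b] s)) = ![a', b'] := by
    rw [← h0, ← h1, coe_substAlgHom]
    funext i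
    fin_cases i <;> rfl
  simp only [substPair, coe_substAlgHom]
  rw [subst_comp_subst_apply (hasSubst_pair ha hb) hc, key]

/-- A power series in one variable is definitionally a multivariate series over `Unit`; this turns
the hypothesis on the constant coefficient into the form that substitution asks for. -/
theorem cc_mv {a : PowerSeries ℂ} (ha : PowerSeries.constantCoeff a = 0) :
    MvPowerSeries.constantCoeff (σ := Unit) a = 0 := ha

theorem constantCoeff_X_ser1 :
    MvPowerSeries.constantCoeff (PowerSeries.X : PowerSeries ℂ) = 0 := cc_mv (by simp)

open MvPowerSeries in
theorem X_one_dvd_of_subst_eq_zero {g : Ser2}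
    (h : substPair (a := (PowerSeries.X : PowerSeries ℂ)) (b := (0 : PowerSeries ℂ))
      constantCoeff_X_ser1 (map_zero _) g = 0) : (X 1 : Ser2) ∣ g := by
  set r : PowerSeries ℂ := PowerSeries.mk fun n => coeff (biexp n 0) g
  have h1 : (X 1 : Ser2) ∣ g - ser1 0 r := by
    rw [X_dvd_iff]
    intro d hd
    rw [eq_biexp d, hd, map_sub, ser1, PowerSeries.toMvPowerSeries_apply]
    have := coeff_embDomain_rename (R := ℂ) ⟨fun _ : Unit => (0 : Fin 2), fun _ _ _ => rfl⟩ r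
      (Finsupp.single () (d 0))
    rw [Finsupp.embDomain_single] at this
    have h2 : biexp (d 0) 0 = Finsupp.single 0 (d 0) := by simp [biexp]
    rw [h2]
    erw [this]
    change _ - PowerSeries.coeff (d 0) r = 0
    simp [r, h2]
  obtain ⟨k, hk⟩ := h1
  have h2 : ser1 0 r = g - X 1 * k := by rw [← hk]; ring
  have h3 := substPair_ser1_zero (a := (PowerSeries.X : PowerSeries ℂ)) (b := (0 : PowerSeries ℂ))
      constantCoeff_X_ser1 (map_zero _) r
  rw [PowerSeries.X_subst] at h3
  rw [h2, map_sub, h, map_mul, substPair_X_one, zero_mul, sub_zero] at h3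
  rw [← h3] at h2
  simp [ser1] at h2
  exact ⟨k, by linear_combination -h2⟩

/-! ### Colengths of ideals -/

/-- The colength `dim_ℂ A / I` of an ideal. -/
def colength {A : Type} [CommRing A] [Algebra ℂ A] (I : Ideal A) : ℕ∞ := Module.length ℂ (A ⧸ I)

section Colength

variable {A B : Type} [CommRing A] [Algebra ℂ A] [CommRing B] [Algebra ℂ B]

theorem colength_le_of_le {I J : Ideal A} (h : I ≤ J) : colength J ≤ colength I :=
  Module.length_le_of_surjective ((Submodule.factor h).restrictScalars ℂ)
    (Submodule.factor_surjective h)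

theorem colength_map_equiv (e : A ≃ₐ[ℂ] B) (I : Ideal A) :
    colength (I.map (e : A →+* B)) = colength I :=
  (Ideal.quotientEquivAlg I _ e rfl).toLinearEquiv.length_eq.symm

theorem colength_comap_of_surjective (f : A →ₐ[ℂ] B) (hf : Function.Surjective f) (J : Ideal B) :
    colength (J.comap f) = colength J :=
  (AlgEquiv.ofBijective (Ideal.quotientMapₐ J f le_rfl)
    ⟨Ideal.quotientMap_injective, Ideal.quotientMap_surjective (H := le_rfl) hf⟩).toLinearEquiv.length_eq

/-- Colength is additive in one generator of an ideal with two generators, if the other generator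
is regular modulo a factor. -/
theorem colength_span_mul_pair {f₁ f₂ g : A} (h0 : ∀ d, f₁ * d = 0 → d = 0)
    (h1 : ∀ d, f₁ ∣ g * d → f₁ ∣ d) :
    colength (Ideal.span {f₁ * f₂, g}) =
      colength (Ideal.span {f₂, g}) + colength (Ideal.span {f₁, g}) := by
  have hle : Ideal.span {f₁ * f₂, g} ≤ Ideal.span {f₁, g} := by
    rw [Ideal.span_le]
    rintro x (rfl | rfl)
    · exact Ideal.mul_mem_right _ _ (Ideal.subset_span (by simp))
    · exact Ideal.subset_span (by simp)
  have hmul : Ideal.span {f₂, g} ≤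
      Submodule.comap (LinearMap.mulLeft A f₁) (Ideal.span {f₁ * f₂, g}) := by
    intro x hx
    obtain ⟨a, b, rfl⟩ := Ideal.mem_span_pair.1 hx
    refine Ideal.mem_span_pair.2 ⟨a, f₁ * b, ?_⟩
    simp; ring
  refine Module.length_eq_add_of_exact
    ((Submodule.mapQ _ _ (LinearMap.mulLeft A f₁) hmul).restrictScalars ℂ)
    ((Submodule.factor hle).restrictScalars ℂ) ?_ (Submodule.factor_surjective hle) ?_
  · intro x y hxy
    obtain ⟨x, rfl⟩ := Submodule.Quotient.mk_surjective _ x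
    obtain ⟨y, rfl⟩ := Submodule.Quotient.mk_surjective _ y
    simp only [LinearMap.coe_restrictScalars, Submodule.mapQ_apply, LinearMap.mulLeft_apply] at hxy
    rw [Submodule.Quotient.eq] at hxy ⊢
    obtain ⟨a, b, hab⟩ := Ideal.mem_span_pair.1 hxy
    obtain ⟨c, rfl⟩ : f₁ ∣ b := h1 b ⟨x - y - a * f₂, by linear_combination hab⟩
    refine Ideal.mem_span_pair.2 ⟨a, c, ?_⟩
    have := h0 (x - y - a * f₂ - c * g) (by linear_combination -hab)
    linear_combination -this
  · intro x
    obtain ⟨x, rfl⟩ := Submodule.Quotient.mk_surjective _ x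
    constructor
    · intro h
      have hx : x ∈ Ideal.span {f₁, g} := by simpa using! (Submodule.Quotient.mk_eq_zero _).1 h
      obtain ⟨a, b, rfl⟩ := Ideal.mem_span_pair.1 hx
      refine ⟨Submodule.Quotient.mk a, ?_⟩
      simp only [LinearMap.coe_restrictScalars, Submodule.mapQ_apply, LinearMap.mulLeft_apply]
      rw [Submodule.Quotient.eq]
      exact Ideal.mem_span_pair.2 ⟨0, -b, by ring⟩
    · rintro ⟨y, hy⟩
      obtain ⟨y, rfl⟩ := Submodule.Quotient.mk_surjective _ y
      rw [← hy]
      refine (Submodule.Quotient.mk_eq_zero _).2 ?_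
      exact Ideal.mul_mem_right _ _ (Ideal.subset_span (by simp))

end Colength

theorem colength_span_X_pow (n : ℕ) :
    colength (Ideal.span {(PowerSeries.X : PowerSeries ℂ) ^ n}) = n := by
  let φ : PowerSeries ℂ →ₗ[ℂ] (Fin n → ℂ) := LinearMap.pi fun i => PowerSeries.coeff (i : ℕ)
  have hker : LinearMap.ker φ =
      (Ideal.span {(PowerSeries.X : PowerSeries ℂ) ^ n}).restrictScalars ℂ := by
    ext f
    rw [LinearMap.mem_ker, Submodule.restrictScalars_mem, Ideal.mem_span_singleton,
      PowerSeries.X_pow_dvd_iff, funext_iff]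
    exact ⟨fun h i hi => h ⟨i, hi⟩, fun h i => h i i.2⟩
  have hsurj : Function.Surjective φ := by
    intro v
    refine ⟨PowerSeries.mk fun i => if h : i < n then v ⟨i, h⟩ else 0, ?_⟩
    ext i
    simp [φ]
  have e1 := (φ.quotKerEquivOfSurjective hsurj).length_eq
  rw [hker] at e1
  have e2 : Module.length ℂ (Fin n → ℂ) = n := by simp [Module.length_eq_finrank]
  rw [← e2, ← e1]
  rfl

theorem colength_bot_powerSeries : colength (⊥ : Ideal (PowerSeries ℂ)) = ⊤ := by
  refine ENat.eq_top_iff_forall_ge.2 fun n => ?_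
  rw [← colength_span_X_pow]
  exact colength_le_of_le bot_le

theorem colength_span_singleton (a : PowerSeries ℂ) : colength (Ideal.span {a}) = a.order := by
  by_cases ha : a = 0
  · rw [ha, PowerSeries.order_zero, ← colength_bot_powerSeries]
    congr 1
    exact Ideal.span_singleton_eq_bot.2 rfl
  have h := PowerSeries.coe_toNat_order ha
  rw [← h, ← colength_span_X_pow]
  congr 1
  rw [Ideal.span_singleton_eq_span_singleton]
  have h2 := PowerSeries.X_pow_order_mul_divXPowOrder (f := a)
  refine Associated.symm ⟨(PowerSeries.isUnit_divided_by_X_pow_order ha).unit, ?_⟩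
  simpa using h2

/-! ### Intersection multiplicities with smooth branches -/

open MvPowerSeries in
/-- The restriction `g(a(s), b(s))` of `g` to a formal parametrized curve. -/
def curveEval (a b : PowerSeries ℂ) (g : Ser2) : PowerSeries ℂ :=
  subst (![a, b] : Fin 2 → MvPowerSeries Unit ℂ) g

theorem curveEval_eq {a b : PowerSeries ℂ} (ha : MvPowerSeries.constantCoeff (σ := Unit) a = 0)
    (hb : MvPowerSeries.constantCoeff (σ := Unit) b = 0) (g : Ser2) :
    curveEval a b g = substPair ha hb g := by
  rw [substPair, MvPowerSeries.coe_substAlgHom]; rfl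

open MvPowerSeries in
theorem X_one_sub_dvd {y : PowerSeries ℂ} (hy : constantCoeff (σ := Unit) y = 0) {g : Ser2}
    (h : curveEval PowerSeries.X y g = 0) : X 1 - ser1 0 y ∣ g := by
  have c0 : constantCoeff (X 0 : Ser2) = 0 := by simp
  have c1 : constantCoeff (X 1 + ser1 0 y : Ser2) = 0 := by simp [constantCoeff_ser1 hy]
  have c2 : constantCoeff (X 1 - ser1 0 y : Ser2) = 0 := by simp [constantCoeff_ser1 hy]
  have hX0 : PowerSeries.subst (X 0 : Ser2) y = ser1 0 y := by
    rw [ser1, PowerSeries.toMvPowerSeries_eq_subst]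
  -- the coordinate change `y ↦ y + y(x)` and its inverse
  have h1 : substPair c0 c2 (substPair c0 c1 g) = g := by
    rw [substPair, substAlgHom_substPair c0 c1 _ (a' := X 0) (b' := X 1) c0 (by simp),
      substPair, coe_substAlgHom]
    · have : (![X 0, X 1] : Fin 2 → Ser2) = X := by funext i; fin_cases i <;> rfl
      rw [this, subst_self]; rfl
    · rw [substAlgHom_X]; rfl
    · change substPair c0 c2 _ = _
      rw [map_add, substPair_X_one, substPair_ser1_zero, hX0]; ring
  have h2 : substPair constantCoeff_X_ser1 (map_zero _) (substPair c0 c1 g) = 0 := by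
    refine Eq.trans ?_ h
    rw [curveEval_eq constantCoeff_X_ser1 hy]
    rw [substPair, substAlgHom_substPair c0 c1 _ constantCoeff_X_ser1 hy]
    · rw [substAlgHom_X]; rfl
    · change substPair constantCoeff_X_ser1 (map_zero _) _ = _
      rw [map_add, substPair_X_one, substPair_ser1_zero, PowerSeries.X_subst, zero_add]
  obtain ⟨k, hk⟩ := X_one_dvd_of_subst_eq_zero h2
  refine ⟨substPair c0 c2 k, ?_⟩
  rw [← h1, hk, map_mul, substPair_X_one]

theorem curveEval_mul {a b : PowerSeries ℂ} (ha : MvPowerSeries.constantCoeff (σ := Unit) a = 0)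
    (hb : MvPowerSeries.constantCoeff (σ := Unit) b = 0) (g g' : Ser2) :
    curveEval a b (g * g') = curveEval a b g * curveEval a b g' := by
  simp only [curveEval_eq ha hb]; exact map_mul _ _ _

theorem curveEval_X_sub {y z : PowerSeries ℂ} (hz : MvPowerSeries.constantCoeff (σ := Unit) z = 0) :
    curveEval PowerSeries.X z (MvPowerSeries.X 1 - ser1 0 y) = z - y := by
  rw [curveEval_eq constantCoeff_X_ser1 hz]
  refine (map_sub _ _ _).trans ?_
  rw [substPair_X_one, substPair_ser1_zero, PowerSeries.X_subst]

theorem X_one_sub_ne_zero (y : PowerSeries ℂ) (hy : MvPowerSeries.constantCoeff (σ := Unit) y = 0) :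
    (MvPowerSeries.X 1 - ser1 0 y : Ser2) ≠ 0 := by
  -- evaluate on the curve `(X, y + X)`
  intro h
  have hz : MvPowerSeries.constantCoeff (σ := Unit) (y + PowerSeries.X) = 0 :=
    (map_add _ _ _).trans (by rw [hy, constantCoeff_X_ser1, add_zero])
  have := curveEval_X_sub (y := y) hz
  rw [h, curveEval_eq constantCoeff_X_ser1 hz, map_zero] at this
  simp only [add_sub_cancel_left] at this
  exact PowerSeries.X_ne_zero this.symm

/-- The intersection multiplicity of a smooth branch `y = y(x)` with `V(g)`. -/
theorem colength_span_branch {y : PowerSeries ℂ}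
    (hy : MvPowerSeries.constantCoeff (σ := Unit) y = 0) (g : Ser2) :
    colength (Ideal.span {MvPowerSeries.X 1 - ser1 0 y, g}) =
      (curveEval PowerSeries.X y g).order := by
  have hsurj : Function.Surjective (substPair constantCoeff_X_ser1 hy) := fun a =>
    ⟨ser1 0 a, by rw [substPair_ser1_zero, PowerSeries.X_subst]⟩
  have h0 := curveEval_eq constantCoeff_X_ser1 hy g
  rw [h0]
  refine Eq.trans ?_ (colength_span_singleton _)
  refine Eq.trans ?_ (colength_comap_of_surjective _ hsurj _)
  congr 1
  ext f
  rw [Ideal.mem_comap, Ideal.mem_span_pair]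
  constructor
  · rintro ⟨a, b, rfl⟩
    refine Ideal.mem_span_singleton'.2 ⟨substPair constantCoeff_X_ser1 hy b, ?_⟩
    have h1 : substPair constantCoeff_X_ser1 hy (MvPowerSeries.X 1 - ser1 0 y) = 0 := by
      rw [← curveEval_eq, curveEval_X_sub hy, sub_self]
    rw [map_add, map_mul, map_mul]
    change _ = _ * substPair constantCoeff_X_ser1 hy (MvPowerSeries.X 1 - ser1 0 y) + _
    rw [h1, mul_zero, zero_add]
  · intro h
    obtain ⟨b, hb⟩ := Ideal.mem_span_singleton'.1 h
    obtain ⟨b, rfl⟩ := hsurj b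
    obtain ⟨k, hk⟩ := X_one_sub_dvd hy (g := f - b * g) (by
      rw [curveEval_eq constantCoeff_X_ser1 hy, map_sub, map_mul]
      exact sub_eq_zero.2 hb.symm)
    exact ⟨k, b, by rw [mul_comm k, ← hk]; ring⟩

/-- Intersection multiplicities with a union of smooth branches. -/
theorem colength_span_prod_branch (s : Multiset (PowerSeries ℂ)) {g : Ser2}
    (hs : ∀ y ∈ s, MvPowerSeries.constantCoeff (σ := Unit) y = 0)
    (hg : ∀ y ∈ s, curveEval PowerSeries.X y g ≠ 0) :
    colength (Ideal.span {(s.map fun y => (MvPowerSeries.X 1 - ser1 0 y : Ser2)).prod, g}) =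
      (s.map fun y => (curveEval PowerSeries.X y g).order).sum := by
  induction s using Multiset.induction_on with
  | empty =>
    have : Ideal.span {(1 : Ser2), g} = ⊤ := Ideal.eq_top_of_unit_mem _ 1 1
      (Ideal.subset_span (by simp)) (by simp)
    simp only [Multiset.map_zero, Multiset.prod_zero, Multiset.sum_zero, this]
    exact Module.length_eq_zero
  | cons y s ih =>
    have hy := hs y (by simp)
    have hgy := hg y (by simp)
    rw [Multiset.map_cons, Multiset.prod_cons, colength_span_mul_pair, Multiset.map_cons,
      Multiset.sum_cons, colength_span_branch hy g,
      ih (fun z hz => hs z (by simp [hz])) fun z hz => hg z (by simp [hz]), add_comm]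
    · intro d hd
      exact (mul_eq_zero.1 hd).resolve_left (X_one_sub_ne_zero y hy)
    · rintro d ⟨k, hk⟩
      apply X_one_sub_dvd hy
      have h1 := congrArg (curveEval PowerSeries.X y) hk
      rw [curveEval_mul constantCoeff_X_ser1 hy, curveEval_mul constantCoeff_X_ser1 hy,
        curveEval_X_sub hy, sub_self, zero_mul] at h1
      exact (mul_eq_zero.1 h1).resolve_left hgy

/-! ### Ramified coverings `x = s ^ n` -/

open MvPowerSeries in
/-- The pullback `g(x ^ n, y)`. -/
def pullback (n : ℕ) (g : Ser2) : Ser2 :=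
  ofCoeff fun i j => if n ∣ i then coeff (biexp (i / n) j) g else 0

open MvPowerSeries in
theorem coeff_pullback (n : ℕ) (g : Ser2) (i j : ℕ) : coeff (biexp i j) (pullback n g) =
    if n ∣ i then coeff (biexp (i / n) j) g else 0 := by
  rw [pullback, coeff_ofCoeff]

theorem constantCoeff_X_pow {σ : Type} (i : σ) {n : ℕ} (hn : n ≠ 0) :
    MvPowerSeries.constantCoeff (MvPowerSeries.X i ^ n : MvPowerSeries σ ℂ) = 0 := by
  simp [hn]

theorem constantCoeff_X_one : MvPowerSeries.constantCoeff (MvPowerSeries.X 1 : Ser2) = 0 := by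
  simp

open MvPowerSeries in
theorem pullback_eq_substPair {n : ℕ} (hn : n ≠ 0) (g : Ser2) :
    pullback n g = substPair (constantCoeff_X_pow 0 hn) constantCoeff_X_one g := by
  apply ser2_ext
  intro i j
  rw [coeff_pullback, substPair, coe_substAlgHom, coeff_subst (hasSubst_pair (constantCoeff_X_pow 0 hn) constantCoeff_X_one)]
  have key : ∀ d : Fin 2 →₀ ℕ, coeff (biexp i j)
      (d.prod fun s e => (![X 0 ^ n, X 1] : Fin 2 → Ser2) s ^ e) =
        if i = n * d 0 ∧ j = d 1 then 1 else 0 := by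
    intro d
    rw [Finsupp.prod_fintype _ _ (by simp), Fin.prod_univ_two]
    have := monomial_biexp (n * d 0) (d 1) 1
    rw [map_one MvPowerSeries.C, one_mul, pow_mul] at this
    change coeff (biexp i j) ((X 0 ^ n) ^ d 0 * X 1 ^ d 1) = _
    rw [← this, coeff_monomial]
    simp only [biexp_inj]
  simp only [key, smul_eq_mul, mul_ite, mul_one, mul_zero]
  split_ifs with h
  · obtain ⟨k, rfl⟩ := h
    rw [finsum_eq_single _ (biexp k j), if_pos (by simp), Nat.mul_div_cancel_left _ (by omega)]
    intro d hd
    rw [if_neg]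
    rintro ⟨h1, h2⟩
    apply hd
    rw [eq_biexp d, biexp_inj]
    exact ⟨(Nat.eq_of_mul_eq_mul_left (by omega) h1).symm, h2.symm⟩
  · symm
    apply finsum_eq_zero_of_forall_eq_zero
    intro d
    rw [if_neg]
    rintro ⟨h1, h2⟩
    exact h ⟨_, h1⟩

open MvPowerSeries in
/-- The decomposition `ℂ⟦s, y⟧ = ⨁_{j < n} s ^ j ℂ⟦s ^ n, y⟧`. -/
def pullbackSum (n : ℕ) (hn : n ≠ 0) : (Fin n → Ser2) →ₗ[ℂ] Ser2 where
  toFun v := ∑ j : Fin n, X 0 ^ (j : ℕ) * substPair (constantCoeff_X_pow 0 hn) constantCoeff_X_one (v j)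
  map_add' v w := by simp [mul_add, Finset.sum_add_distrib]
  map_smul' c v := by simp [Finset.smul_sum]

open MvPowerSeries in
theorem coeff_pullbackSum (n : ℕ) (hn : n ≠ 0) (v : Fin n → Ser2) (i k : ℕ) (j : Fin n) :
    coeff (biexp (n * i + j) k) (pullbackSum n hn v) = coeff (biexp i k) (v j) := by
  have h : ∀ l : Fin n, coeff (biexp (n * i + j) k) (X 0 ^ (l : ℕ) *
      substPair (constantCoeff_X_pow 0 hn) constantCoeff_X_one (v l)) =
        if l = j then coeff (biexp i k) (v j) else 0 := by
    intro l
    rw [← pullback_eq_substPair hn, X_pow_eq, coeff_monomial_mul, one_mul]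
    have hle : (Finsupp.single 0 (l : ℕ) : Fin 2 →₀ ℕ) ≤ biexp (n * i + j) k ↔
        (l : ℕ) ≤ n * i + j := by
      rw [Finsupp.single_le_iff]; simp
    have hsub : biexp (n * i + j) k - Finsupp.single 0 (l : ℕ) = biexp (n * i + j - l) k := by
      ext s; fin_cases s <;> simp
    rw [hsub, coeff_pullback]
    simp only [hle]
    by_cases hl : l = j
    · subst hl
      simp [Nat.mul_div_cancel_left _ (Nat.pos_of_ne_zero hn)]
    · rw [if_neg hl]
      split_ifs with h1 h2
      · exfalso
        apply hl
        obtain ⟨q, hq⟩ := h2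
        have h3 : n * i + (j : ℕ) = n * q + l := by omega
        have h4 := congrArg (· % n) h3
        simp only [Nat.mul_add_mod, Nat.mod_eq_of_lt j.2, Nat.mod_eq_of_lt l.2] at h4
        exact Fin.ext h4.symm
      · rfl
      · rfl
  change coeff (biexp (n * i + j) k) (∑ l : Fin n, X 0 ^ (l : ℕ) *
      substPair (constantCoeff_X_pow 0 hn) constantCoeff_X_one (v l)) = _
  rw [map_sum, Finset.sum_congr rfl fun l _ => h l]
  simp

theorem pullbackSum_bijective (n : ℕ) (hn : n ≠ 0) : Function.Bijective (pullbackSum n hn) := by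
  constructor
  · intro v w h
    funext j
    apply ser2_ext
    intro i k
    rw [← coeff_pullbackSum n hn v, h, coeff_pullbackSum]
  · intro g
    refine ⟨fun j => ofCoeff fun i k => MvPowerSeries.coeff (biexp (n * i + j) k) g, ?_⟩
    apply ser2_ext
    intro i k
    have hi : i = n * (i / n) + ((⟨i % n, Nat.mod_lt _ (by omega)⟩ : Fin n) : ℕ) :=
      (Nat.div_add_mod i n).symm
    rw [hi, coeff_pullbackSum, coeff_ofCoeff]

/-- Pulling back along `x = s ^ n` multiplies intersection multiplicities by `n`. -/
theorem colength_pullback {n : ℕ} (hn : n ≠ 0) (a b : Ser2) :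
    colength (Ideal.span {pullback n a, pullback n b}) = n * colength (Ideal.span {a, b}) := by
  set I := Ideal.span {a, b}
  set J := Ideal.span {pullback n a, pullback n b}
  set P := substPair (constantCoeff_X_pow (0 : Fin 2) hn) constantCoeff_X_one
  have hmul : ∀ (c : Ser2) (v : Fin n → Ser2),
      pullbackSum n hn (fun j => c * v j) = pullback n c * pullbackSum n hn v := by
    intro c v
    rw [pullback_eq_substPair hn]
    change ∑ j : Fin n, _ = _ * ∑ j : Fin n, _
    rw [Finset.mul_sum]
    refine Finset.sum_congr rfl fun j _ => ?_
    rw [map_mul]; ring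
  let e := LinearEquiv.ofBijective _ (pullbackSum_bijective n hn)
  have hmap : (Submodule.pi Set.univ fun _ : Fin n => I.restrictScalars ℂ).map
      (e : (Fin n → Ser2) →ₗ[ℂ] Ser2) = J.restrictScalars ℂ := by
    ext f
    rw [Submodule.mem_map, Submodule.restrictScalars_mem]
    constructor
    · rintro ⟨v, hv, rfl⟩
      change ∑ j : Fin n, _ ∈ J
      refine Ideal.sum_mem _ fun j _ => Ideal.mul_mem_left _ _ ?_
      obtain ⟨c, d, hcd⟩ := Ideal.mem_span_pair.1 (hv j trivial)
      rw [← hcd, map_add, map_mul, map_mul, ← pullback_eq_substPair hn a,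
        ← pullback_eq_substPair hn b]
      exact Ideal.mem_span_pair.2 ⟨_, _, rfl⟩
    · intro hf
      obtain ⟨c, d, rfl⟩ := Ideal.mem_span_pair.1 hf
      obtain ⟨v, rfl⟩ := (pullbackSum_bijective n hn).2 c
      obtain ⟨w, rfl⟩ := (pullbackSum_bijective n hn).2 d
      refine ⟨(fun j => a * v j) + fun j => b * w j, fun j _ => ?_, ?_⟩
      · exact Ideal.mem_span_pair.2 ⟨v j, w j, by simp [mul_comm]⟩
      · change pullbackSum n hn _ = _
        rw [map_add, hmul, hmul]; ring
  have e1 := (Submodule.Quotient.equiv _ _ e hmap).length_eq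
  have e2 := (Submodule.quotientPi fun _ : Fin n => I.restrictScalars ℂ).length_eq
  have e3 : Module.length ℂ (Fin n → Ser2 ⧸ I.restrictScalars ℂ) = n * colength I := by
    rw [Module.length_pi]; simp; rfl
  change Module.length ℂ (Ser2 ⧸ J.restrictScalars ℂ) = _
  rw [← e1, e2, e3]

/-! ### The Newton–Puiseux theorem -/

instance : IsAdicComplete (IsLocalRing.maximalIdeal (PowerSeries ℂ)) (PowerSeries ℂ) := by
  have hmem : ∀ (n : ℕ) (a b : PowerSeries ℂ),
      a ≡ b [SMOD (IsLocalRing.maximalIdeal (PowerSeries ℂ) ^ n • ⊤ :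
        Submodule (PowerSeries ℂ) (PowerSeries ℂ))] ↔
        ∀ i < n, PowerSeries.coeff i a = PowerSeries.coeff i b := by
    intro n a b
    rw [SModEq.sub_mem, PowerSeries.maximalIdeal_eq_span_X, Ideal.span_singleton_pow, smul_eq_mul,
      Ideal.mul_top, Ideal.mem_span_singleton, PowerSeries.X_pow_dvd_iff]
    simp [sub_eq_zero]
  have h1 : IsHausdorff (IsLocalRing.maximalIdeal (PowerSeries ℂ)) (PowerSeries ℂ) := by
    refine ⟨fun x hx => ?_⟩
    ext i
    exact (hmem (i + 1) x 0).1 (hx _) i (Nat.lt_succ_self i)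
  have h2 : IsPrecomplete (IsLocalRing.maximalIdeal (PowerSeries ℂ)) (PowerSeries ℂ) := by
    refine ⟨fun f hf => ⟨PowerSeries.mk fun i => PowerSeries.coeff i (f (i + 1)), fun n => ?_⟩⟩
    rw [hmem]
    intro i hi
    rw [PowerSeries.coeff_mk]
    exact ((hmem _ _ _).1 (hf (show i + 1 ≤ n from hi)) i (Nat.lt_succ_self i)).symm
  exact { h1, h2 with }

theorem residue_eq_zero_iff (a : PowerSeries ℂ) :
    IsLocalRing.residue (PowerSeries ℂ) a = 0 ↔ PowerSeries.constantCoeff a = 0 := by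
  rw [IsLocalRing.residue_eq_zero_iff, PowerSeries.maximalIdeal_eq_span_X,
    Ideal.mem_span_singleton, PowerSeries.X_dvd_iff]

/-- If `g` is a series over `ℂ⟦s⟧` whose reduction at `s = 0` has order exactly `k`, then `g` is the
product of a unit and a distinguished polynomial of degree `k`. -/
theorem exists_weierstrass (g : PowerSeries (PowerSeries ℂ)) (k : ℕ)
    (h0 : ∀ i < k, PowerSeries.constantCoeff (PowerSeries.coeff i g) = 0)
    (hk : PowerSeries.constantCoeff (PowerSeries.coeff k g) ≠ 0) :
    ∃ (f : Polynomial (PowerSeries ℂ)) (u : PowerSeries (PowerSeries ℂ)), IsUnit u ∧ f.Monic ∧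
      f.IsDistinguishedAt (IsLocalRing.maximalIdeal (PowerSeries ℂ)) ∧ f.natDegree = k ∧
      g = f * u := by
  have hord : (g.map (IsLocalRing.residue (PowerSeries ℂ))).order = k := by
    rw [PowerSeries.order_eq_nat]
    refine ⟨?_, fun i hi => ?_⟩
    · rw [PowerSeries.coeff_map, Ne, residue_eq_zero_iff]; exact hk
    · rw [PowerSeries.coeff_map, residue_eq_zero_iff]; exact h0 i hi
  have hne : g.map (IsLocalRing.residue (PowerSeries ℂ)) ≠ 0 := by
    rw [← PowerSeries.order_finite_iff_ne_zero, hord]; exact ENat.natCast_lt_top k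
  obtain ⟨f, u, H⟩ := PowerSeries.exists_isWeierstrassFactorization hne
  refine ⟨f, u, H.isUnit, H.isDistinguishedAt.monic, H.isDistinguishedAt, ?_, H.eq_mul⟩
  rw [H.natDegree_eq_toNat_order_map, hord]; rfl

/-- A special case of Hensel's lemma: a monic polynomial over `ℂ⟦s⟧` has a factor whose roots are
the ones that vanish at `s = 0`. -/
theorem exists_factor (Q : Polynomial (PowerSeries ℂ)) (hQ : Q.Monic) (k : ℕ)
    (h0 : ∀ i < k, PowerSeries.constantCoeff (Q.coeff i) = 0)
    (hk : PowerSeries.constantCoeff (Q.coeff k) ≠ 0) :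
    ∃ f g : Polynomial (PowerSeries ℂ), f.Monic ∧ g.Monic ∧ f.natDegree = k ∧ Q = f * g := by
  obtain ⟨f, u, hu, hf, hd, hfk, hfu⟩ := exists_weierstrass (Q : PowerSeries (PowerSeries ℂ)) k
    (by simpa using h0) (by simpa using hk)
  have hdiv := Polynomial.modByMonic_add_div Q f
  have hWD := hd.isWeierstrassDivisorAt'
  have hdeg : ((((f : PowerSeries (PowerSeries ℂ)).map (Ideal.Quotient.mk
      (IsLocalRing.maximalIdeal (PowerSeries ℂ)))).order.toNat : ℕ) : WithBot ℕ) = f.degree := by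
    have := hd.coe_natDegree_eq_order_map (f : PowerSeries (PowerSeries ℂ)) 1 (by
      rw [map_one, ← Ideal.ne_top_iff_one]; exact Ideal.IsMaximal.ne_top inferInstance) (by simp)
    rw [← this, Polynomial.degree_eq_natDegree hf.ne_zero]
    rfl
  have huniq := hWD.eq_of_mul_add_eq_mul_add (q := u) (r := 0)
    (q' := ((Q /ₘ f : Polynomial (PowerSeries ℂ)) : PowerSeries (PowerSeries ℂ))) (r' := Q %ₘ f)
    (by rw [hdeg, Polynomial.degree_zero]; exact bot_lt_iff_ne_bot.2 (by simpa using hf.ne_zero))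
    (by rw [hdeg]; exact Polynomial.degree_modByMonic_lt _ hf)
    (by rw [Polynomial.coe_zero, add_zero, ← hfu, ← Polynomial.coe_mul, ← Polynomial.coe_add,
          add_comm, hdiv])
  rw [← huniq.2, zero_add] at hdiv
  exact ⟨f, Q /ₘ f, hf, hf.of_mul_monic_left (by rwa [hdiv]), hfk, hdiv.symm⟩

theorem monic_taylor {R : Type} [CommRing R] {P : Polynomial R} (hP : P.Monic) (r : R) :
    (P.taylor r).Monic := (Polynomial.leadingCoeff_taylor r P).trans hP

theorem coeff_taylor_of_natDegree_eq {R : Type} [CommRing R] {P : Polynomial R} (hP : P.Monic)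
    {d : ℕ} (hd : P.natDegree = d + 1) (r : R) :
    (P.taylor r).coeff d = P.coeff d + (d + 1) * r := by
  have h1 : (Polynomial.hasseDeriv d P).natDegree < 2 :=
    lt_of_le_of_lt (Polynomial.natDegree_hasseDeriv_le P d) (by omega)
  rw [Polynomial.taylor_coeff, Polynomial.eval_eq_sum_range' h1]
  have h2 : P.coeff (1 + d) = 1 := by rw [add_comm, ← hd]; exact hP
  simp [Finset.sum_range_succ, Polynomial.hasseDeriv_coeff, h2]
  rw [add_comm 1 d, Nat.choose_succ_self_right]
  push_cast; ring

/-- Base change along `s ↦ s ^ n`. -/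
abbrev ramify (n : ℕ) (hn : n ≠ 0) : PowerSeries ℂ →+* PowerSeries ℂ :=
  (PowerSeries.expand n hn : PowerSeries ℂ →ₐ[ℂ] PowerSeries ℂ)

theorem splits_ramify_mul {P : Polynomial (PowerSeries ℂ)} {n : ℕ} (hn : n ≠ 0)
    (h : (P.map (ramify n hn)).Splits) (k : ℕ) (hk : k ≠ 0) :
    (P.map (ramify (k * n) (mul_ne_zero hk hn))).Splits := by
  have : ramify (k * n) (mul_ne_zero hk hn) = (ramify k hk).comp (ramify n hn) := by
    ext1 f
    exact PowerSeries.expand_mul _ hk _ hn _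
  rw [this, ← Polynomial.map_map]
  exact h.map _

/-- The step of the Newton polygon algorithm: after a ramification and a division of the roots by a
power of `s`, a monic polynomial without second highest coefficient becomes a polynomial whose
reduction at `s = 0` has a nonzero lower coefficient. -/
theorem exists_scaleRoots (P : Polynomial (PowerSeries ℂ)) (hP : P.Monic) {i₁ : ℕ}
    (hi₁ : i₁ < P.natDegree) (hne : P.coeff i₁ ≠ 0) :
    ∃ (N : ℕ) (hN : N ≠ 0) (p : ℕ) (Q : Polynomial (PowerSeries ℂ)), Q.Monic ∧
      Q.natDegree = P.natDegree ∧ P.map (ramify N hN) = Q.scaleRoots (PowerSeries.X ^ p) ∧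
      (∀ i, P.coeff i = 0 → Q.coeff i = 0) ∧
      ∃ i < P.natDegree, PowerSeries.constantCoeff (Q.coeff i) ≠ 0 := by
  classical
  set d := P.natDegree with hd
  have hN : d.factorial ≠ 0 := Nat.factorial_ne_zero d
  set N := d.factorial with hNdef
  let e : ℕ → ℕ := fun i => N / (d - i) * (P.coeff i).order.toNat
  obtain ⟨i₀, hi₀, hmin⟩ := Finset.exists_min_image
    ((Finset.range d).filter fun i => P.coeff i ≠ 0) e ⟨i₁, by simp [hi₁, hne]⟩
  simp only [Finset.mem_filter, Finset.mem_range] at hi₀ hmin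
  set p := e i₀ with hp
  have hmul : ∀ i < d, (d - i) * e i = N * (P.coeff i).order.toNat := by
    intro i hi
    have : (d - i) ∣ N := Nat.dvd_factorial (by omega) (by omega)
    rw [← mul_assoc, Nat.mul_div_cancel' this]
  have hord : ∀ i, P.coeff i ≠ 0 → (ramify N hN (P.coeff i)).order =
      ((N * (P.coeff i).order.toNat : ℕ) : ℕ∞) := by
    intro i hi
    refine (PowerSeries.order_expand N hN _).trans ?_
    rw [nsmul_eq_mul, Nat.cast_mul, PowerSeries.coe_toNat_order hi]
  have hdvd : ∀ i, ∃ b : PowerSeries ℂ, ramify N hN (P.coeff i) = b * (PowerSeries.X ^ p) ^ (d - i)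
      ∧ (P.coeff i = 0 → b = 0) := by
    intro i
    by_cases h : P.coeff i = 0
    · exact ⟨0, by rw [h, map_zero, zero_mul], fun _ => rfl⟩
    by_cases hi : i < d
    · have h1 : (PowerSeries.X ^ p) ^ (d - i) ∣ ramify N hN (P.coeff i) := by
        rw [← pow_mul, PowerSeries.X_pow_dvd_iff]
        intro l hl
        apply PowerSeries.coeff_of_lt_order
        rw [hord i h, ← hmul i hi]
        have := Nat.mul_le_mul_left (d - i) (hmin i ⟨hi, h⟩)
        have h3 : p * (d - i) = (d - i) * e i₀ := by rw [hp, mul_comm]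
        exact_mod_cast lt_of_lt_of_le hl (h3 ▸ this)
      obtain ⟨b, hb⟩ := h1
      exact ⟨b, by rw [hb, mul_comm], fun h' => absurd h' h⟩
    · exact ⟨ramify N hN (P.coeff i), by rw [Nat.sub_eq_zero_of_le (not_lt.1 hi)]; simp,
        fun h' => absurd h' h⟩
  choose b hb hb0 using hdvd
  have hbd : b d = 1 := by
    have := hb d
    rw [Nat.sub_self, pow_zero, mul_one, show P.coeff d = 1 from hP, map_one] at this
    exact this.symm
  let Q : Polynomial (PowerSeries ℂ) := ∑ i ∈ Finset.range (d + 1), Polynomial.monomial i (b i)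
  have hQc : ∀ i, Q.coeff i = b i := by
    intro i
    simp only [Q, Polynomial.finsetSum_coeff, Polynomial.coeff_monomial]
    rw [Finset.sum_ite_eq' (Finset.range (d + 1)) i b]
    split_ifs with h
    · rfl
    · refine (hb0 i (Polynomial.coeff_eq_zero_of_natDegree_lt ?_)).symm
      simp at h; omega
  have hQd : Q.natDegree = d := by
    apply Polynomial.natDegree_eq_of_le_of_coeff_ne_zero
    · rw [Polynomial.natDegree_le_iff_coeff_eq_zero]
      intro i hi
      rw [hQc]
      exact hb0 i (Polynomial.coeff_eq_zero_of_natDegree_lt hi)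
    · rw [hQc, hbd]; exact one_ne_zero
  refine ⟨N, hN, p, Q, ?_, hQd, ?_, fun i hi => by rw [hQc, hb0 i hi], i₀, hi₀.1, ?_⟩
  · rw [Polynomial.Monic, Polynomial.leadingCoeff, hQd, hQc, hbd]
  · ext1 i
    rw [Polynomial.coeff_map, Polynomial.coeff_scaleRoots, hQd, hQc]
    exact hb i
  · rw [hQc]
    intro h0
    have h1 := hord i₀ hi₀.2
    rw [hb i₀] at h1
    obtain ⟨c, hc⟩ := PowerSeries.X_dvd_iff.2 h0
    have h2 : (PowerSeries.X : PowerSeries ℂ) ^ (N * (P.coeff i₀).order.toNat + 1) ∣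
        b i₀ * (PowerSeries.X ^ p) ^ (d - i₀) := by
      rw [hc, ← pow_mul, ← hmul i₀ hi₀.1, pow_succ', mul_comm p]
      exact ⟨c, by ring⟩
    have h3 := (PowerSeries.X_pow_dvd_iff.1 h2) _ (Nat.lt_succ_self _)
    exact (PowerSeries.order_eq_nat.1 h1).1 h3

/-- The **Newton–Puiseux theorem**: a monic polynomial over `ℂ⟦x⟧` splits over `ℂ⟦s⟧`, where
`x = s ^ n` for some `n`. -/
theorem exists_ramify_splits (P : Polynomial (PowerSeries ℂ)) (hP : P.Monic) :
    ∃ (n : ℕ) (hn : n ≠ 0), (P.map (ramify n hn)).Splits := by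
  induction hd : P.natDegree using Nat.strong_induction_on generalizing P with
  | _ d ih =>
  obtain hd1 | hd1 := Nat.lt_or_ge 1 d
  swap
  · exact ⟨1, one_ne_zero, .of_natDegree_le_one_of_monic
      (by rw [hP.natDegree_map]; omega) (hP.map _)⟩
  obtain ⟨d, rfl⟩ : ∃ d', d = d' + 1 := ⟨d - 1, by omega⟩
  -- remove the second highest coefficient
  set r : PowerSeries ℂ := PowerSeries.C (-(1 / ((d : ℂ) + 1))) * P.coeff d with hr
  set P₁ := P.taylor r with hP₁
  have hP₁m : P₁.Monic := monic_taylor hP r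
  have hP₁d : P₁.natDegree = d + 1 := by rw [hP₁, Polynomial.natDegree_taylor, hd]
  have hP₁0 : P₁.coeff d = 0 := by
    rw [hP₁, coeff_taylor_of_natDegree_eq hP hd, hr]
    have : ((d : PowerSeries ℂ) + 1) * PowerSeries.C (-(1 / ((d : ℂ) + 1))) = -1 := by
      have h1 : ((d : PowerSeries ℂ) + 1) = PowerSeries.C ((d : ℂ) + 1) := by simp
      have h2 : (d : ℂ) + 1 ≠ 0 := by exact_mod_cast Nat.succ_ne_zero d
      rw [h1, ← map_mul, mul_neg, mul_one_div_cancel h2]; simp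
    rw [← mul_assoc, this]; ring
  suffices h : ∃ (n : ℕ) (hn : n ≠ 0), (P₁.map (ramify n hn)).Splits by
    obtain ⟨n, hn, h⟩ := h
    refine ⟨n, hn, ?_⟩
    have h2 : P = P₁.taylor (-r) := by rw [hP₁, Polynomial.taylor_taylor]; simp
    rw [h2, Polynomial.map_taylor]
    exact h.taylor _
  by_cases hX : ∀ i < d + 1, P₁.coeff i = 0
  · refine ⟨1, one_ne_zero, ?_⟩
    have : P₁ = Polynomial.X ^ (d + 1) := by
      ext1 i
      rw [Polynomial.coeff_X_pow]
      rcases lt_trichotomy i (d + 1) with h | h | h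
      · rw [hX i h, if_neg h.ne]
      · rw [if_pos h, h, ← hP₁d]; exact hP₁m
      · rw [if_neg h.ne', Polynomial.coeff_eq_zero_of_natDegree_lt (by omega)]
    rw [this]
    exact (Polynomial.Splits.X_pow _).map _
  push Not at hX
  obtain ⟨i₁, hi₁, hi₁0⟩ := hX
  obtain ⟨N, hN, p, Q, hQm, hQd, hPQ, hQ0, i₀, hi₀, hQi₀⟩ :=
    exists_scaleRoots P₁ hP₁m (by rwa [hP₁d]) hi₁0
  rw [hP₁d] at hQd hi₀
  suffices h : ∃ (n : ℕ) (hn : n ≠ 0), (Q.map (ramify n hn)).Splits by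
    obtain ⟨n, hn, h⟩ := h
    refine ⟨n * N, mul_ne_zero hn hN, ?_⟩
    have : ramify (n * N) (mul_ne_zero hn hN) = (ramify n hn).comp (ramify N hN) := by
      ext1 f
      exact PowerSeries.expand_mul _ hn _ hN _
    rw [this, ← Polynomial.map_map, hPQ, Polynomial.map_scaleRoots]
    · exact h.scaleRoots _
    · rw [hQm.leadingCoeff, map_one]; exact one_ne_zero
  -- a root `c` of the reduction at `s = 0`, whose multiplicity is less than the degree
  set R := Q.map (PowerSeries.constantCoeff (R := ℂ)) with hR
  have hRm : R.Monic := hQm.map _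
  have hRd : R.natDegree = d + 1 := by rw [hR, hQm.natDegree_map, hQd]
  obtain ⟨c, hc⟩ := IsAlgClosed.exists_root R (by
    rw [Polynomial.degree_eq_natDegree hRm.ne_zero, hRd]; exact_mod_cast Nat.succ_ne_zero d)
  set Q₁ := Q.taylor (PowerSeries.C c) with hQ₁
  have hQ₁R : Q₁.map (PowerSeries.constantCoeff (R := ℂ)) = R.taylor c := by
    rw [hQ₁, Polynomial.map_taylor]; simp [hR]
  set k := (R.taylor c).natTrailingDegree with hk
  have hT0 : R.taylor c ≠ 0 := (monic_taylor hRm c).ne_zero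
  have hcoef : ∀ i, PowerSeries.constantCoeff (Q₁.coeff i) = (R.taylor c).coeff i := by
    intro i; rw [← hQ₁R, Polynomial.coeff_map]
  have hk0 : k ≠ 0 := by
    intro h
    have h1 := Polynomial.coeff_natTrailingDegree_ne_zero.2 hT0
    rw [← hk, h, Polynomial.taylor_coeff_zero] at h1
    exact h1 hc
  have hkd : k < d + 1 := by
    by_contra! hle
    have h1 : ∀ i < d + 1, (R.taylor c).coeff i = 0 := fun i hi =>
      Polynomial.coeff_eq_zero_of_lt_natTrailingDegree (lt_of_lt_of_le hi hle)
    have h2 := h1 d (Nat.lt_succ_self d)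
    rw [coeff_taylor_of_natDegree_eq hRm hRd, hR, Polynomial.coeff_map, hQ0 d hP₁0, map_zero,
      zero_add] at h2
    have hc0 : c = 0 := (mul_eq_zero.1 h2).resolve_left (by exact_mod_cast Nat.succ_ne_zero d)
    have h3 := h1 i₀ hi₀
    rw [hc0, Polynomial.taylor_zero, hR, Polynomial.coeff_map] at h3
    exact hQi₀ h3
  obtain ⟨f, g, hf, hg, hfk, hfg⟩ := exists_factor Q₁ (monic_taylor hQm _) k
    (fun i hi => by rw [hcoef]; exact Polynomial.coeff_eq_zero_of_lt_natTrailingDegree hi)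
    (by rw [hcoef]; exact Polynomial.coeff_natTrailingDegree_ne_zero.2 hT0)
  have hdeg : k + g.natDegree = d + 1 := by
    rw [← hfk, ← hf.natDegree_mul hg, ← hfg, hQ₁, Polynomial.natDegree_taylor, hQd]
  obtain ⟨n₁, hn₁, h₁⟩ := ih k hkd f hf hfk
  obtain ⟨n₂, hn₂, h₂⟩ := ih g.natDegree (by omega) g hg rfl
  refine ⟨n₂ * n₁, mul_ne_zero hn₂ hn₁, ?_⟩
  have hQ : Q = Q₁.taylor (-PowerSeries.C c) := by rw [hQ₁, Polynomial.taylor_taylor]; simp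
  rw [hQ, Polynomial.map_taylor, hfg, Polynomial.map_mul]
  refine (Polynomial.Splits.mul (splits_ramify_mul hn₁ h₁ n₂ hn₂) ?_).taylor _
  have := splits_ramify_mul hn₂ h₂ n₁ hn₁
  simp only [mul_comm n₁ n₂] at this
  exact this

/-! ### Puiseux factorization of a series regular in `y` -/

/-- The bijection of variables behind `ℂ⟦x, y⟧ = ℂ⟦x⟧⟦y⟧`. -/
def finTwoEquivOption : Fin 2 ≃ Option Unit where
  toFun := ![some (), none]
  invFun := fun o => o.elim 1 fun _ => 0
  left_inv := by intro i; fin_cases i <;> rfl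
  right_inv := by rintro (_ | _) <;> rfl

/-- The identification `ℂ⟦x, y⟧ = ℂ⟦x⟧⟦y⟧`. -/
def iterated : Ser2 ≃ₐ[ℂ] PowerSeries (PowerSeries ℂ) :=
  (MvPowerSeries.renameEquiv ℂ finTwoEquivOption).trans (MvPowerSeries.optionEquivLeft Unit ℂ)

theorem coeff_iterated (g : Ser2) (i j : ℕ) :
    PowerSeries.coeff i (PowerSeries.coeff j (iterated g)) =
      MvPowerSeries.coeff (biexp i j) g := by
  refine (MvPowerSeries.coeff_coeff_optionEquivLeft
    (MvPowerSeries.renameEquiv ℂ finTwoEquivOption g) j (Finsupp.single () i)).trans ?_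
  have h := MvPowerSeries.coeff_embDomain_rename finTwoEquivOption.toEmbedding g (biexp i j)
  refine Eq.trans ?_ h
  rw [MvPowerSeries.renameEquiv_apply]
  congr 2
  ext o
  rcases o with _ | u
  · have : (none : Option Unit) = finTwoEquivOption.toEmbedding 1 := rfl
    rw [this, Finsupp.embDomain_apply_self]
    simp [finTwoEquivOption]
  · have : (some u : Option Unit) = finTwoEquivOption.toEmbedding 0 := rfl
    rw [this, Finsupp.embDomain_apply_self]
    simp [finTwoEquivOption]

theorem iterated_ext {f g : PowerSeries (PowerSeries ℂ)}
    (h : ∀ i j, PowerSeries.coeff i (PowerSeries.coeff j f) =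
      PowerSeries.coeff i (PowerSeries.coeff j g)) : f = g := by
  ext j i; exact h i j

theorem coeff_ser1_zero (a : PowerSeries ℂ) (i j : ℕ) :
    MvPowerSeries.coeff (biexp i j) (ser1 0 a) = if j = 0 then PowerSeries.coeff i a else 0 := by
  rw [ser1, PowerSeries.toMvPowerSeries_apply]
  split_ifs with hj
  · have := MvPowerSeries.coeff_embDomain_rename (R := ℂ)
      ⟨fun _ : Unit => (0 : Fin 2), fun _ _ _ => rfl⟩ a (Finsupp.single () i)
    rw [Finsupp.embDomain_single] at this
    have h2 : biexp i j = Finsupp.single 0 i := by simp [biexp, hj]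
    rw [h2]
    exact this
  · apply MvPowerSeries.coeff_rename_eq_zero
    rintro ⟨d, hd⟩
    have h1 := DFunLike.congr_fun hd 1
    rw [Finsupp.mapDomain_of_notMem_range] at h1
    · simp at h1; exact hj h1.symm
    · simp

theorem iterated_ser1_zero (a : PowerSeries ℂ) : iterated (ser1 0 a) = PowerSeries.C a := by
  apply iterated_ext
  intro i j
  rw [coeff_iterated, coeff_ser1_zero, PowerSeries.coeff_C]
  split_ifs <;> simp

theorem iterated_X_one : iterated (MvPowerSeries.X 1) = PowerSeries.X := by
  change MvPowerSeries.optionEquivLeft Unit ℂ (MvPowerSeries.rename finTwoEquivOption _) = _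
  rw [MvPowerSeries.rename_X]
  exact MvPowerSeries.optionEquivLeft_X_none

theorem iterated_pullback {n : ℕ} (hn : n ≠ 0) (g : Ser2) :
    iterated (pullback n g) = (iterated g).map (ramify n hn) := by
  apply iterated_ext
  intro i j
  rw [coeff_iterated, coeff_pullback, PowerSeries.coeff_map]
  refine Eq.trans ?_ (PowerSeries.coeff_expand n hn _).symm
  rw [coeff_iterated]

/-- A series that is regular of order `d` in `y` defines, after a ramified covering `x = s ^ n`, a
union of `d` smooth branches `y = y_i(s)`. -/
theorem exists_pullback_eq_prod (g : Ser2) (d : ℕ)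
    (h0 : ∀ j < d, MvPowerSeries.coeff (biexp 0 j) g = 0)
    (hd : MvPowerSeries.coeff (biexp 0 d) g ≠ 0) :
    ∃ (n : ℕ) (_ : n ≠ 0) (w : Ser2) (s : Multiset (PowerSeries ℂ)), IsUnit w ∧ s.card = d ∧
      (∀ y ∈ s, MvPowerSeries.constantCoeff (σ := Unit) y = 0) ∧
      pullback n g = (s.map fun y => (MvPowerSeries.X 1 - ser1 0 y : Ser2)).prod * w := by
  obtain ⟨f, u, hu, hf, hfd, hdeg, hfu⟩ := exists_weierstrass (iterated g) d
    (fun j hj => by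
      rw [← PowerSeries.coeff_zero_eq_constantCoeff_apply, coeff_iterated, h0 j hj])
    (by rw [← PowerSeries.coeff_zero_eq_constantCoeff_apply, coeff_iterated]; exact hd)
  obtain ⟨n, hn, hs⟩ := exists_ramify_splits f hf
  set F := f.map (ramify n hn) with hF
  have hFm : F.Monic := hf.map _
  have hFd : F.natDegree = d := by rw [hF, hf.natDegree_map, hdeg]
  have hprod := hs.eq_prod_roots_of_monic hFm
  refine ⟨n, hn, iterated.symm (u.map (ramify n hn)), F.roots,
    (hu.map (PowerSeries.map (ramify n hn))).map iterated.symm, ?_, ?_, ?_⟩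
  · rw [← hFd, hs.natDegree_eq_card_roots]
  · intro y hy
    have h1 : F.eval y = 0 := Polynomial.isRoot_of_mem_roots hy
    have h2 := congrArg (PowerSeries.constantCoeff (R := ℂ)) h1
    rw [Polynomial.eval_eq_sum_range, hFd, Finset.sum_range_succ, map_add, map_sum,
      Finset.sum_eq_zero, zero_add, map_zero, show F.coeff d = 1 from hFd ▸ hFm, one_mul,
      map_pow] at h2
    · exact eq_zero_of_pow_eq_zero h2
    · intro i hi
      have h3 := hfd.mem (n := i) (by rw [hdeg]; simpa using hi)
      rw [PowerSeries.maximalIdeal_eq_span_X, Ideal.mem_span_singleton, PowerSeries.X_dvd_iff] at h3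
      rw [map_mul, hF, Polynomial.coeff_map]
      have h4 : PowerSeries.constantCoeff (ramify n hn (f.coeff i)) = 0 :=
        (PowerSeries.constantCoeff_expand n hn _).trans h3
      rw [h4, zero_mul]
  · apply iterated.injective
    rw [iterated_pullback hn, map_mul, AlgEquiv.apply_symm_apply, hfu, map_mul, map_multiset_prod,
      Multiset.map_map]
    congr 1
    rw [← Polynomial.polynomial_map_coe, ← hF]
    conv_lhs => rw [hprod]
    rw [← Polynomial.coeToPowerSeries.ringHom_apply, map_multiset_prod, Multiset.map_map]
    congr 2
    funext y
    simp only [Function.comp_apply]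
    rw [map_sub, map_sub, iterated_X_one, iterated_ser1_zero]
    simp

/-! ### Partial derivatives and the chain rule -/

section Coeff
open MvPowerSeries

theorem coeff_X_zero_mul (g : Ser2) (i j : ℕ) :
    coeff (biexp (i + 1) j) (X 0 * g) = coeff (biexp i j) g := by
  have : biexp (i + 1) j = Finsupp.single 0 1 + biexp i j := by
    ext s; fin_cases s <;> simp [add_comm]
  rw [this, X_def, coeff_add_monomial_mul, one_mul]

theorem coeff_X_zero_mul_zero (g : Ser2) (j : ℕ) : coeff (biexp 0 j) (X 0 * g) = 0 := by
  rw [X_def, coeff_monomial_mul, if_neg]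
  rw [Finsupp.single_le_iff]; simp

theorem coeff_X_one_mul (g : Ser2) (i j : ℕ) :
    coeff (biexp i (j + 1)) (X 1 * g) = coeff (biexp i j) g := by
  have : biexp i (j + 1) = Finsupp.single 1 1 + biexp i j := by
    ext s; fin_cases s <;> simp [add_comm]
  rw [this, X_def, coeff_add_monomial_mul, one_mul]

theorem coeff_X_one_mul_zero (g : Ser2) (i : ℕ) : coeff (biexp i 0) (X 1 * g) = 0 := by
  rw [X_def, coeff_monomial_mul, if_neg]
  rw [Finsupp.single_le_iff]; simp

theorem coeff_pderiv_one (g : Ser2) (i j : ℕ) :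
    coeff (biexp i j) (pderiv ℂ 1 g) = coeff (biexp i (j + 1)) g * (j + 1) := by
  rw [coeff_pderiv]
  have : biexp i j + Finsupp.single 1 1 = biexp i (j + 1) := by
    ext s; fin_cases s <;> simp
  rw [this, biexp_one]

/-- The quotient of `g` by `x`, up to terms without `x`. -/
def shiftX (g : Ser2) : Ser2 := ofCoeff fun i j => coeff (biexp (i + 1) j) g

/-- The quotient by `y` of the part of `g` without `x`. -/
def shiftY (g : Ser2) : Ser2 := ofCoeff fun i j => if i = 0 then coeff (biexp 0 (j + 1)) g else 0

theorem coeff_C_biexp (c : ℂ) (i j : ℕ) :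
    coeff (biexp i j) (C c : Ser2) = if i = 0 ∧ j = 0 then c else 0 := by
  classical
  have h : biexp i j = 0 ↔ i = 0 ∧ j = 0 := by
    have : (0 : Fin 2 →₀ ℕ) = biexp 0 0 := by simp [biexp]
    rw [this, biexp_inj]
  rw [coeff_C]
  simp only [h]

theorem eq_C_add_shift (g : Ser2) :
    g = C (coeff (biexp 0 0) g) + X 0 * shiftX g + X 1 * shiftY g := by
  apply ser2_ext
  rintro (_ | i) (_ | j) <;>
  simp [shiftX, shiftY, coeff_X_zero_mul, coeff_X_zero_mul_zero, coeff_X_one_mul,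
    coeff_X_one_mul_zero, coeff_C_biexp]

theorem pderiv_one_pullback (n : ℕ) (g : Ser2) :
    pderiv ℂ 1 (pullback n g) = pullback n (pderiv ℂ 1 g) := by
  apply ser2_ext
  intro i j
  rw [coeff_pderiv_one, coeff_pullback, coeff_pullback, coeff_pderiv_one]
  split_ifs <;> simp

end Coeff

theorem X_dvd_of_cc {a : PowerSeries ℂ} (ha : MvPowerSeries.constantCoeff (σ := Unit) a = 0) :
    PowerSeries.X ∣ a := PowerSeries.X_dvd_iff.2 ha

/-- The chain rule, for a derivation `d` of the target ring. -/
theorem derivation_substPair {τ : Type} {a b : MvPowerSeries τ ℂ}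
    (d : Derivation ℂ (MvPowerSeries τ ℂ) (MvPowerSeries τ ℂ))
    (ha : MvPowerSeries.constantCoeff a = 0) (hb : MvPowerSeries.constantCoeff b = 0) (g : Ser2) :
    d (substPair ha hb g) = substPair ha hb (MvPowerSeries.pderiv ℂ 0 g) * d a +
      substPair ha hb (MvPowerSeries.pderiv ℂ 1 g) * d b := by
  -- the defect of the chain rule is a derivation that vanishes on `x` and on `y`
  set D : Ser2 → MvPowerSeries τ ℂ := fun g => d (substPair ha hb g) -
      (substPair ha hb (MvPowerSeries.pderiv ℂ 0 g) * d a +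
      substPair ha hb (MvPowerSeries.pderiv ℂ 1 g) * d b) with hD
  have hC : ∀ c : ℂ, substPair ha hb (MvPowerSeries.C c) = algebraMap ℂ _ c :=
    (substPair ha hb).commutes
  have hstep : ∀ g, D g = a * D (shiftX g) + b * D (shiftY g) := by
    intro g
    have h := eq_C_add_shift g
    set g₁ := shiftX g
    set g₂ := shiftY g
    have h01 : MvPowerSeries.pderiv ℂ (0 : Fin 2) (MvPowerSeries.X 1) = 0 :=
      MvPowerSeries.pderiv_X_of_ne (by decide)
    have h10 : MvPowerSeries.pderiv ℂ (1 : Fin 2) (MvPowerSeries.X 0) = 0 :=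
      MvPowerSeries.pderiv_X_of_ne (by decide)
    have hp0 : MvPowerSeries.pderiv ℂ 0 g = MvPowerSeries.X 0 * MvPowerSeries.pderiv ℂ 0 g₁ + g₁ +
        MvPowerSeries.X 1 * MvPowerSeries.pderiv ℂ 0 g₂ := by
      conv_lhs => rw [h]
      rw [map_add, map_add, MvPowerSeries.pderiv_C, Derivation.leibniz, Derivation.leibniz, h01,
        MvPowerSeries.pderiv_X_self]
      simp
    have hp1 : MvPowerSeries.pderiv ℂ 1 g = MvPowerSeries.X 0 * MvPowerSeries.pderiv ℂ 1 g₁ +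
        (MvPowerSeries.X 1 * MvPowerSeries.pderiv ℂ 1 g₂ + g₂) := by
      conv_lhs => rw [h]
      rw [map_add, map_add, MvPowerSeries.pderiv_C, Derivation.leibniz, Derivation.leibniz, h10,
        MvPowerSeries.pderiv_X_self]
      simp
    have he : substPair ha hb g = algebraMap ℂ _ (MvPowerSeries.coeff (biexp 0 0) g) +
        a * substPair ha hb g₁ + b * substPair ha hb g₂ := by
      conv_lhs => rw [h]
      rw [map_add, map_add, map_mul, map_mul, substPair_X_zero, substPair_X_one, hC]
    simp only [hD]
    rw [he, hp0, hp1]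
    simp only [map_add, map_mul, substPair_X_zero, substPair_X_one, Derivation.map_algebraMap,
      Derivation.leibniz, smul_eq_mul]
    ring
  have hord : ∀ (N : ℕ) g, (N : ℕ∞) ≤ (D g).order := by
    intro N
    induction N with
    | zero => intro g; simp
    | succ N ih =>
      intro g
      have h1 : ∀ {c e : MvPowerSeries τ ℂ}, MvPowerSeries.constantCoeff c = 0 →
          (N : ℕ∞) ≤ e.order → ((N + 1 : ℕ) : ℕ∞) ≤ (c * e).order := by
        intro c e hc he
        refine le_trans ?_ MvPowerSeries.le_order_mul
        rw [Nat.cast_add, add_comm]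
        exact add_le_add (MvPowerSeries.one_le_order_iff_constCoeff_eq_zero.2 hc) he
      rw [hstep]
      exact (le_min (h1 ha (ih _)) (h1 hb (ih _))).trans MvPowerSeries.min_order_le_add
  refine sub_eq_zero.1 ?_
  change D g = 0
  rw [← MvPowerSeries.order_eq_top_iff]
  exact ENat.eq_top_iff_forall_ge.2 fun N => hord N g

theorem derivative_curveEval {a b : PowerSeries ℂ}
    (ha : MvPowerSeries.constantCoeff (σ := Unit) a = 0)
    (hb : MvPowerSeries.constantCoeff (σ := Unit) b = 0) (g : Ser2) :
    PowerSeries.derivative ℂ (curveEval a b g) =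
      curveEval a b (MvPowerSeries.pderiv ℂ 0 g) * PowerSeries.derivative ℂ a +
      curveEval a b (MvPowerSeries.pderiv ℂ 1 g) * PowerSeries.derivative ℂ b := by
  simp only [curveEval_eq ha hb]
  exact derivation_substPair (PowerSeries.derivative ℂ) ha hb g

/-! ### Composition of substitutions along curves -/

theorem substPair_curve_comp {c : PowerSeries ℂ} (hc : MvPowerSeries.constantCoeff (σ := Unit) c = 0)
    {a b : PowerSeries ℂ} (ha : MvPowerSeries.constantCoeff (σ := Unit) a = 0)
    (hb : MvPowerSeries.constantCoeff (σ := Unit) b = 0) (g : Ser2) :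
    PowerSeries.subst c (curveEval a b g) =
      curveEval (PowerSeries.subst c a) (PowerSeries.subst c b) g := by
  have hs : PowerSeries.HasSubst c := PowerSeries.HasSubst.of_constantCoeff_zero hc
  have ha' : MvPowerSeries.constantCoeff (σ := Unit) (PowerSeries.subst c a) = 0 :=
    PowerSeries.constantCoeff_subst_eq_zero hc _ ha
  have hb' : MvPowerSeries.constantCoeff (σ := Unit) (PowerSeries.subst c b) = 0 :=
    PowerSeries.constantCoeff_subst_eq_zero hc _ hb
  rw [curveEval_eq ha hb, curveEval_eq ha' hb']
  have h := substAlgHom_substPair ha hb hs.const ha' hb'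
    (by rw [MvPowerSeries.coe_substAlgHom]; rfl) (by rw [MvPowerSeries.coe_substAlgHom]; rfl) g
  rw [MvPowerSeries.coe_substAlgHom] at h
  exact h

theorem constantCoeff_X_pow_ser1 {n : ℕ} (hn : n ≠ 0) :
    MvPowerSeries.constantCoeff (σ := Unit) (PowerSeries.X ^ n : PowerSeries ℂ) = 0 :=
  cc_mv (by simp [hn])

theorem curveEval_pullback {n : ℕ} (hn : n ≠ 0) {z : PowerSeries ℂ}
    (hz : MvPowerSeries.constantCoeff (σ := Unit) z = 0) (g : Ser2) :
    curveEval PowerSeries.X z (pullback n g) = curveEval (PowerSeries.X ^ n) z g := by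
  rw [pullback_eq_substPair hn, curveEval_eq constantCoeff_X_ser1 hz,
    curveEval_eq (constantCoeff_X_pow_ser1 hn) hz]
  rw [substPair, substAlgHom_substPair (constantCoeff_X_pow 0 hn) constantCoeff_X_one]
  · change substPair constantCoeff_X_ser1 hz _ = _
    rw [map_pow, substPair_X_zero]
  · change substPair constantCoeff_X_ser1 hz _ = _
    rw [substPair_X_one]

theorem rescale_curveEval (r : ℂ) {a b : PowerSeries ℂ}
    (ha : MvPowerSeries.constantCoeff (σ := Unit) a = 0)
    (hb : MvPowerSeries.constantCoeff (σ := Unit) b = 0) (g : Ser2) :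
    PowerSeries.rescale r (curveEval a b g) =
      curveEval (PowerSeries.rescale r a) (PowerSeries.rescale r b) g := by
  simp only [PowerSeries.rescale_eq_subst]
  exact substPair_curve_comp (cc_mv (by simp)) ha hb g

theorem order_rescale {r : ℂ} (hr : r ≠ 0) (a : PowerSeries ℂ) :
    (PowerSeries.rescale r a).order = a.order := by
  by_cases h : a = 0
  · simp [h]
  · rw [← PowerSeries.coe_toNat_order h, PowerSeries.order_eq_nat]
    obtain ⟨h1, h2⟩ := PowerSeries.order_eq_nat.1 (PowerSeries.coe_toNat_order h).symm
    refine ⟨?_, fun i hi => ?_⟩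
    · rw [PowerSeries.coeff_rescale]; exact mul_ne_zero (pow_ne_zero _ hr) h1
    · rw [PowerSeries.coeff_rescale, h2 i hi, mul_zero]

theorem prod_branch_dvd {ι : Type} (s : Finset ι) (y : ι → PowerSeries ℂ)
    (hy : ∀ i ∈ s, MvPowerSeries.constantCoeff (σ := Unit) (y i) = 0)
    (hinj : ∀ i ∈ s, ∀ j ∈ s, y i = y j → i = j) {g : Ser2}
    (hg : ∀ i ∈ s, curveEval PowerSeries.X (y i) g = 0) :
    ∏ i ∈ s, (MvPowerSeries.X 1 - ser1 0 (y i)) ∣ g := by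
  classical
  induction s using Finset.induction_on generalizing g with
  | empty => simp
  | insert i s hi ih =>
    obtain ⟨k, rfl⟩ := X_one_sub_dvd (hy i (by simp)) (hg i (by simp))
    rw [Finset.prod_insert hi]
    refine mul_dvd_mul_left _ (ih (fun j hj => hy j (by simp [hj]))
      (fun j hj l hl => hinj j (by simp [hj]) l (by simp [hl])) fun j hj => ?_)
    have h1 := hg j (by simp [hj])
    have hyj := hy j (by simp [hj])
    rw [curveEval_mul constantCoeff_X_ser1 hyj, curveEval_X_sub hyj] at h1
    refine (mul_eq_zero.1 h1).resolve_left fun h2 => hi ?_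
    rw [hinj i (by simp) j (by simp [hj]) (sub_eq_zero.1 h2).symm]
    exact hj

/-! ### The equation of a branch -/

/-- A primitive `m`-th root of unity. -/
def unityRoot (m : ℕ) : ℂ := Complex.exp (2 * Real.pi * Complex.I / m)

theorem isPrimitiveRoot_unityRoot {m : ℕ} (hm : m ≠ 0) : IsPrimitiveRoot (unityRoot m) m :=
  Complex.isPrimitiveRoot_exp m hm

/-- The conjugate `y(ζ ^ j u)` of a Puiseux series, where `ζ` is a primitive `m`-th root of unity. -/
def conjugate (m : ℕ) (y : PowerSeries ℂ) (j : ℕ) : PowerSeries ℂ :=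
  PowerSeries.rescale (unityRoot m ^ j) y

theorem pow_gcdBelow_eq_one_iff {m : ℕ} {ω : ℂ} (hω : ω ^ m = 1) (y : PowerSeries ℂ) (N : ℕ) :
    ω ^ gcdBelow m y N = 1 ↔ ∀ n < N, PowerSeries.coeff n y ≠ 0 → ω ^ n = 1 := by
  classical
  rw [← orderOf_dvd_iff_pow_eq_one, gcdBelow, Nat.dvd_gcd_iff, Finset.dvd_gcd_iff]
  simp only [orderOf_dvd_iff_pow_eq_one, hω, true_and, Finset.mem_filter, Finset.mem_range, id]
  exact ⟨fun h n h1 h2 => h n ⟨h1, by simpa using h2⟩, fun h n h1 => h n h1.1 (by simpa using h1.2)⟩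

theorem conjugate_zero (m : ℕ) (y : PowerSeries ℂ) : conjugate m y 0 = y := by
  simp [conjugate]

theorem coeff_conjugate (m : ℕ) (y : PowerSeries ℂ) (j n : ℕ) :
    PowerSeries.coeff n (conjugate m y j) = (unityRoot m ^ j) ^ n * PowerSeries.coeff n y :=
  PowerSeries.coeff_rescale _ _ _

theorem constantCoeff_conjugate {m : ℕ} {y : PowerSeries ℂ}
    (hy : MvPowerSeries.constantCoeff (σ := Unit) y = 0) (j : ℕ) :
    MvPowerSeries.constantCoeff (σ := Unit) (conjugate m y j) = 0 := by
  apply cc_mv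
  rw [← PowerSeries.coeff_zero_eq_constantCoeff_apply, coeff_conjugate]
  have : PowerSeries.coeff 0 y = 0 := (PowerSeries.coeff_zero_eq_constantCoeff_apply y).trans hy
  rw [this, mul_zero]

theorem conjugate_injOn {m : ℕ} (hm : m ≠ 0) {y : PowerSeries ℂ}
    (hprim : ∃ n, gcdBelow m y n = 1) {i j : ℕ} (hi : i < m) (hj : j < m)
    (h : conjugate m y i = conjugate m y j) : i = j := by
  have hζ := isPrimitiveRoot_unityRoot hm
  set ζ := unityRoot m with hζdef
  have h0 : ζ ≠ 0 := hζ.ne_zero hm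
  obtain ⟨n, hn⟩ := hprim
  have hω : (ζ ^ i / ζ ^ j) ^ m = 1 := by
    rw [div_pow, ← pow_mul, ← pow_mul, mul_comm i, mul_comm j, pow_mul, pow_mul, hζ.pow_eq_one]
    simp
  have h1 := (pow_gcdBelow_eq_one_iff hω y n).2 fun k _ hk => by
    have := congrArg (PowerSeries.coeff k) h
    rw [coeff_conjugate, coeff_conjugate] at this
    rw [div_pow, mul_right_cancel₀ hk this, div_self]
    exact pow_ne_zero _ (pow_ne_zero _ h0)
  rw [hn, pow_one] at h1
  exact hζ.pow_inj hi hj (div_eq_one_iff_eq (pow_ne_zero _ h0) |>.1 h1)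

/-- The pullback `∏ (y - y(ζ ^ j u))` of the equation of a branch along `x = u ^ m`. -/
def conjProd (m : ℕ) (y : PowerSeries ℂ) : Ser2 :=
  ∏ j ∈ Finset.range m, (MvPowerSeries.X 1 - ser1 0 (conjugate m y j))

/-- The action of the covering group of `x = u ^ m`. -/
def rotate (m : ℕ) : Ser2 →+* Ser2 := MvPowerSeries.rescale ![unityRoot m, 1]

theorem coeff_rotate (m : ℕ) (g : Ser2) (i j : ℕ) :
    MvPowerSeries.coeff (biexp i j) (rotate m g) =
      unityRoot m ^ i * MvPowerSeries.coeff (biexp i j) g := by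
  rw [rotate, MvPowerSeries.coeff_rescale, Finsupp.prod_fintype _ _ (by simp), Fin.prod_univ_two]
  simp

theorem rotate_conjProd {m : ℕ} (hm : m ≠ 0) (y : PowerSeries ℂ) :
    rotate m (conjProd m y) = conjProd m y := by
  have h1 : rotate m (MvPowerSeries.X 1) = MvPowerSeries.X 1 := by
    have : (MvPowerSeries.X 1 : Ser2) = ofCoeff fun i j => if i = 0 ∧ j = 1 then 1 else 0 := by
      have h := monomial_biexp 0 1 1
      rw [pow_zero, mul_one, pow_one, map_one MvPowerSeries.C, one_mul] at h
      rw [← h]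
      apply ser2_ext
      intro i j
      rw [MvPowerSeries.coeff_monomial, coeff_ofCoeff]
      simp only [biexp_inj]
    apply ser2_ext
    intro i j
    rw [coeff_rotate, this, coeff_ofCoeff]
    split_ifs with h
    · rw [h.1, pow_zero, one_mul]
    · rw [mul_zero]
  have h2 : ∀ j, rotate m (ser1 0 (conjugate m y j)) = ser1 0 (conjugate m y (j + 1)) := by
    intro j
    apply ser2_ext
    intro i k
    rw [coeff_rotate, coeff_ser1_zero, coeff_ser1_zero]
    split_ifs
    · rw [coeff_conjugate, coeff_conjugate, pow_succ, mul_pow]; ring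
    · rw [mul_zero]
  have h3 : conjugate m y m = conjugate m y 0 := by
    rw [conjugate, conjugate, (isPrimitiveRoot_unityRoot hm).pow_eq_one, pow_zero]
  obtain ⟨m', hm'⟩ := Nat.exists_eq_succ_of_ne_zero hm
  rw [conjProd, map_prod]
  simp only [map_sub, h1, h2]
  rw [hm', Nat.succ_eq_add_one, Finset.prod_range_succ, ← Nat.succ_eq_add_one, ← hm', h3,
    hm', Nat.succ_eq_add_one, Finset.prod_range_succ']

theorem rotate_pullback {m : ℕ} (hm : m ≠ 0) (g : Ser2) :
    rotate m (pullback m g) = pullback m g := by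
  apply ser2_ext
  intro i j
  rw [coeff_rotate, coeff_pullback]
  split_ifs with h
  · obtain ⟨k, rfl⟩ := h
    rw [pow_mul, (isPrimitiveRoot_unityRoot hm).pow_eq_one, one_pow, one_mul]
  · rw [mul_zero]

/-- Descent along `x = u ^ m`. -/
def descend (m : ℕ) (g : Ser2) : Ser2 :=
  ofCoeff fun i j => MvPowerSeries.coeff (biexp (m * i) j) g

theorem pullback_descend {m : ℕ} (hm : m ≠ 0) {g : Ser2} (hg : rotate m g = g) :
    pullback m (descend m g) = g := by
  apply ser2_ext
  intro i j
  rw [coeff_pullback]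
  split_ifs with h
  · rw [descend, coeff_ofCoeff, Nat.mul_div_cancel' h]
  · have h1 := congrArg (MvPowerSeries.coeff (biexp i j)) hg
    rw [coeff_rotate] at h1
    by_contra h2
    have h3 := mul_right_cancel₀ (Ne.symm h2) (h1.trans (one_mul _).symm)
    exact h (((isPrimitiveRoot_unityRoot hm).pow_eq_one_iff_dvd i).1 h3)

theorem pullback_injective {m : ℕ} (hm : m ≠ 0) : Function.Injective (pullback m) := by
  intro f g h
  apply ser2_ext
  intro i j
  have h1 := congrArg (MvPowerSeries.coeff (biexp (m * i) j)) h
  simpa [coeff_pullback, Nat.mul_div_cancel_left _ (Nat.pos_of_ne_zero hm)] using h1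

theorem pullback_mul {m : ℕ} (hm : m ≠ 0) (f g : Ser2) :
    pullback m (f * g) = pullback m f * pullback m g := by
  simp only [pullback_eq_substPair hm, map_mul]

/-- The equation `∏ (y - y(ζ ^ j x ^ (1 / m)))` of the branch `(u ^ m, y(u))`. -/
def branchEq (m : ℕ) (y : PowerSeries ℂ) : Ser2 := descend m (conjProd m y)

theorem pullback_branchEq {m : ℕ} (hm : m ≠ 0) (y : PowerSeries ℂ) :
    pullback m (branchEq m y) = conjProd m y := pullback_descend hm (rotate_conjProd hm y)

theorem conjProd_ne_zero {m : ℕ} {y : PowerSeries ℂ}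
    (hy : MvPowerSeries.constantCoeff (σ := Unit) y = 0) : conjProd m y ≠ 0 :=
  Finset.prod_ne_zero_iff.2 fun _ _ => X_one_sub_ne_zero _ (constantCoeff_conjugate hy _)

/-- Every series that vanishes on a primitively parametrized branch is a multiple of the equation of
the branch. -/
theorem branchEq_dvd {m : ℕ} (hm : m ≠ 0) {y : PowerSeries ℂ}
    (hy : MvPowerSeries.constantCoeff (σ := Unit) y = 0) (hprim : ∃ n, gcdBelow m y n = 1)
    {h : Ser2} (hh : curveEval (PowerSeries.X ^ m) y h = 0) : branchEq m y ∣ h := by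
  have hdvd : conjProd m y ∣ pullback m h := by
    apply prod_branch_dvd
    · exact fun i _ => constantCoeff_conjugate hy i
    · intro i hi j hj hij
      exact conjugate_injOn hm hprim (Finset.mem_range.1 hi) (Finset.mem_range.1 hj) hij
    · intro i _
      rw [curveEval_pullback hm (constantCoeff_conjugate hy i)]
      have h1 := rescale_curveEval (unityRoot m ^ i) (constantCoeff_X_pow_ser1 hm) hy h
      rw [hh, map_zero, map_pow, PowerSeries.rescale_X, mul_pow, ← map_pow, ← pow_mul, mul_comm i,
        pow_mul, (isPrimitiveRoot_unityRoot hm).pow_eq_one, one_pow, map_one, one_mul] at h1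
      exact h1.symm
  obtain ⟨q, hq⟩ := hdvd
  have hq' : rotate m q = q := by
    have h1 := rotate_pullback hm h
    rw [hq, map_mul, rotate_conjProd hm] at h1
    exact mul_left_cancel₀ (conjProd_ne_zero hy) h1
  refine ⟨descend m q, pullback_injective hm ?_⟩
  rw [pullback_mul hm, pullback_branchEq hm, pullback_descend hm hq', hq]

theorem curveEval_branchEq {m : ℕ} (hm : m ≠ 0) {y : PowerSeries ℂ}
    (hy : MvPowerSeries.constantCoeff (σ := Unit) y = 0) :
    curveEval (PowerSeries.X ^ m) y (branchEq m y) = 0 := by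
  rw [← curveEval_pullback hm hy, pullback_branchEq hm, conjProd,
    Finset.prod_eq_mul_prod_sdiff_singleton_of_mem (Finset.mem_range.2 (Nat.pos_of_ne_zero hm)),
    curveEval_mul constantCoeff_X_ser1 hy, curveEval_X_sub hy, conjugate_zero, sub_self, zero_mul]

theorem weight_biexp (w : Fin 2 → ℕ) (i j : ℕ) :
    Finsupp.weight w (biexp i j) = i * w 0 + j * w 1 := by
  simp [biexp, Finsupp.weight_apply, Finsupp.sum_add_index', Finsupp.sum_single_index, add_mul]

theorem le_order_branchEq {m : ℕ} {y : PowerSeries ℂ}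
    (hy : ∀ n < m, PowerSeries.coeff n y = 0) : (m : ℕ∞) ≤ (branchEq m y).order := by
  -- every factor of `conjProd` has order at least `m` when `x` has weight `1` and `y` weight `m`
  have h1 : ∀ j, (m : ℕ∞) ≤
      MvPowerSeries.weightedOrder ![1, m] (MvPowerSeries.X 1 - ser1 0 (conjugate m y j)) := by
    intro j
    apply MvPowerSeries.nat_le_weightedOrder
    intro d hd
    rw [eq_biexp d, weight_biexp] at hd
    have hd' : d 0 * 1 + d 1 * m < m := hd
    have h10 : d 1 = 0 := by
      by_contra h
      have := Nat.le_mul_of_pos_left m (Nat.pos_of_ne_zero h)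
      omega
    rw [eq_biexp d, map_sub, coeff_ser1_zero, if_pos h10, coeff_conjugate, hy _ (by omega), mul_zero,
      sub_zero, MvPowerSeries.coeff_X, if_neg]
    intro h
    have := DFunLike.congr_fun h 1
    simp [h10] at this
  have h2 : ((m * m : ℕ) : ℕ∞) ≤ MvPowerSeries.weightedOrder ![1, m] (conjProd m y) := by
    refine le_trans ?_ (MvPowerSeries.le_weightedOrder_prod _ _ _)
    refine le_trans ?_ (Finset.sum_le_sum fun j _ => h1 j)
    simp
  apply MvPowerSeries.nat_le_order
  intro d hd
  rw [eq_biexp d, degree_biexp] at hd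
  rw [eq_biexp d, branchEq, descend, coeff_ofCoeff]
  apply MvPowerSeries.coeff_eq_zero_of_lt_weightedOrder ![1, m]
  refine lt_of_lt_of_le ?_ h2
  rw [weight_biexp]
  have : m * d 0 * 1 + d 1 * m < m * m := by
    have := Nat.mul_lt_mul_of_pos_left hd (show 0 < m by omega)
    nlinarith
  exact_mod_cast this

theorem coeff_branchEq {m : ℕ} {y : PowerSeries ℂ}
    (hy : MvPowerSeries.constantCoeff (σ := Unit) y = 0) :
    MvPowerSeries.coeff (biexp 0 m) (branchEq m y) = 1 := by
  have h1 : ∀ k, (MvPowerSeries.X 0 : Ser2) ∣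
      ∏ j ∈ Finset.range k, (MvPowerSeries.X 1 - ser1 0 (conjugate m y j)) -
        MvPowerSeries.X 1 ^ k := by
    intro k
    induction k with
    | zero => simp
    | succ k ih =>
      obtain ⟨a, ha⟩ := X_dvd_of_cc (constantCoeff_conjugate (m := m) hy k)
      obtain ⟨b, hb⟩ := ih
      rw [Finset.prod_range_succ, sub_eq_iff_eq_add.1 hb]
      have h2 : ser1 0 (conjugate m y k) = MvPowerSeries.X 0 * ser1 0 a := by
        rw [ha, ser1, map_mul, PowerSeries.toMvPowerSeries_X]; rfl
      rw [h2]
      exact ⟨b * (MvPowerSeries.X 1 - MvPowerSeries.X 0 * ser1 0 a) -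
        MvPowerSeries.X 1 ^ k * ser1 0 a, by ring⟩
  obtain ⟨b, hb⟩ := h1 m
  rw [branchEq, descend, coeff_ofCoeff, mul_zero, conjProd, sub_eq_iff_eq_add.1 hb, map_add,
    coeff_X_zero_mul_zero, zero_add]
  have := monomial_biexp 0 m 1
  rw [pow_zero, mul_one, map_one MvPowerSeries.C, one_mul] at this
  rw [← this, MvPowerSeries.coeff_monomial_same]

/-! ### The Milnor number in terms of a parametrization -/

theorem enat_mul_left_cancel {n : ℕ} (hn : n ≠ 0) {a b : ℕ∞} (h : (n : ℕ∞) * a = n * b) : a = b := by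
  have hn' : (n : ℕ∞) ≠ 0 := by exact_mod_cast hn
  induction a using ENat.recTopCoe <;> induction b using ENat.recTopCoe
  · rfl
  · rw [ENat.mul_top hn'] at h
    exact absurd h.symm (by exact_mod_cast ENat.natCast_ne_top _)
  · rw [ENat.mul_top hn'] at h
    exact absurd h (by exact_mod_cast ENat.natCast_ne_top _)
  · exact_mod_cast Nat.eq_of_mul_eq_mul_left (Nat.pos_of_ne_zero hn) (by exact_mod_cast h)

/-- The order of contact `∑_{j = 1}^{m - 1} ord (y(u) - y(ζ ^ j u))` of `y` with its conjugates. -/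
def contactSum (m : ℕ) (y : PowerSeries ℂ) : ℕ∞ :=
  ∑ j ∈ Finset.range (m - 1), (y - conjugate m y (j + 1)).order

theorem contactSum_ne_top {m : ℕ} (hm : m ≠ 0) {y : PowerSeries ℂ}
    (hprim : ∃ n, gcdBelow m y n = 1) : contactSum m y ≠ ⊤ := by
  rw [contactSum, ENat.sum_ne_top]
  intro j hj
  rw [Finset.mem_range] at hj
  rw [Ne, PowerSeries.order_eq_top, sub_eq_zero]
  intro h
  rw [← conjugate_zero m y] at h
  have h2 : conjugate m y 0 = conjugate m y (j + 1) := by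
    conv_rhs => rw [← conjugate_zero m y]
    exact h
  have := conjugate_injOn hm hprim (i := 0) (j := j + 1) (by omega) (by omega) h2
  omega

theorem order_derivative_add_one {e : PowerSeries ℂ} (he : PowerSeries.constantCoeff e = 0) :
    (PowerSeries.derivative ℂ e).order + 1 = e.order := by
  by_cases h : e = 0
  · simp [h]
  · set N := e.order.toNat with hN
    have h1 : (N : ℕ∞) = e.order := PowerSeries.coe_toNat_order h
    obtain ⟨h2, h3⟩ := PowerSeries.order_eq_nat.1 h1.symm
    obtain ⟨M, hM⟩ : ∃ M, N = M + 1 := by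
      refine Nat.exists_eq_succ_of_ne_zero fun h0 => ?_
      rw [h0, PowerSeries.coeff_zero_eq_constantCoeff_apply, he] at h2
      exact h2 rfl
    have h4 : (PowerSeries.derivative ℂ e).order = M := by
      rw [PowerSeries.order_eq_nat]
      refine ⟨?_, fun i hi => ?_⟩
      · rw [PowerSeries.coeff_derivative, ← hM]
        exact mul_ne_zero h2 (by exact_mod_cast Nat.succ_ne_zero M)
      · rw [PowerSeries.coeff_derivative, h3 _ (by omega), zero_mul]
    rw [h4, ← h1, hM]; rfl

theorem isUnit_of_coeff_ne_zero {q : Ser2} (hq : MvPowerSeries.constantCoeff q ≠ 0) : IsUnit q :=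
  MvPowerSeries.isUnit_iff_constantCoeff.2 hq.isUnit

theorem constantCoeff_curveEval {a b : PowerSeries ℂ}
    (ha : MvPowerSeries.constantCoeff (σ := Unit) a = 0)
    (hb : MvPowerSeries.constantCoeff (σ := Unit) b = 0) (g : Ser2)
    (hg : MvPowerSeries.constantCoeff g = 0) : PowerSeries.constantCoeff (curveEval a b g) = 0 := by
  have := MvPowerSeries.constantCoeff_subst_eq_zero (hasSubst_pair ha hb)
    (by simp [Fin.forall_fin_two, ha, hb]) hg
  exact this

section Milnor

variable {m : ℕ} (hm : m ≠ 0) {y : PowerSeries ℂ} (hy : ∀ n ≤ m, PowerSeries.coeff n y = 0)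
  (hprim : ∃ n, gcdBelow m y n = 1) {h : Ser2} (hord : h.order = m)
  (hh : curveEval (PowerSeries.X ^ m) y h = 0)

include hy in
theorem cc_of_exponents : MvPowerSeries.constantCoeff (σ := Unit) y = 0 := by
  have := hy 0 (Nat.zero_le _)
  rwa [PowerSeries.coeff_zero_eq_constantCoeff_apply] at this

include hm hy hprim hord hh in
theorem exists_unit_mul_branchEq :
    ∃ q : Ser2, MvPowerSeries.constantCoeff q ≠ 0 ∧ h = branchEq m y * q := by
  have hcc := cc_of_exponents hy
  obtain ⟨q, rfl⟩ := branchEq_dvd hm hcc hprim hh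
  refine ⟨q, fun hq => ?_, rfl⟩
  have h1 : (1 : ℕ∞) ≤ q.order := MvPowerSeries.one_le_order_iff_constCoeff_eq_zero.2 hq
  have h2 := le_order_branchEq fun n hn => hy n (le_of_lt hn)
  have h3 := (add_le_add h2 h1).trans (MvPowerSeries.le_order_mul (f := branchEq m y) (g := q))
  rw [hord] at h3
  have : m + 1 ≤ m := by exact_mod_cast h3
  omega

include hm hy hprim hord hh in
theorem coeff_zero_ne_zero : MvPowerSeries.coeff (biexp 0 m) h ≠ 0 := by
  obtain ⟨q, hq, rfl⟩ := exists_unit_mul_branchEq hm hy hprim hord hh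
  set c := MvPowerSeries.constantCoeff q with hc
  have h1 : branchEq m y * q = branchEq m y * MvPowerSeries.C c +
      branchEq m y * (q - MvPowerSeries.C c) := by ring
  have h2 : (1 : ℕ∞) ≤ (q - MvPowerSeries.C c).order :=
    MvPowerSeries.one_le_order_iff_constCoeff_eq_zero.2 (by simp [hc])
  have h3 : MvPowerSeries.coeff (biexp 0 m) (branchEq m y * (q - MvPowerSeries.C c)) = 0 := by
    apply MvPowerSeries.coeff_of_lt_order
    refine lt_of_lt_of_le ?_ MvPowerSeries.le_order_mul
    refine lt_of_lt_of_le ?_ (add_le_add (le_order_branchEq fun n hn => hy n (le_of_lt hn)) h2)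
    rw [degree_biexp, zero_add]
    exact_mod_cast Nat.lt_succ_self m
  rw [h1, map_add, h3, add_zero, MvPowerSeries.coeff_mul_C, coeff_branchEq (cc_of_exponents hy),
    one_mul]
  exact hq

include hm hy hprim hord hh in
/-- The order of `∂h/∂y` along the branch is the order of contact with the conjugates. -/
theorem order_curveEval_pderiv :
    (curveEval (PowerSeries.X ^ m) y (MvPowerSeries.pderiv ℂ 1 h)).order = contactSum m y := by
  have hcc := cc_of_exponents hy
  have hcv := curveEval_mul constantCoeff_X_ser1 hcc
  obtain ⟨q, hq, hhq⟩ := exists_unit_mul_branchEq hm hy hprim hord hh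
  obtain ⟨m', hm'⟩ := Nat.exists_eq_succ_of_ne_zero hm
  set G : Ser2 := ∏ j ∈ Finset.range (m - 1),
    (MvPowerSeries.X 1 - ser1 0 (conjugate m y (j + 1))) with hG
  have hprod : conjProd m y = G * (MvPowerSeries.X 1 - ser1 0 y) := by
    rw [conjProd, hG]
    have h1 : m = (m - 1) + 1 := by omega
    conv_lhs => rw [h1]
    rw [Finset.prod_range_succ', ← h1, conjugate_zero]
  have hpb : pullback m h = (MvPowerSeries.X 1 - ser1 0 y) * (G * pullback m q) := by
    rw [hhq, pullback_mul hm, pullback_branchEq hm, hprod]; ring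
  have hd : MvPowerSeries.pderiv ℂ (1 : Fin 2) (MvPowerSeries.X 1 - ser1 0 y) = 1 := by
    rw [map_sub, MvPowerSeries.pderiv_X_self]
    have : MvPowerSeries.pderiv ℂ (1 : Fin 2) (ser1 0 y) = 0 := by
      apply ser2_ext
      intro i j
      rw [coeff_pderiv_one, coeff_ser1_zero, if_neg (Nat.succ_ne_zero j), zero_mul, map_zero]
    rw [this, sub_zero]
  rw [← curveEval_pullback hm hcc, ← pderiv_one_pullback, hpb, Derivation.leibniz, hd]
  have hadd : ∀ f g, curveEval PowerSeries.X y (f + g) =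
      curveEval PowerSeries.X y f + curveEval PowerSeries.X y g := by
    intro f g; simp only [curveEval_eq constantCoeff_X_ser1 hcc]; exact map_add _ _ _
  rw [hadd, smul_eq_mul, hcv, curveEval_X_sub hcc, sub_self, zero_mul, zero_add, smul_eq_mul,
    mul_one, hcv, PowerSeries.order_mul]
  have h2 : (curveEval PowerSeries.X y (pullback m q)).order = 0 := by
    rw [curveEval_pullback hm hcc]
    apply PowerSeries.order_zero_of_unit
    rw [curveEval_eq (constantCoeff_X_pow_ser1 hm) hcc]
    exact (isUnit_of_coeff_ne_zero hq).map _
  have h3 : curveEval PowerSeries.X y G =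
      ∏ j ∈ Finset.range (m - 1), (y - conjugate m y (j + 1)) := by
    rw [hG, curveEval_eq constantCoeff_X_ser1 hcc]
    refine (map_prod _ _ _).trans (Finset.prod_congr rfl fun j _ => ?_)
    rw [← curveEval_eq constantCoeff_X_ser1 hcc, curveEval_X_sub hcc]
  rw [h2, add_zero, h3, PowerSeries.order_prod]
  rfl

include hm hy hprim hord hh in
/-- The intersection multiplicity of the branch with its polar curve. -/
theorem colength_polar :
    colength (Ideal.span {MvPowerSeries.pderiv ℂ 1 h, h}) = contactSum m y := by
  have hcc := cc_of_exponents hy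
  obtain ⟨q, hq, hhq⟩ := exists_unit_mul_branchEq hm hy hprim hord hh
  have hI : Ideal.span {MvPowerSeries.pderiv ℂ 1 h, h} =
      Ideal.span {branchEq m y, MvPowerSeries.pderiv ℂ 1 h} := by
    rw [Set.pair_comm, Ideal.span_insert, Ideal.span_insert]
    congr 1
    rw [hhq, Ideal.span_singleton_mul_right_unit (isUnit_of_coeff_ne_zero hq)]
  have h1 := colength_pullback hm (branchEq m y) (MvPowerSeries.pderiv ℂ 1 h)
  rw [← hI, pullback_branchEq hm] at h1
  have hB := order_curveEval_pderiv hm hy hprim hord hh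
  have hfin := contactSum_ne_top hm hprim
  have h2 : ∀ j, (curveEval PowerSeries.X (conjugate m y j)
      (pullback m (MvPowerSeries.pderiv ℂ 1 h))).order = contactSum m y := by
    intro j
    rw [curveEval_pullback hm (constantCoeff_conjugate hcc j), ← hB]
    have h3 := rescale_curveEval (unityRoot m ^ j) (constantCoeff_X_pow_ser1 hm) hcc
      (MvPowerSeries.pderiv ℂ 1 h)
    rw [map_pow, PowerSeries.rescale_X, mul_pow, ← map_pow, ← pow_mul, mul_comm j,
      pow_mul, (isPrimitiveRoot_unityRoot hm).pow_eq_one, one_pow, map_one, one_mul] at h3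
    rw [conjugate, ← h3, order_rescale]
    exact pow_ne_zero _ ((isPrimitiveRoot_unityRoot hm).ne_zero hm)
  have h4 := colength_span_prod_branch ((Multiset.range m).map fun j => conjugate m y j)
    (g := pullback m (MvPowerSeries.pderiv ℂ 1 h))
    (by simp only [Multiset.mem_map]; rintro _ ⟨j, _, rfl⟩; exact constantCoeff_conjugate hcc j)
    (by
      simp only [Multiset.mem_map]; rintro _ ⟨j, _, rfl⟩ h0
      have := h2 j
      rw [h0, PowerSeries.order_zero] at this
      exact hfin this.symm)
  rw [Multiset.map_map, Multiset.map_map] at h4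
  have h5 : (Multiset.map ((fun y => (MvPowerSeries.X 1 - ser1 0 y : Ser2)) ∘
      fun j => conjugate m y j) (Multiset.range m)).prod = conjProd m y := rfl
  rw [h5, h1] at h4
  have h6 : (Multiset.map ((fun z => (curveEval PowerSeries.X z
      (pullback m (MvPowerSeries.pderiv ℂ 1 h))).order) ∘ fun j => conjugate m y j)
      (Multiset.range m)).sum = m * contactSum m y := by
    have : ((fun z => (curveEval PowerSeries.X z
      (pullback m (MvPowerSeries.pderiv ℂ 1 h))).order) ∘ fun j => conjugate m y j) =
        fun _ => contactSum m y := funext h2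
    rw [this]; simp
  rw [h6] at h4
  exact enat_mul_left_cancel hm h4

include hm hy hprim hord hh in
/-- **Teissier's lemma**: the Milnor number and the intersection multiplicity of `V(h)` with its
polar curve `∂h/∂y = 0` differ by the intersection multiplicity `m - 1` of the polar curve
with `x = 0`. Along a branch `(s ^ n, y_i(s))` of the polar curve, the derivative of `h` with respect
to `s` is `∂h/∂x * n * s ^ (n - 1)`, so that the orders of `h` and `∂h/∂x` differ by `n`. -/
theorem colength_jacobian_add :
    colength (Ideal.span {MvPowerSeries.pderiv ℂ 0 h, MvPowerSeries.pderiv ℂ 1 h}) +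
      ((m - 1 : ℕ) : ℕ∞) = contactSum m y := by
  have hcoef := coeff_zero_ne_zero hm hy hprim hord hh
  have hh0 : MvPowerSeries.constantCoeff h = 0 := by
    rw [← MvPowerSeries.one_le_order_iff_constCoeff_eq_zero, hord]
    exact_mod_cast Nat.one_le_iff_ne_zero.2 hm
  set p := MvPowerSeries.pderiv ℂ 1 h with hp
  obtain ⟨n, hn, w, s, hw, hcard, hs, hprod⟩ := exists_pullback_eq_prod p (m - 1)
    (fun j hj => by
      rw [hp, coeff_pderiv_one, MvPowerSeries.coeff_of_lt_order, zero_mul]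
      rw [hord, degree_biexp]
      exact_mod_cast (by omega : 0 + (j + 1) < m))
    (by
      rw [hp, coeff_pderiv_one, Nat.sub_add_cancel (Nat.one_le_iff_ne_zero.2 hm)]
      exact mul_ne_zero hcoef (by exact_mod_cast Nat.succ_ne_zero (m - 1)))
  set F := (s.map fun z => (MvPowerSeries.X 1 - ser1 0 z : Ser2)).prod with hF
  have hspan : ∀ g : Ser2, Ideal.span {F, pullback n g} =
      Ideal.span {pullback n p, pullback n g} := by
    intro g
    rw [Ideal.span_insert, Ideal.span_insert, hprod, Ideal.span_singleton_mul_right_unit hw]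
  have hcol : ∀ g : Ser2, colength (Ideal.span {F, pullback n g}) =
      n * colength (Ideal.span {p, g}) := by
    intro g; rw [hspan, colength_pullback hn]
  have hfin := contactSum_ne_top hm hprim
  have hpol := colength_polar hm hy hprim hord hh
  have hFy : ∀ z ∈ s, curveEval PowerSeries.X z (pullback n p) = 0 := by
    intro z hz
    rw [hprod, curveEval_mul constantCoeff_X_ser1 (hs z hz)]
    obtain ⟨k, hk⟩ : (MvPowerSeries.X 1 - ser1 0 z : Ser2) ∣ F :=
      Multiset.dvd_prod (Multiset.mem_map_of_mem _ hz)
    rw [hk, curveEval_mul constantCoeff_X_ser1 (hs z hz), curveEval_X_sub (hs z hz), sub_self,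
      zero_mul, zero_mul]
  have hne : ∀ z ∈ s, curveEval PowerSeries.X z (pullback n h) ≠ 0 := by
    intro z hz h0
    have h1 : colength (Ideal.span {(MvPowerSeries.X 1 - ser1 0 z : Ser2), pullback n h}) ≤
        colength (Ideal.span {F, pullback n h}) := by
      apply colength_le_of_le
      rw [Ideal.span_le]
      rintro x (rfl | rfl)
      · obtain ⟨k, hk⟩ : (MvPowerSeries.X 1 - ser1 0 z : Ser2) ∣ F :=
          Multiset.dvd_prod (Multiset.mem_map_of_mem _ hz)
        rw [hk]
        exact Ideal.mul_mem_right _ _ (Ideal.subset_span (by simp))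
      · exact Ideal.subset_span (by simp)
    rw [colength_span_branch (hs z hz), h0, PowerSeries.order_zero, hcol, hpol, top_le_iff] at h1
    exact (WithTop.mul_ne_top (ENat.natCast_ne_top n) hfin) h1
  -- the orders of `h` and of its derivatives along a branch of the polar curve
  have hordz : ∀ z ∈ s, (curveEval PowerSeries.X z (pullback n h)).order =
      (curveEval PowerSeries.X z (pullback n (MvPowerSeries.pderiv ℂ 0 h))).order + n := by
    intro z hz
    have hcn := constantCoeff_X_pow_ser1 hn
    have h1 := derivative_curveEval hcn (hs z hz) h
    have h2 := hFy z hz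
    rw [curveEval_pullback hn (hs z hz)] at h2 ⊢
    rw [curveEval_pullback hn (hs z hz)]
    rw [← hp, h2, zero_mul, add_zero, PowerSeries.derivative_pow, PowerSeries.derivative_X,
      mul_one] at h1
    rw [← order_derivative_add_one (constantCoeff_curveEval hcn (hs z hz) h hh0), h1,
      PowerSeries.order_mul, PowerSeries.order_mul, PowerSeries.order_X_pow]
    have h3 : ((n : PowerSeries ℂ)).order = 0 := by
      apply PowerSeries.order_zero_of_unit
      have : (n : PowerSeries ℂ) = PowerSeries.C (n : ℂ) := by simp
      rw [this]
      exact (IsUnit.mk0 (n : ℂ) (by exact_mod_cast hn)).map _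
    rw [h3, zero_add, add_assoc]
    congr 1
    exact_mod_cast Nat.sub_add_cancel (Nat.one_le_iff_ne_zero.2 hn)
  have e1 := colength_span_prod_branch s hs hne
  have e2 := colength_span_prod_branch s (g := pullback n (MvPowerSeries.pderiv ℂ 0 h)) hs
    (by
      intro z hz h0
      have h1 := hordz z hz
      rw [h0, PowerSeries.order_zero, top_add] at h1
      exact hne z hz (PowerSeries.order_eq_top.1 h1))
  rw [← hF, hcol] at e1 e2
  rw [Multiset.map_congr rfl hordz, Multiset.sum_map_add, ← e2, hpol] at e1
  simp only [Multiset.map_const', Multiset.sum_replicate, hcard, nsmul_eq_mul] at e1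
  rw [mul_comm ((m - 1 : ℕ) : ℕ∞), ← mul_add] at e1
  rw [Set.pair_comm]
  exact (enat_mul_left_cancel hn e1).symm

end Milnor

/-! ### The double point ideal of a parametrization -/

/-- The difference quotient `(y(x₁) - y(x₀)) / (x₁ - x₀)`. -/
def diffQuot (y : PowerSeries ℂ) : Ser2 := ofCoeff fun i j => PowerSeries.coeff (i + j + 1) y

/-- The ideal of the double points of a parametrized curve `u ↦ φ(u)`, generated by the difference
quotients of its components. Its colength is twice the `δ`-invariant. -/
def doubleIdeal (φ : Fin 2 → PowerSeries ℂ) : Ideal Ser2 :=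
  Ideal.span {diffQuot (φ 0), diffQuot (φ 1)}

theorem coeff_ser1_one (a : PowerSeries ℂ) (i j : ℕ) :
    MvPowerSeries.coeff (biexp i j) (ser1 1 a) = if i = 0 then PowerSeries.coeff j a else 0 := by
  rw [ser1, PowerSeries.toMvPowerSeries_apply]
  split_ifs with hj
  · have := MvPowerSeries.coeff_embDomain_rename (R := ℂ)
      ⟨fun _ : Unit => (1 : Fin 2), fun _ _ _ => rfl⟩ a (Finsupp.single () j)
    rw [Finsupp.embDomain_single] at this
    have h2 : biexp i j = Finsupp.single 1 j := by simp [biexp, hj]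
    rw [h2]
    exact this
  · apply MvPowerSeries.coeff_rename_eq_zero
    rintro ⟨d, hd⟩
    have h1 := DFunLike.congr_fun hd 0
    rw [Finsupp.mapDomain_of_notMem_range] at h1
    · simp at h1; exact hj h1.symm
    · simp

theorem sub_mul_diffQuot (y : PowerSeries ℂ) :
    (MvPowerSeries.X 1 - MvPowerSeries.X 0) * diffQuot y = ser1 1 y - ser1 0 y := by
  rw [sub_mul]
  apply ser2_ext
  rintro (_ | i) (_ | j) <;> rw [map_sub, map_sub] <;>
  simp [coeff_X_zero_mul, coeff_X_zero_mul_zero, coeff_X_one_mul, coeff_X_one_mul_zero,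
    coeff_ser1_one, coeff_ser1_zero, diffQuot]
  rw [show i + 1 + j + 1 = i + (j + 1) + 1 by ring, sub_self]

theorem diffQuot_linear (a b : PowerSeries ℂ) (r s : ℂ) :
    diffQuot (PowerSeries.C r * a + PowerSeries.C s * b) =
      MvPowerSeries.C r * diffQuot a + MvPowerSeries.C s * diffQuot b := by
  apply ser2_ext
  intro i j
  simp [diffQuot]

theorem span_linear_le {A : Type} [CommRing A] (a b r s t u : A) :
    Ideal.span {r * a + s * b, t * a + u * b} ≤ Ideal.span {a, b} := by
  rw [Ideal.span_le]
  rintro x (rfl | rfl)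
  · exact Ideal.mem_span_pair.2 ⟨r, s, rfl⟩
  · exact Ideal.mem_span_pair.2 ⟨t, u, rfl⟩

theorem span_linear_eq {A : Type} [CommRing A] [Algebra ℂ A] (L : GL (Fin 2) ℂ) (a b : A) :
    Ideal.span {algebraMap ℂ A (L 0 0) * a + algebraMap ℂ A (L 0 1) * b,
      algebraMap ℂ A (L 1 0) * a + algebraMap ℂ A (L 1 1) * b} = Ideal.span {a, b} := by
  refine le_antisymm (span_linear_le _ _ _ _ _ _) ?_
  have h : (L⁻¹ : GL (Fin 2) ℂ).1 * L.1 = 1 := Units.inv_mul L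
  set M := (L⁻¹ : GL (Fin 2) ℂ).1 with hM
  have e : ∀ i j, M i 0 * L.1 0 j + M i 1 * L.1 1 j = (1 : Matrix (Fin 2) (Fin 2) ℂ) i j := by
    intro i j; rw [← h, Matrix.mul_apply, Fin.sum_univ_two]
  have e' : ∀ i j, algebraMap ℂ A (M i 0) * algebraMap ℂ A (L 0 j) +
      algebraMap ℂ A (M i 1) * algebraMap ℂ A (L 1 j) =
        algebraMap ℂ A ((1 : Matrix (Fin 2) (Fin 2) ℂ) i j) := by
    intro i j; rw [← e, map_add, map_mul, map_mul]
  refine le_trans (le_of_eq ?_) (span_linear_le _ _ (algebraMap ℂ A (M 0 0))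
    (algebraMap ℂ A (M 0 1)) (algebraMap ℂ A (M 1 0)) (algebraMap ℂ A (M 1 1)))
  have e00 := e' 0 0
  have e01 := e' 0 1
  have e10 := e' 1 0
  have e11 := e' 1 1
  simp only [Matrix.one_apply_eq, map_one] at e00 e11
  rw [Matrix.one_apply_ne (by decide), map_zero] at e01 e10
  congr 2
  · linear_combination -a * e00 - b * e01
  · congr 1
    linear_combination -a * e10 - b * e11

theorem doubleIdeal_puiseuxCurve (m : ℕ) (L : GL (Fin 2) ℂ) (y : PowerSeries ℂ) :
    doubleIdeal (puiseuxCurve m L y) =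
      Ideal.span {diffQuot (PowerSeries.X ^ m), diffQuot y} := by
  rw [doubleIdeal, puiseuxCurve, puiseuxCurve, diffQuot_linear, diffQuot_linear]
  exact span_linear_eq L _ _

theorem conjugate_X (m j : ℕ) :
    conjugate m PowerSeries.X j = PowerSeries.C (unityRoot m ^ j) * PowerSeries.X := by
  rw [conjugate, PowerSeries.rescale_X]

theorem ser1_X (i : Fin 2) : ser1 i PowerSeries.X = MvPowerSeries.X i := by
  rw [ser1, PowerSeries.toMvPowerSeries_X]

theorem X_sub_X_ne_zero : (MvPowerSeries.X 1 - MvPowerSeries.X 0 : Ser2) ≠ 0 := by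
  rw [← ser1_X 0]
  exact X_one_sub_ne_zero _ constantCoeff_X_ser1

instance : IsDomain Ser2 := NoZeroDivisors.to_isDomain _

theorem diffQuot_X_pow {m : ℕ} (hm : m ≠ 0) : diffQuot (PowerSeries.X ^ m) =
    (((Multiset.range (m - 1)).map fun j => conjugate m PowerSeries.X (j + 1)).map
      fun y => (MvPowerSeries.X 1 - ser1 0 y : Ser2)).prod := by
  have hζ := isPrimitiveRoot_unityRoot hm
  apply mul_left_cancel₀ X_sub_X_ne_zero
  rw [sub_mul_diffQuot]
  have h1 : ∀ i, ser1 i (PowerSeries.X ^ m) = MvPowerSeries.X i ^ m := by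
    intro i; rw [ser1, map_pow, PowerSeries.toMvPowerSeries_X]
  have h2 : (MvPowerSeries.X 1 : Ser2) ^ m - MvPowerSeries.X 0 ^ m =
      ∏ j ∈ Finset.range m, (MvPowerSeries.X 1 - ser1 0 (conjugate m PowerSeries.X j)) := by
    classical
    have hζ' : IsPrimitiveRoot (MvPowerSeries.C (unityRoot m) : Ser2) m :=
      hζ.map_of_injective fun _ _ h => MvPowerSeries.C_injective h
    rw [hζ'.pow_sub_pow_eq_prod_sub_mul _ _ (Nat.pos_of_ne_zero hm)]
    have h3 : Polynomial.nthRootsFinset m (1 : Ser2) =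
        (Finset.range m).image fun j => MvPowerSeries.C (unityRoot m) ^ j := by
      ext x
      rw [Polynomial.mem_nthRootsFinset (Nat.pos_of_ne_zero hm), Finset.mem_image]
      constructor
      · intro hx
        have : NeZero m := ⟨hm⟩
        obtain ⟨i, hi, rfl⟩ := hζ'.eq_pow_of_pow_eq_one hx
        exact ⟨i, Finset.mem_range.2 hi, rfl⟩
      · rintro ⟨i, _, rfl⟩
        rw [← pow_mul, mul_comm, pow_mul, hζ'.pow_eq_one, one_pow]
    rw [h3, Finset.prod_image]
    · refine Finset.prod_congr rfl fun j _ => ?_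
      rw [conjugate_X, ser1, map_mul, PowerSeries.toMvPowerSeries_C, PowerSeries.toMvPowerSeries_X,
        map_pow]
    · intro i hi j hj hij
      exact hζ'.pow_inj (Finset.mem_range.1 hi) (Finset.mem_range.1 hj) hij
  rw [h1, h1, h2, Multiset.map_map]
  obtain ⟨m', rfl⟩ := Nat.exists_eq_succ_of_ne_zero hm
  rw [Nat.succ_eq_add_one, Finset.prod_range_succ', conjugate_zero, ser1_X 0, mul_comm]
  rfl

/-- The colength of the double point ideal, in terms of the contact of `y` with its conjugates. -/
theorem colength_doubleIdeal_add {m : ℕ} (hm : m ≠ 0) (L : GL (Fin 2) ℂ) {y : PowerSeries ℂ}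
    (hprim : ∃ n, gcdBelow m y n = 1) :
    colength (doubleIdeal (puiseuxCurve m L y)) + ((m - 1 : ℕ) : ℕ∞) = contactSum m y := by
  have hζ := isPrimitiveRoot_unityRoot hm
  have hcX : ∀ j, MvPowerSeries.constantCoeff (σ := Unit) (conjugate m PowerSeries.X j) = 0 :=
    constantCoeff_conjugate constantCoeff_X_ser1
  have key : ∀ j, j + 1 < m →
      (curveEval PowerSeries.X (conjugate m PowerSeries.X (j + 1)) (diffQuot y)).order + 1 =
        (y - conjugate m y (j + 1)).order := by
    intro j hj
    have h1 := congrArg (curveEval PowerSeries.X (conjugate m PowerSeries.X (j + 1)))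
      (sub_mul_diffQuot y)
    rw [curveEval_mul constantCoeff_X_ser1 (hcX _), ← ser1_X 0, curveEval_X_sub (hcX _),
      curveEval_eq constantCoeff_X_ser1 (hcX _) (ser1 1 y - ser1 0 y), map_sub,
      substPair_ser1_one, substPair_ser1_zero, PowerSeries.X_subst] at h1
    have h2 : PowerSeries.subst (conjugate m PowerSeries.X (j + 1)) y = conjugate m y (j + 1) := by
      rw [conjugate_X, conjugate, PowerSeries.rescale_eq_subst, PowerSeries.smul_eq_C_mul]
    rw [h2, conjugate_X] at h1
    have h3 := congrArg PowerSeries.order h1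
    have h4 : PowerSeries.C (unityRoot m ^ (j + 1)) * PowerSeries.X - PowerSeries.X =
        PowerSeries.C (unityRoot m ^ (j + 1) - 1) * (PowerSeries.X : PowerSeries ℂ) := by
      rw [map_sub, map_one]; ring
    have h5 : (PowerSeries.C (unityRoot m ^ (j + 1) - 1) : PowerSeries ℂ).order = 0 := by
      apply PowerSeries.order_zero_of_unit
      refine (IsUnit.mk0 _ (sub_ne_zero.2 ?_)).map _
      exact hζ.pow_ne_one_of_pos_of_lt (Nat.succ_ne_zero j) hj
    have h6 : (y - conjugate m y (j + 1)).order = (conjugate m y (j + 1) - y).order := by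
      rw [← neg_sub, PowerSeries.order_neg]
    rw [h4, PowerSeries.order_mul, PowerSeries.order_mul, h5, PowerSeries.order_X, zero_add] at h3
    rw [h6, ← h3, conjugate_X, add_comm]
  rw [doubleIdeal_puiseuxCurve, diffQuot_X_pow hm, colength_span_prod_branch]
  · rw [Multiset.map_map, contactSum]
    change (∑ j ∈ Finset.range (m - 1), (curveEval PowerSeries.X
      (conjugate m PowerSeries.X (j + 1)) (diffQuot y)).order) + _ = _
    have h1 : ((m - 1 : ℕ) : ℕ∞) = ∑ j ∈ Finset.range (m - 1), 1 := by simp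
    rw [h1, ← Finset.sum_add_distrib]
    refine Finset.sum_congr rfl fun j hj => key j ?_
    rw [Finset.mem_range] at hj
    omega
  · simp only [Multiset.mem_map]; rintro _ ⟨j, _, rfl⟩; exact hcX _
  · simp only [Multiset.mem_map, Multiset.mem_range]
    rintro _ ⟨j, hj, rfl⟩ h0
    have h1 := key j (by omega)
    rw [h0, PowerSeries.order_zero, top_add] at h1
    have h2 := contactSum_ne_top hm hprim
    rw [contactSum, ENat.sum_ne_top] at h2
    exact h2 j (Finset.mem_range.2 hj) h1.symm

/-! ### The Milnor number in terms of the characteristic exponents -/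

theorem gcdBelow_dvd_left (m : ℕ) (y : PowerSeries ℂ) (n : ℕ) : gcdBelow m y n ∣ m := by
  rw [gcdBelow]; exact Nat.gcd_dvd_left _ _

theorem dvd_gcdBelow_iff {d m : ℕ} {y : PowerSeries ℂ} {n : ℕ} :
    d ∣ gcdBelow m y n ↔ d ∣ m ∧ ∀ k < n, PowerSeries.coeff k y ≠ 0 → d ∣ k := by
  classical
  rw [gcdBelow, Nat.dvd_gcd_iff, Finset.dvd_gcd_iff]
  simp only [Finset.mem_filter, Finset.mem_range, id, and_imp]

theorem gcdBelow_dvd_of_le {m : ℕ} {y : PowerSeries ℂ} {n n' : ℕ} (h : n ≤ n') :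
    gcdBelow m y n' ∣ gcdBelow m y n := by
  have := dvd_gcdBelow_iff.1 (dvd_refl (gcdBelow m y n'))
  exact dvd_gcdBelow_iff.2 ⟨this.1, fun k hk => this.2 k (lt_of_lt_of_le hk h)⟩

theorem gcdBelow_succ (m : ℕ) (y : PowerSeries ℂ) (n : ℕ) : gcdBelow m y (n + 1) =
    if PowerSeries.coeff n y = 0 then gcdBelow m y n else Nat.gcd (gcdBelow m y n) n := by
  refine Nat.dvd_antisymm ?_ ?_
  · have := dvd_gcdBelow_iff.1 (dvd_refl (gcdBelow m y (n + 1)))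
    split_ifs with h
    · exact gcdBelow_dvd_of_le (Nat.le_succ n)
    · exact Nat.dvd_gcd (gcdBelow_dvd_of_le (Nat.le_succ n)) (this.2 n (Nat.lt_succ_self n) h)
  · have h1 := dvd_gcdBelow_iff.1 (dvd_refl (gcdBelow m y n))
    split_ifs with h
    · refine dvd_gcdBelow_iff.2 ⟨h1.1, fun k hk h0 => ?_⟩
      rcases Nat.lt_succ_iff_lt_or_eq.1 hk with hk | rfl
      · exact h1.2 k hk h0
      · exact absurd h h0
    · refine dvd_gcdBelow_iff.2 ⟨(Nat.gcd_dvd_left _ _).trans h1.1, fun k hk h0 => ?_⟩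
      rcases Nat.lt_succ_iff_lt_or_eq.1 hk with hk | rfl
      · exact (Nat.gcd_dvd_left _ _).trans (h1.2 k hk h0)
      · exact Nat.gcd_dvd_right _ _

theorem gcdBelow_of_exponents {m : ℕ} {y : PowerSeries ℂ}
    (hy : ∀ n ≤ m, PowerSeries.coeff n y = 0) {n : ℕ} (hn : n ≤ m + 1) : gcdBelow m y n = m :=
  Nat.dvd_antisymm (gcdBelow_dvd_left m y n) (dvd_gcdBelow_iff.2
    ⟨dvd_rfl, fun k hk h0 => absurd (hy k (by omega)) h0⟩)

theorem gcdBelow_eq_one_of_le {m : ℕ} {y : PowerSeries ℂ} {N n : ℕ} (hN : gcdBelow m y N = 1)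
    (h : N ≤ n) : gcdBelow m y n = 1 :=
  Nat.dvd_one.1 (hN ▸ gcdBelow_dvd_of_le h)

/-- The number of `m`-th roots of unity whose `d`-th power is `1`, for `d` a divisor of `m`. -/
theorem card_filter_pow_eq_one {m d : ℕ} (hm : m ≠ 0) (hd : d ∣ m) :
    ((Finset.range m).filter fun j => (unityRoot m ^ j) ^ d = 1).card = d := by
  obtain ⟨e, rfl⟩ := hd
  have hd0 : 0 < d := Nat.pos_of_ne_zero (left_ne_zero_of_mul hm)
  have he0 : 0 < e := Nat.pos_of_ne_zero (right_ne_zero_of_mul hm)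
  have h : ((Finset.range (d * e)).filter fun j => (unityRoot (d * e) ^ j) ^ d = 1) =
      (Finset.range d).image fun t => e * t := by
    ext j
    simp only [Finset.mem_filter, Finset.mem_range, Finset.mem_image, ← pow_mul,
      (isPrimitiveRoot_unityRoot hm).pow_eq_one_iff_dvd]
    constructor
    · rintro ⟨h1, h2⟩
      rw [mul_comm j] at h2
      obtain ⟨t, rfl⟩ := Nat.dvd_of_mul_dvd_mul_left hd0 h2
      exact ⟨t, by rw [mul_comm d] at h1; exact Nat.lt_of_mul_lt_mul_left h1, rfl⟩
    · rintro ⟨t, ht, rfl⟩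
      exact ⟨by rw [mul_comm d]; exact Nat.mul_lt_mul_of_pos_left ht he0, t, by ring⟩
  rw [h, Finset.card_image_of_injective _ fun a b hab => Nat.eq_of_mul_eq_mul_left he0 hab,
    Finset.card_range]

/-- The order of contact of `y` with its conjugates: `ζ ^ j` contributes `1` at each `n` up to
`ord (y(u) - y(ζ ^ j u))`, and `ζ ^ j` contributes at `n` if its order divides `gcdBelow m y n`. -/
theorem contactSum_eq {m : ℕ} (hm : m ≠ 0) {y : PowerSeries ℂ} {N : ℕ}
    (hN : gcdBelow m y N = 1) :
    contactSum m y = ((∑ n ∈ Finset.Ico 1 N, (gcdBelow m y n - 1) : ℕ) : ℕ∞) := by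
  classical
  have hζ := isPrimitiveRoot_unityRoot hm
  have h1 : ∀ j, j + 1 < m → (y - conjugate m y (j + 1)).order =
      ((∑ n ∈ Finset.Ico 1 N, if (unityRoot m ^ (j + 1)) ^ gcdBelow m y n = 1 then 1 else 0 : ℕ) :
        ℕ∞) := by
    intro j hj
    set ω := unityRoot m ^ (j + 1) with hω
    have hω1 : ω ≠ 1 := hζ.pow_ne_one_of_pos_of_lt (Nat.succ_ne_zero j) hj
    have hωm : ω ^ m = 1 := by
      rw [hω, ← pow_mul, mul_comm, pow_mul, hζ.pow_eq_one, one_pow]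
    have hcoef : ∀ k, PowerSeries.coeff k (y - conjugate m y (j + 1)) =
        (1 - ω ^ k) * PowerSeries.coeff k y := by
      intro k; rw [map_sub, coeff_conjugate]; ring
    have hiff := pow_gcdBelow_eq_one_iff hωm y
    have hex : ∃ o, PowerSeries.coeff o (y - conjugate m y (j + 1)) ≠ 0 ∧ o < N := by
      by_contra! hcon
      apply hω1
      have := (hiff N).2 fun k hk h0 => by
        by_contra h2
        have := hcon k (by rw [hcoef]; exact mul_ne_zero (sub_ne_zero.2 (Ne.symm h2)) h0)
        omega
      rwa [hN, pow_one] at this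
    have hex' : ∃ o, PowerSeries.coeff o (y - conjugate m y (j + 1)) ≠ 0 :=
      hex.imp fun _ h => h.1
    set o := Nat.find hex' with ho
    have ho1 := Nat.find_spec hex'
    have hoN : o < N := by
      obtain ⟨k, hk, hkN⟩ := hex
      exact lt_of_le_of_lt (Nat.find_min' hex' hk) hkN
    have ho2 : ∀ k < o, PowerSeries.coeff k (y - conjugate m y (j + 1)) = 0 := fun k hk =>
      not_not.1 (Nat.find_min hex' hk)
    have hord : (y - conjugate m y (j + 1)).order = o :=
      PowerSeries.order_eq_nat.2 ⟨ho1, ho2⟩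
    have hmem : ∀ n, ω ^ gcdBelow m y n = 1 ↔ n ≤ o := by
      intro n
      rw [hiff]
      constructor
      · intro h
        by_contra! hlt
        rw [hcoef] at ho1
        exact ho1 (by rw [h o hlt (right_ne_zero_of_mul ho1), sub_self, zero_mul])
      · intro h k hk h0
        have := ho2 k (by omega)
        rw [hcoef] at this
        exact (sub_eq_zero.1 ((mul_eq_zero.1 this).resolve_right h0)).symm
    rw [hord]
    simp only [hmem]
    rw [← Finset.card_filter]
    have : (Finset.Ico 1 N).filter (fun n => n ≤ o) = Finset.Icc 1 o := by
      ext n; simp only [Finset.mem_filter, Finset.mem_Ico, Finset.mem_Icc]; omega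
    rw [this, Nat.card_Icc, Nat.add_sub_cancel]
  rw [contactSum, Finset.sum_congr rfl fun j hj => h1 j (by rw [Finset.mem_range] at hj; omega),
    ← Nat.cast_sum, Finset.sum_comm]
  congr 1
  refine Finset.sum_congr rfl fun n _ => ?_
  have h2 := card_filter_pow_eq_one hm (gcdBelow_dvd_left m y n)
  obtain ⟨m', rfl⟩ := Nat.exists_eq_succ_of_ne_zero hm
  rw [Finset.card_filter, Nat.succ_eq_add_one, Finset.sum_range_succ', pow_zero, one_pow,
    if_pos rfl] at h2
  exact Nat.eq_sub_of_add_eq h2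

/-- The sum `∑_{n ≥ 2} (D(n) - 1)`, cut off at `N`, where `D(n) = gcdBelow m y n`; for large `N`
this is the Milnor number. -/
def gcdSum (m : ℕ) (y : PowerSeries ℂ) (N : ℕ) : ℕ :=
  ∑ n ∈ Finset.Ico 2 N, (gcdBelow m y n - 1)

theorem contactSum_eq_gcdSum_add {m : ℕ} (hm : 2 ≤ m) {y : PowerSeries ℂ}
    (hy : ∀ n ≤ m, PowerSeries.coeff n y = 0) {N : ℕ} (hN : gcdBelow m y N = 1) :
    contactSum m y = (gcdSum m y N : ℕ∞) + ((m - 1 : ℕ) : ℕ∞) := by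
  have hN2 : 1 < N := by
    by_contra! h
    rw [gcdBelow_of_exponents hy (by omega)] at hN
    omega
  rw [contactSum_eq (by omega) hN, Finset.sum_eq_sum_Ico_succ_bot hN2,
    gcdBelow_of_exponents hy (by omega), gcdSum]
  push_cast
  rw [add_comm]

theorem colength_doubleIdeal {m : ℕ} (hm : 2 ≤ m) (L : GL (Fin 2) ℂ) {y : PowerSeries ℂ}
    (hy : ∀ n ≤ m, PowerSeries.coeff n y = 0) {N : ℕ} (hN : gcdBelow m y N = 1) :
    colength (doubleIdeal (puiseuxCurve m L y)) = gcdSum m y N := by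
  have h := colength_doubleIdeal_add (by omega) L ⟨N, hN⟩
  rw [contactSum_eq_gcdSum_add hm hy hN] at h
  exact WithTop.add_right_cancel (ENat.natCast_ne_top _) h

/-! ### Chains of divisors -/

/-- A chain `1 = f 0 ∣ f 1 ∣ ⋯ ∣ f g = m` of `g` proper divisions. Only the values of `f` up to `g`
matter. -/
structure IsDivisorChain (m g : ℕ) (f : ℕ → ℕ) : Prop where
  zero : f 0 = 1
  last : f g = m
  dvd : ∀ j < g, f j ∣ f (j + 1)
  lt : ∀ j < g, f j < f (j + 1)

/-- The least possible value of `∑_{n > m} (D(n) - 1)` when the greatest common divisors `D(n)` run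
down the chain `f`. -/
def chainWeight (f : ℕ → ℕ) (g : ℕ) : ℕ := ∑ j ∈ Finset.range g, f j * (f (j + 1) - 1)

theorem IsDivisorChain.dvd_of_le {m g : ℕ} {f : ℕ → ℕ} (hf : IsDivisorChain m g f) {i j : ℕ}
    (hij : i ≤ j) (hj : j ≤ g) : f i ∣ f j := by
  induction j, hij using Nat.le_induction with
  | base => exact dvd_rfl
  | succ j _ ih => exact (ih (by omega)).trans (hf.dvd j (by omega))

theorem IsDivisorChain.lt_of_lt {m g : ℕ} {f : ℕ → ℕ} (hf : IsDivisorChain m g f) {i j : ℕ}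
    (hij : i < j) (hj : j ≤ g) : f i < f j := by
  induction j, hij using Nat.le_induction with
  | base => exact hf.lt i (by omega)
  | succ j _ ih => exact (ih (by omega)).trans (hf.lt j (by omega))

theorem IsDivisorChain.pos {m g : ℕ} {f : ℕ → ℕ} (hf : IsDivisorChain m g f) {i : ℕ}
    (hi : i ≤ g) : 0 < f i := by
  rcases Nat.eq_zero_or_pos i with rfl | h
  · rw [hf.zero]; exact one_pos
  · exact lt_of_le_of_lt (Nat.zero_le _) (hf.lt_of_lt h hi)

/-- Replacing the end of a chain by a single step to `m` lowers the weight. -/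
theorem IsDivisorChain.exists_shorter {m g g' : ℕ} {f : ℕ → ℕ} (hf : IsDivisorChain m g' f)
    (hg : 1 ≤ g) (hgg : g < g') :
    ∃ f', IsDivisorChain m g f' ∧ chainWeight f' g < chainWeight f g' := by
  obtain ⟨g, rfl⟩ : ∃ c, g = c + 1 := ⟨g - 1, by omega⟩
  obtain ⟨c, rfl⟩ : ∃ c, g' = g + 1 + (c + 1) := ⟨g' - g - 2, by omega⟩
  have hfm := hf.last
  refine ⟨fun j => if j < g + 1 then f j else m, ⟨by simp [hf.zero], by simp, fun j hj => ?_,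
    fun j hj => ?_⟩, ?_⟩
  · rw [if_pos hj]
    split_ifs
    · exact hf.dvd j (by omega)
    · exact hfm ▸ hf.dvd_of_le (by omega) le_rfl
  · rw [if_pos hj]
    split_ifs
    · exact hf.lt j (by omega)
    · exact hfm ▸ hf.lt_of_lt (by omega) le_rfl
  · have h1 : f g < f (g + 1 + c) := hf.lt_of_lt (by omega) (by omega)
    have h2 : f g < m := hfm ▸ hf.lt_of_lt (by omega) le_rfl
    have h0 := hf.pos (i := g) (by omega)
    rw [chainWeight, chainWeight, ← Nat.add_assoc, Finset.sum_range_succ, Finset.sum_range_succ,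
      Finset.sum_range_add]
    have h3 : ∀ j ∈ Finset.range g, (if j < g + 1 then f j else m) *
        ((if j + 1 < g + 1 then f (j + 1) else m) - 1) = f j * (f (j + 1) - 1) := by
      intro j hj
      rw [Finset.mem_range] at hj
      rw [if_pos (by omega), if_pos (by omega)]
    rw [Finset.sum_congr rfl h3, if_pos (by omega), if_neg (by omega),
      show g + 1 + c + 1 = g + 1 + (c + 1) by ring, hfm, Finset.sum_range_succ]
    have h4 : f g * (m - 1) < f (g + 1 + c) * (m - 1) :=
      Nat.mul_lt_mul_of_pos_right h1 (by omega)
    omega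

/-- The smallest chain of length `g`: products of the smallest prime factors of `m`. -/
def nestedChain (m g j : ℕ) : ℕ := if j < g then (m.primeFactorsList.take j).prod else m

theorem prod_take_le_of_sublist {l l' : List ℕ} (hl : l.Pairwise (· ≤ ·)) (h : l'.Sublist l)
    {j : ℕ} (hj : j ≤ l'.length) : (l.take j).prod ≤ (l'.take j).prod := by
  induction l' generalizing l j with
  | nil => simp_all
  | cons b t' ih =>
    cases j with
    | zero => simp
    | succ j =>
      cases l with
      | nil => simp at h
      | cons a t =>
        rw [List.take_succ_cons, List.take_succ_cons, List.prod_cons, List.prod_cons]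
        have h1 : a ≤ b := by
          have hb : b ∈ a :: t := h.subset (by simp)
          rcases List.mem_cons.1 hb with rfl | hb
          · exact le_rfl
          · exact List.rel_of_pairwise_cons hl hb
        have h2 : t'.Sublist t := by
          cases h with
          | cons _ h => exact (List.sublist_cons_self _ _).trans h
          | cons_cons _ h => exact h
        exact Nat.mul_le_mul h1 (ih (List.Pairwise.of_cons hl) h2 (by simpa using hj))

theorem IsDivisorChain.le_length {m g : ℕ} {f : ℕ → ℕ} (hf : IsDivisorChain m g f) {j : ℕ}
    (hj : j ≤ g) : j ≤ (f j).primeFactorsList.length := by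
  induction j with
  | zero => simp
  | succ j ih =>
    refine lt_of_le_of_lt (ih (by omega)) ?_
    have h1 := Nat.primeFactorsList_sublist_of_dvd (hf.dvd j hj) (hf.pos hj).ne'
    refine lt_of_le_of_ne h1.length_le fun h2 => ?_
    have h3 := congrArg List.prod (h1.eq_of_length h2)
    rw [Nat.prod_primeFactorsList (hf.pos (by omega)).ne',
      Nat.prod_primeFactorsList (hf.pos hj).ne'] at h3
    exact (hf.lt j hj).ne h3

theorem prod_take_le_prod {l : List ℕ} (hl : ∀ a ∈ l, 1 ≤ a) (j : ℕ) :
    (l.take j).prod ≤ l.prod := by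
  have h1 : 1 ≤ (l.drop j).prod := List.one_le_prod fun a ha => hl a (List.mem_of_mem_drop ha)
  rw [← List.prod_take_mul_prod_drop l j]
  exact Nat.le_mul_of_pos_right _ h1

theorem IsDivisorChain.nestedChain_le {m g : ℕ} {f : ℕ → ℕ} (hf : IsDivisorChain m g f) {j : ℕ}
    (hj : j ≤ g) : nestedChain m g j ≤ f j := by
  rw [nestedChain]
  split_ifs with h
  · have h1 : f j ∣ m := hf.last ▸ hf.dvd_of_le hj le_rfl
    have hm : m ≠ 0 := hf.last ▸ (hf.pos le_rfl).ne'
    refine (prod_take_le_of_sublist (Nat.primeFactorsList_sorted m).pairwise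
      (Nat.primeFactorsList_sublist_of_dvd h1 hm) (hf.le_length hj)).trans ?_
    refine (prod_take_le_prod (fun a ha => (Nat.prime_of_mem_primeFactorsList ha).one_le) j).trans
      (Nat.prod_primeFactorsList (hf.pos hj).ne').le
  · obtain rfl : j = g := by omega
    exact hf.last.ge

theorem IsDivisorChain.chainWeight_nestedChain_le {m g : ℕ} {f : ℕ → ℕ}
    (hf : IsDivisorChain m g f) : chainWeight (nestedChain m g) g ≤ chainWeight f g := by
  refine Finset.sum_le_sum fun j hj => ?_
  rw [Finset.mem_range] at hj
  exact Nat.mul_le_mul (hf.nestedChain_le hj.le) (Nat.sub_le_sub_right (hf.nestedChain_le hj) 1)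

theorem prod_take_dvd_lt {m i j : ℕ} (hij : i < j) (hj : j ≤ m.primeFactorsList.length) :
    (m.primeFactorsList.take i).prod ∣ (m.primeFactorsList.take j).prod ∧
      (m.primeFactorsList.take i).prod < (m.primeFactorsList.take j).prod := by
  have hp : ∀ l : List ℕ, (∀ a ∈ l, a ∈ m.primeFactorsList) → 1 ≤ l.prod := fun l hl =>
    List.one_le_prod fun a ha => (Nat.prime_of_mem_primeFactorsList (hl a ha)).one_le
  induction j, hij using Nat.le_induction with
  | base =>
    have hi : i < m.primeFactorsList.length := hj
    have h2 := (Nat.prime_of_mem_primeFactorsList (List.getElem_mem hi)).two_le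
    have h1 := hp (m.primeFactorsList.take i) fun a ha => List.mem_of_mem_take ha
    rw [Nat.succ_eq_add_one, List.prod_take_succ _ _ hi]
    exact ⟨dvd_mul_right _ _, by nlinarith⟩
  | succ j _ ih =>
    obtain ⟨ih1, ih2⟩ := ih (by omega)
    have hi : j < m.primeFactorsList.length := hj
    have h2 := (Nat.prime_of_mem_primeFactorsList (List.getElem_mem hi)).two_le
    rw [List.prod_take_succ _ _ hi]
    exact ⟨ih1.trans (dvd_mul_right _ _), lt_of_lt_of_le ih2 (Nat.le_mul_of_pos_right _ (by omega))⟩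

theorem IsDivisorChain.nestedChain {m g : ℕ} {f : ℕ → ℕ} (hf : IsDivisorChain m g f) :
    IsDivisorChain m g (nestedChain m g) := by
  have hm : m ≠ 0 := hf.last ▸ (hf.pos le_rfl).ne'
  have hlen := hf.le_length le_rfl
  rw [hf.last] at hlen
  have hl : (m.primeFactorsList.take m.primeFactorsList.length).prod = m := by
    rw [List.take_length, Nat.prod_primeFactorsList hm]
  have key : ∀ j < g, PlaneCurve.nestedChain m g j ∣ PlaneCurve.nestedChain m g (j + 1) ∧
      PlaneCurve.nestedChain m g j < PlaneCurve.nestedChain m g (j + 1) := by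
    intro j hj
    rw [PlaneCurve.nestedChain, PlaneCurve.nestedChain, if_pos hj]
    split_ifs
    · exact prod_take_dvd_lt (Nat.lt_succ_self j) (by omega)
    · have := prod_take_dvd_lt (m := m) (i := j) (by omega) le_rfl
      rwa [hl] at this
  refine ⟨?_, by simp [PlaneCurve.nestedChain], fun j hj => (key j hj).1, fun j hj => (key j hj).2⟩
  rw [PlaneCurve.nestedChain]
  split_ifs with h
  · simp
  · obtain rfl : g = 0 := by omega
    rw [← hf.last, hf.zero]

/-- The closed formula for the weight of the smallest chain. It differs from `chainWeight` by a
telescoping sum, because the factors `d_j` and `d_{j+1}` change roles. -/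
theorem nestedChain_formula {m k : ℕ} (hk : 4 ≤ k)
    (hf : IsDivisorChain m (k - 1) (nestedChain m (k - 1))) :
    (m - 1) ^ 2 + chainWeight (nestedChain m (k - 1)) (k - 1) =
      m * (m - 2 + nestedDivisor m k 1) + ∑ j ∈ Finset.Icc 1 (k - 3),
        nestedDivisor m k j * (nestedDivisor m k (j + 1) - 1) := by
  obtain ⟨c, rfl⟩ : ∃ c, k = c + 4 := ⟨k - 4, by omega⟩
  rw [show c + 4 - 1 = c + 3 by omega, show c + 4 - 3 = c + 1 by omega] at *
  set F := nestedChain m (c + 3) with hF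
  have hd : ∀ i, i ≤ c + 2 → nestedDivisor m (c + 4) (i + 1) = F (c + 2 - i) := by
    intro i hi
    rw [nestedDivisor, hF, nestedChain, if_pos (by omega)]
    congr 2
    omega
  have hF0 := hf.zero
  have hFm := hf.last
  have hm2 : 2 ≤ m := by
    have := hf.lt_of_lt (i := 0) (j := c + 3) (by omega) le_rfl
    rw [hF0, hFm] at this; omega
  have hsum : ∑ j ∈ Finset.Icc 1 (c + 1), nestedDivisor m (c + 4) j *
      (nestedDivisor m (c + 4) (j + 1) - 1) =
        ∑ j ∈ Finset.range (c + 1), F (j + 2) * (F (j + 1) - 1) := by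
    rw [← Finset.sum_range_reflect, Finset.range_eq_Ico, ← Finset.Ico_add_one_right_eq_Icc,
      Finset.sum_Ico_eq_sum_range]
    refine Finset.sum_congr (by simp) fun j hj => ?_
    rw [Finset.mem_Ico] at hj
    rw [add_comm 1 j, hd j (by omega), hd (j + 1) (by omega)]
    congr 2 <;> congr 1 <;> omega
  -- the telescoping step, over the integers
  have hpos : ∀ i, i ≤ c + 3 → 0 < F i := fun i hi => hf.pos hi
  have htel : ∀ n, n ≤ c + 1 → (∑ j ∈ Finset.range n, F (j + 1) * (F (j + 2) - 1)) + F 1 =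
      (∑ j ∈ Finset.range n, F (j + 2) * (F (j + 1) - 1)) + F (n + 1) := by
    intro n
    induction n with
    | zero => simp
    | succ n ih =>
      intro hn
      have h1 := ih (by omega)
      rw [Finset.sum_range_succ, Finset.sum_range_succ]
      obtain ⟨a, ha⟩ := Nat.exists_eq_add_of_lt (hpos (n + 1) (by omega))
      obtain ⟨b, hb⟩ := Nat.exists_eq_add_of_lt (hpos (n + 2) (by omega))
      rw [show n + 1 + 1 = n + 2 by ring]
      rw [ha] at h1 ⊢
      rw [hb]
      simp only [zero_add, Nat.add_sub_cancel] at h1 ⊢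
      linarith [mul_comm a b]
  have h2 := htel (c + 1) le_rfl
  rw [hsum, hd 0 (by omega), chainWeight, Finset.sum_range_succ, Finset.sum_range_succ']
  simp only [show ∀ j, j + 1 + 1 = j + 2 from fun j => rfl, hF0, zero_add, one_mul, Nat.sub_zero]
    at h2 ⊢
  rw [show F (c + 2 + 1) = m from hFm]
  have h3 := hpos 1 (by omega)
  have h4 := hpos (c + 2) (by omega)
  obtain ⟨n, rfl⟩ : ∃ n, m = n + 2 := ⟨m - 2, by omega⟩
  obtain ⟨a, ha⟩ := Nat.exists_eq_add_of_lt h3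
  rw [ha] at h2 ⊢
  simp only [zero_add, Nat.add_sub_cancel, show n + 2 - 1 = n + 1 from rfl] at h2 ⊢
  nlinarith [h2]

/-! ### Characteristic exponents and chains of divisors -/

/-- The positions in `[a, N)` at which `gcdBelow` drops. -/
def drops (m : ℕ) (y : PowerSeries ℂ) (a N : ℕ) : Finset ℕ :=
  (Finset.Ico a N).filter fun α => gcdBelow m y (α + 1) < gcdBelow m y α

theorem gcdBelow_pos {m : ℕ} (hm : m ≠ 0) (y : PowerSeries ℂ) (n : ℕ) : 0 < gcdBelow m y n :=
  Nat.pos_of_dvd_of_pos (gcdBelow_dvd_left m y n) (Nat.pos_of_ne_zero hm)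

theorem ncard_charExponents {m : ℕ} {y : PowerSeries ℂ}
    (hy : ∀ n ≤ m, PowerSeries.coeff n y = 0) {N : ℕ} (hN : gcdBelow m y N = 1) :
    (charExponents m y).ncard = (drops m y (m + 1) N).card + 1 := by
  have h1 : charExponents m y = ↑(insert m (drops m y (m + 1) N)) := by
    ext α
    simp only [charExponents, drops, Set.mem_insert_iff, Set.mem_ofPred_eq, Finset.coe_insert,
      Finset.coe_filter, Finset.mem_Ico]
    refine or_congr_right ⟨fun h => ⟨⟨?_, ?_⟩, h⟩, fun h => h.2⟩
    · by_contra! h2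
      rw [gcdBelow_of_exponents hy (by omega), gcdBelow_of_exponents hy (by omega)] at h
      exact lt_irrefl _ h
    · by_contra! h2
      rw [gcdBelow_eq_one_of_le hN (by omega), gcdBelow_eq_one_of_le hN (by omega)] at h
      exact lt_irrefl _ h
  rw [h1, Set.ncard_coe_finset, Finset.card_insert_of_notMem]
  simp [drops]

theorem gcdBelow_eq_of_no_drop {m : ℕ} (hm : m ≠ 0) {y : PowerSeries ℂ} {a b : ℕ} (hab : a ≤ b)
    (h : ∀ n, a ≤ n → n < b → ¬ gcdBelow m y (n + 1) < gcdBelow m y n) :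
    gcdBelow m y b = gcdBelow m y a := by
  induction b, hab using Nat.le_induction with
  | base => rfl
  | succ b hb ih =>
    rw [← ih fun n h1 h2 => h n h1 (by omega)]
    exact le_antisymm (Nat.le_of_dvd (gcdBelow_pos hm y b) (gcdBelow_dvd_of_le (Nat.le_succ b)))
      (not_lt.1 (h b hb (Nat.lt_succ_self b)))

theorem sum_Ico_sub_one_of_const {F : ℕ → ℕ} {a b c : ℕ} (h : ∀ n, a ≤ n → n < b → F n = c) :
    ∑ n ∈ Finset.Ico a b, (F n - 1) = (b - a) * (c - 1) := by
  have h1 : ∀ n ∈ Finset.Ico a b, F n - 1 = c - 1 := fun n hn => by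
    rw [Finset.mem_Ico] at hn
    rw [h n hn.1 hn.2]
  rw [Finset.sum_congr rfl h1, Finset.sum_const, Nat.card_Ico, smul_eq_mul]

/-- Between two consecutive drops of the greatest common divisor, from `e` to `e'` and further,
there are at least `e'` steps. -/
theorem exists_chain_of_drops {m : ℕ} (hm : m ≠ 0) {y : PowerSeries ℂ} {N : ℕ}
    (hN : gcdBelow m y N = 1) (g : ℕ) : ∀ a, a + 1 ≤ N → gcdBelow m y (a + 1) ∣ a →
    (drops m y (a + 1) N).card = g →
    ∃ f, IsDivisorChain (gcdBelow m y (a + 1)) g f ∧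
      chainWeight f g ≤ ∑ n ∈ Finset.Ico (a + 1) N, (gcdBelow m y n - 1) := by
  induction g with
  | zero =>
    intro a ha _ h0
    have h1 : gcdBelow m y N = gcdBelow m y (a + 1) := by
      refine gcdBelow_eq_of_no_drop hm ha fun n h1 h2 h3 => ?_
      have : n ∈ drops m y (a + 1) N :=
        Finset.mem_filter.2 ⟨Finset.mem_Ico.2 ⟨h1, h2⟩, h3⟩
      rw [Finset.card_eq_zero.1 h0] at this
      simp at this
    refine ⟨fun _ => 1, ⟨rfl, by rw [← h1, hN], by simp, by simp⟩, by simp [chainWeight]⟩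
  | succ g ih =>
    intro a ha hdvd hcard
    have hne : (drops m y (a + 1) N).Nonempty := Finset.card_pos.1 (by omega)
    set b := (drops m y (a + 1) N).min' hne with hb
    have hbmem := Finset.min'_mem _ hne
    rw [← hb] at hbmem
    obtain ⟨hb1, hb2⟩ := Finset.mem_filter.1 hbmem
    rw [Finset.mem_Ico] at hb1
    have hconst : ∀ n, a + 1 ≤ n → n ≤ b → gcdBelow m y n = gcdBelow m y (a + 1) := by
      intro n h1 h2
      refine gcdBelow_eq_of_no_drop hm h1 fun k h3 h4 h5 => ?_
      have := Finset.min'_le (drops m y (a + 1) N) k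
        (Finset.mem_filter.2 ⟨Finset.mem_Ico.2 ⟨h3, by omega⟩, h5⟩)
      omega
    have hb3 : gcdBelow m y (b + 1) ∣ b := by
      by_cases h : PowerSeries.coeff b y = 0
      · rw [gcdBelow_succ, if_pos h] at hb2; exact absurd hb2 (lt_irrefl _)
      · rw [gcdBelow_succ, if_neg h]; exact Nat.gcd_dvd_right _ _
    have hsplit : drops m y (a + 1) N = insert b (drops m y (b + 1) N) := by
      ext n
      rw [Finset.mem_insert]
      constructor
      · intro hn
        have h1 := Finset.min'_le _ n hn
        rcases Nat.eq_or_lt_of_le h1 with h | h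
        · exact Or.inl (by rw [hb, h])
        · obtain ⟨h2, h3⟩ := Finset.mem_filter.1 hn
          rw [Finset.mem_Ico] at h2
          exact Or.inr (Finset.mem_filter.2 ⟨Finset.mem_Ico.2 ⟨by omega, h2.2⟩, h3⟩)
      · rintro (rfl | hn)
        · exact hbmem
        · obtain ⟨h2, h3⟩ := Finset.mem_filter.1 hn
          rw [Finset.mem_Ico] at h2
          exact Finset.mem_filter.2 ⟨Finset.mem_Ico.2 ⟨by omega, h2.2⟩, h3⟩
    have hcard' : (drops m y (b + 1) N).card = g := by
      rw [hsplit, Finset.card_insert_of_notMem (by simp [drops])] at hcard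
      omega
    obtain ⟨f, hf, hW⟩ := ih b (by omega) hb3 hcard'
    set e := gcdBelow m y (a + 1)
    set e' := gcdBelow m y (b + 1)
    have he : e' ∣ e := gcdBelow_dvd_of_le (by omega)
    have hlt : e' < e := by rwa [hconst b hb1.1 le_rfl] at hb2
    refine ⟨fun j => if j ≤ g then f j else e, ⟨by simp [hf.zero], by simp, fun j hj => ?_,
      fun j hj => ?_⟩, ?_⟩
    · rw [if_pos (by omega)]
      split_ifs
      · exact hf.dvd j (by omega)
      · obtain rfl : j = g := by omega
        rwa [hf.last]
    · rw [if_pos (by omega)]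
      split_ifs
      · exact hf.lt j (by omega)
      · obtain rfl : j = g := by omega
        rwa [hf.last]
    · rw [chainWeight, Finset.sum_range_succ, if_pos le_rfl, if_neg (by omega), hf.last]
      have h1 : ∑ j ∈ Finset.range g, (if j ≤ g then f j else e) *
          ((if j + 1 ≤ g then f (j + 1) else e) - 1) = chainWeight f g := by
        refine Finset.sum_congr rfl fun j hj => ?_
        rw [Finset.mem_range] at hj
        rw [if_pos (by omega), if_pos (by omega)]
      have h2 : ∑ n ∈ Finset.Ico (a + 1) (b + 1), (gcdBelow m y n - 1) = (b - a) * (e - 1) := by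
        rw [sum_Ico_sub_one_of_const fun n h3 h4 => hconst n h3 (by omega)]
        congr 1
        omega
      rw [h1, ← Finset.sum_Ico_consecutive _ (show a + 1 ≤ b + 1 by omega)
        (show b + 1 ≤ N by omega), h2, add_comm]
      refine Nat.add_le_add (Nat.mul_le_mul_right _ ?_) hW
      exact Nat.le_of_dvd (by omega) (Nat.dvd_sub hb3 (he.trans hdvd))

theorem sum_gcdBelow_initial {m : ℕ} {y : PowerSeries ℂ}
    (hy : ∀ n ≤ m, PowerSeries.coeff n y = 0) :
    ∑ n ∈ Finset.Ico 2 (m + 1), (gcdBelow m y n - 1) = (m - 1) ^ 2 := by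
  rw [sum_Ico_sub_one_of_const fun n _ h => gcdBelow_of_exponents hy (by omega), pow_two]
  congr 1

theorem exists_chain_le_gcdSum {m : ℕ} (hm : 2 ≤ m) {y : PowerSeries ℂ}
    (hy : ∀ n ≤ m, PowerSeries.coeff n y = 0) {N g : ℕ} (hN : gcdBelow m y N = 1)
    (hg : (charExponents m y).ncard = g + 1) :
    ∃ f, IsDivisorChain m g f ∧ (m - 1) ^ 2 + chainWeight f g ≤ gcdSum m y N := by
  have hmN : m + 1 ≤ N := by
    by_contra! h
    rw [gcdBelow_of_exponents hy (by omega)] at hN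
    omega
  rw [ncard_charExponents hy hN] at hg
  have h0 := gcdBelow_of_exponents hy (le_refl (m + 1))
  obtain ⟨f, hf, hW⟩ := exists_chain_of_drops (by omega) hN g m hmN (by rw [h0]) (by omega)
  rw [h0] at hf
  refine ⟨f, hf, ?_⟩
  rw [gcdSum, ← Finset.sum_Ico_consecutive _ (show 2 ≤ m + 1 by omega) hmN,
    sum_gcdBelow_initial hy]
  omega

/-- The exponents of the parametrization that realizes a chain: the gaps are the members of the
chain, in decreasing order. -/
def chainExponent (m g : ℕ) (f : ℕ → ℕ) (i : ℕ) : ℕ := m + ∑ l ∈ Finset.range i, f (g - 1 - l)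

open Classical in
/-- The polynomial `∑ u ^ β_i` over the exponents `β_i` attached to a chain. -/
def chainSeries (m g : ℕ) (f : ℕ → ℕ) : PowerSeries ℂ :=
  PowerSeries.mk fun n => if ∃ i < g, n = chainExponent m g f (i + 1) then 1 else 0

section ChainSeries

variable {m g : ℕ} {f : ℕ → ℕ} (hf : IsDivisorChain m g f)
include hf

theorem chainExponent_succ_pos {i : ℕ} (hi : i < g) :
    chainExponent m g f i < chainExponent m g f (i + 1) := by
  rw [chainExponent, chainExponent, Finset.sum_range_succ]
  have := hf.pos (i := g - 1 - i) (by omega)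
  omega

theorem chainExponent_lt {i j : ℕ} (hij : i < j) (hj : j ≤ g) :
    chainExponent m g f i < chainExponent m g f j := by
  induction j, hij using Nat.le_induction with
  | base => exact chainExponent_succ_pos hf (by omega)
  | succ j _ ih => exact (ih (by omega)).trans (chainExponent_succ_pos hf (by omega))

theorem coeff_chainSeries_eq_zero {n : ℕ} (hn : n ≤ m) :
    PowerSeries.coeff n (chainSeries m g f) = 0 := by
  rw [chainSeries, PowerSeries.coeff_mk, if_neg]
  rintro ⟨i, hi, rfl⟩
  have := chainExponent_lt hf (Nat.succ_pos i) hi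
  rw [Nat.succ_eq_add_one] at this
  simp only [chainExponent, Finset.range_zero, Finset.sum_empty] at this hn
  omega

theorem coeff_chainSeries_between {i n : ℕ} (hi : i < g) (h1 : chainExponent m g f i < n)
    (h2 : n < chainExponent m g f (i + 1)) :
    PowerSeries.coeff n (chainSeries m g f) = 0 := by
  rw [chainSeries, PowerSeries.coeff_mk, if_neg]
  rintro ⟨j, hj, rfl⟩
  rcases lt_trichotomy i j with h | rfl | h
  · have := chainExponent_lt hf (show i + 1 < j + 1 by omega) hj
    omega
  · exact lt_irrefl _ h2
  · rcases Nat.eq_or_lt_of_le (show j + 1 ≤ i from h) with h | h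
    · rw [h] at h1; exact lt_irrefl _ h1
    · have := chainExponent_lt hf h hi.le
      omega

theorem gcdBelow_chainSeries (hm : 2 ≤ m) (i : ℕ) (hi : i ≤ g) :
    gcdBelow m (chainSeries m g f) (chainExponent m g f i + 1) = f (g - i) ∧
    f (g - i) ∣ chainExponent m g f i ∧
    (drops m (chainSeries m g f) (m + 1) (chainExponent m g f i + 1)).card = i ∧
    gcdSum m (chainSeries m g f) (chainExponent m g f i + 1) =
      (m - 1) ^ 2 + ∑ l ∈ Finset.range i, f (g - 1 - l) * (f (g - 1 - l + 1) - 1) := by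
  have hy := fun n (hn : n ≤ m) => coeff_chainSeries_eq_zero hf hn
  induction i with
  | zero =>
    have h0 : chainExponent m g f 0 = m := by simp [chainExponent]
    rw [h0, Nat.sub_zero, hf.last, gcdBelow_of_exponents hy le_rfl]
    exact ⟨rfl, dvd_rfl, by simp [drops], by rw [gcdSum, sum_gcdBelow_initial hy]; simp⟩
  | succ i ih =>
    obtain ⟨ih1, ih2, ih3, ih4⟩ := ih (by omega)
    have hlt := chainExponent_succ_pos hf (show i < g by omega)
    have hmβ : m ≤ chainExponent m g f i := by rw [chainExponent]; omega
    have hstep : chainExponent m g f (i + 1) = chainExponent m g f i + f (g - 1 - i) := by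
      rw [chainExponent, Finset.sum_range_succ, ← Nat.add_assoc]; rfl
    set β := chainExponent m g f i with hβ
    set β' := chainExponent m g f (i + 1) with hβ'
    set y := chainSeries m g f with hyy
    have e1 : g - (i + 1) = g - 1 - i := by omega
    have e2 : g - i = g - 1 - i + 1 := by omega
    rw [e1]
    rw [e2] at ih1 ih2
    have hdvd := hf.dvd (g - 1 - i) (by omega)
    have hflt := hf.lt (g - 1 - i) (by omega)
    have hconst : ∀ n, β + 1 ≤ n → n ≤ β' → gcdBelow m y n = f (g - 1 - i + 1) := by
      intro n h1
      induction n, h1 using Nat.le_induction with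
      | base => exact fun _ => ih1
      | succ n hn ihn =>
        intro h2
        rw [gcdBelow_succ, if_pos (coeff_chainSeries_between hf (by omega : i < g) hn h2),
          ihn (by omega)]
    have hβ1 : PowerSeries.coeff β' y ≠ 0 := by
      rw [hyy, chainSeries, PowerSeries.coeff_mk, if_pos ⟨i, by omega, rfl⟩]
      exact one_ne_zero
    have hD : gcdBelow m y (β' + 1) = f (g - 1 - i) := by
      rw [gcdBelow_succ, if_neg hβ1, hconst β' hlt le_rfl, hstep]
      refine Nat.dvd_antisymm ?_ (Nat.dvd_gcd hdvd ((hdvd.trans ih2).add dvd_rfl))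
      exact (Nat.dvd_add_right ((Nat.gcd_dvd_left _ _).trans ih2)).1 (Nat.gcd_dvd_right _ _)
    refine ⟨hD, ?_, ?_, ?_⟩
    · rw [hstep]; exact (hdvd.trans ih2).add dvd_rfl
    · have : drops m y (m + 1) (β' + 1) = insert β' (drops m y (m + 1) (β + 1)) := by
        ext n
        simp only [drops, Finset.mem_insert, Finset.mem_filter, Finset.mem_Ico]
        constructor
        · rintro ⟨⟨h1, h2⟩, h3⟩
          rcases Nat.lt_or_ge n (β + 1) with h4 | h4
          · exact Or.inr ⟨⟨h1, h4⟩, h3⟩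
          · rcases Nat.lt_or_ge n β' with h5 | h5
            · rw [hconst n h4 h5.le, hconst (n + 1) (by omega) h5] at h3
              exact absurd h3 (lt_irrefl _)
            · exact Or.inl (by omega)
        · rintro (rfl | ⟨⟨h1, h2⟩, h3⟩)
          · refine ⟨⟨by omega, by omega⟩, ?_⟩
            rw [hD, hconst _ hlt le_rfl]
            exact hflt
          · exact ⟨⟨h1, by omega⟩, h3⟩
      rw [this, Finset.card_insert_of_notMem, ih3]
      simp only [drops, Finset.mem_filter, Finset.mem_Ico]
      omega
    · rw [Finset.sum_range_succ, ← Nat.add_assoc, ← ih4, gcdSum, gcdSum,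
        ← Finset.sum_Ico_consecutive _ (show 2 ≤ β + 1 by omega) (show β + 1 ≤ β' + 1 by omega)]
      congr 1
      rw [sum_Ico_sub_one_of_const fun n h5 h6 => hconst n h5 (by omega)]
      congr 1
      omega

/-- Every chain is realized, with equality in the lower bound, by a polynomial parametrization. -/
theorem exists_series_of_chain (hm : 2 ≤ m) :
    ∃ (y : PowerSeries ℂ) (N : ℕ), (∀ n ≤ m, PowerSeries.coeff n y = 0) ∧
      (∀ n, N ≤ n → PowerSeries.coeff n y = 0) ∧ gcdBelow m y N = 1 ∧
      (charExponents m y).ncard = g + 1 ∧ gcdSum m y N = (m - 1) ^ 2 + chainWeight f g := by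
  obtain ⟨h1, -, h3, h4⟩ := gcdBelow_chainSeries hf hm g le_rfl
  rw [Nat.sub_self, hf.zero] at h1
  have hy := fun n (hn : n ≤ m) => coeff_chainSeries_eq_zero hf hn
  refine ⟨chainSeries m g f, chainExponent m g f g + 1, hy, ?_, h1, ?_, ?_⟩
  · intro n hn
    rw [chainSeries, PowerSeries.coeff_mk, if_neg]
    rintro ⟨i, hi, rfl⟩
    rcases Nat.eq_or_lt_of_le (show i + 1 ≤ g from hi) with h | h
    · rw [h] at hn; omega
    · have := chainExponent_lt hf h le_rfl
      omega
  · rw [ncard_charExponents hy h1, h3]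
  · rw [h4, chainWeight, ← Finset.sum_range_reflect (fun j => f j * (f (j + 1) - 1))]

end ChainSeries

/-! ### Linear changes of coordinates -/

/-- The components of the linear map given by `M`. -/
def linForm (M : Matrix (Fin 2) (Fin 2) ℂ) (i : Fin 2) : Ser2 :=
  MvPowerSeries.C (M i 0) * MvPowerSeries.X 0 + MvPowerSeries.C (M i 1) * MvPowerSeries.X 1

theorem constantCoeff_linForm (M : Matrix (Fin 2) (Fin 2) ℂ) (i : Fin 2) :
    MvPowerSeries.constantCoeff (linForm M i) = 0 := by
  simp [linForm]

/-- The substitution of the components of the linear map given by `M`. -/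
def linSubst (M : Matrix (Fin 2) (Fin 2) ℂ) : Ser2 →ₐ[ℂ] Ser2 :=
  substPair (constantCoeff_linForm M 0) (constantCoeff_linForm M 1)

theorem map_C {A : Type} [CommRing A] [Algebra ℂ A] (f : Ser2 →ₐ[ℂ] A) (c : ℂ) :
    f (MvPowerSeries.C c) = algebraMap ℂ A c := f.commutes c

theorem linSubst_linForm (M M' : Matrix (Fin 2) (Fin 2) ℂ) (i : Fin 2) :
    linSubst M (linForm M' i) = linForm (M' * M) i := by
  rw [linForm, map_add, map_mul, map_mul, map_C, map_C, linSubst, substPair_X_zero,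
    substPair_X_one, linForm, linForm, linForm, Matrix.mul_apply, Matrix.mul_apply,
    Fin.sum_univ_two, Fin.sum_univ_two]
  change MvPowerSeries.C _ * _ + MvPowerSeries.C _ * _ = _
  simp only [map_add, map_mul]
  ring

theorem linForm_one (i : Fin 2) : linForm 1 i = MvPowerSeries.X i := by
  obtain rfl | rfl : i = 0 ∨ i = 1 := by omega
  all_goals simp [linForm]

theorem linSubst_linSubst {M M' : Matrix (Fin 2) (Fin 2) ℂ} (h : M' * M = 1) (g : Ser2) :
    linSubst M (linSubst M' g) = g := by
  have h0 := linSubst_linForm M M' 0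
  have h1 := linSubst_linForm M M' 1
  rw [h, linForm_one] at h0 h1
  have := substAlgHom_substPair (constantCoeff_linForm M' 0) (constantCoeff_linForm M' 1)
    (hasSubst_pair (constantCoeff_linForm M 0) (constantCoeff_linForm M 1))
    (by simp) (by simp) h0 h1 g
  refine this.trans ?_
  rw [substPair, MvPowerSeries.coe_substAlgHom]
  have h2 : (![MvPowerSeries.X 0, MvPowerSeries.X 1] : Fin 2 → Ser2) = MvPowerSeries.X := by
    funext i; fin_cases i <;> rfl
  rw [h2, MvPowerSeries.subst_self]; rfl

theorem inv_mul_coe (L : GL (Fin 2) ℂ) : (L⁻¹ : GL (Fin 2) ℂ).1 * L.1 = 1 := Units.inv_mul L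

theorem mul_inv_coe (L : GL (Fin 2) ℂ) : L.1 * (L⁻¹ : GL (Fin 2) ℂ).1 = 1 := Units.mul_inv L

/-- A linear change of coordinates as an automorphism of `ℂ⟦x, y⟧`. -/
def linEquiv (L : GL (Fin 2) ℂ) : Ser2 ≃ₐ[ℂ] Ser2 :=
  AlgEquiv.ofAlgHom (linSubst L.1) (linSubst (L⁻¹ : GL (Fin 2) ℂ).1)
    (AlgHom.ext fun g => linSubst_linSubst (inv_mul_coe L) g)
    (AlgHom.ext fun g => linSubst_linSubst (mul_inv_coe L) g)

theorem le_order_linSubst (M : Matrix (Fin 2) (Fin 2) ℂ) (g : Ser2) :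
    g.order ≤ (linSubst M g).order := by
  have h := MvPowerSeries.le_order_subst
    (hasSubst_pair (constantCoeff_linForm M 0) (constantCoeff_linForm M 1)) g
  rw [linSubst, substPair, MvPowerSeries.coe_substAlgHom]
  refine le_trans ?_ h
  have h1 : (1 : ℕ∞) ≤ ⨅ i, (![linForm M 0, linForm M 1] i).order := by
    refine le_iInf fun i => MvPowerSeries.one_le_order_iff_constCoeff_eq_zero.2 ?_
    fin_cases i
    · exact constantCoeff_linForm M 0
    · exact constantCoeff_linForm M 1
  calc g.order = 1 * g.order := (one_mul _).symm
    _ ≤ _ := mul_le_mul_left h1 _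

theorem order_linSubst (L : GL (Fin 2) ℂ) (g : Ser2) : (linSubst L.1 g).order = g.order := by
  refine le_antisymm ?_ (le_order_linSubst _ _)
  have := le_order_linSubst (L⁻¹ : GL (Fin 2) ℂ).1 (linSubst L.1 g)
  rwa [linSubst_linSubst (mul_inv_coe L)] at this

theorem constantCoeff_linear {a b : PowerSeries ℂ}
    (ha : MvPowerSeries.constantCoeff (σ := Unit) a = 0)
    (hb : MvPowerSeries.constantCoeff (σ := Unit) b = 0) (r s : ℂ) :
    MvPowerSeries.constantCoeff (σ := Unit) (PowerSeries.C r * a + PowerSeries.C s * b) = 0 := by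
  refine (map_add _ _ _).trans ?_
  have h1 := map_mul (MvPowerSeries.constantCoeff (σ := Unit) (R := ℂ)) (PowerSeries.C r) a
  have h2 := map_mul (MvPowerSeries.constantCoeff (σ := Unit) (R := ℂ)) (PowerSeries.C s) b
  rw [ha, mul_zero] at h1
  rw [hb, mul_zero] at h2
  exact (congrArg₂ (· + ·) h1 h2).trans (add_zero 0)

theorem curveEval_linSubst {a b : PowerSeries ℂ}
    (ha : MvPowerSeries.constantCoeff (σ := Unit) a = 0)
    (hb : MvPowerSeries.constantCoeff (σ := Unit) b = 0) (M : Matrix (Fin 2) (Fin 2) ℂ) (g : Ser2) :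
    curveEval a b (linSubst M g) = curveEval (PowerSeries.C (M 0 0) * a + PowerSeries.C (M 0 1) * b)
      (PowerSeries.C (M 1 0) * a + PowerSeries.C (M 1 1) * b) g := by
  have hl : ∀ i, substPair ha hb (linForm M i) =
      PowerSeries.C (M i 0) * a + PowerSeries.C (M i 1) * b := by
    intro i
    rw [linForm, map_add, map_mul, map_mul, map_C, map_C, substPair_X_zero, substPair_X_one]
    rfl
  have hc := fun i => constantCoeff_linear ha hb (M i 0) (M i 1)
  rw [curveEval_eq ha hb, curveEval_eq (hc 0) (hc 1)]
  exact substAlgHom_substPair (constantCoeff_linForm M 0) (constantCoeff_linForm M 1)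
    (hasSubst_pair ha hb) (hc 0) (hc 1) (hl 0) (hl 1) g

theorem pderiv_linSubst (M : Matrix (Fin 2) (Fin 2) ℂ) (j : Fin 2) (g : Ser2) :
    MvPowerSeries.pderiv ℂ j (linSubst M g) =
      algebraMap ℂ Ser2 (M 0 j) * linSubst M (MvPowerSeries.pderiv ℂ 0 g) +
      algebraMap ℂ Ser2 (M 1 j) * linSubst M (MvPowerSeries.pderiv ℂ 1 g) := by
  have hl : ∀ i, MvPowerSeries.pderiv ℂ j (linForm M i) = algebraMap ℂ Ser2 (M i j) := by
    intro i
    rw [linForm, map_add, Derivation.leibniz, Derivation.leibniz]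
    fin_cases j
    · have h01 : MvPowerSeries.pderiv ℂ (0 : Fin 2) (MvPowerSeries.X 1) = 0 :=
        MvPowerSeries.pderiv_X_of_ne (by decide)
      simp [h01, MvPowerSeries.pderiv_X_self, MvPowerSeries.pderiv_C]
      rfl
    · have h10 : MvPowerSeries.pderiv ℂ (1 : Fin 2) (MvPowerSeries.X 0) = 0 :=
        MvPowerSeries.pderiv_X_of_ne (by decide)
      simp [h10, MvPowerSeries.pderiv_X_self, MvPowerSeries.pderiv_C]
      rfl
  rw [linSubst, derivation_substPair, hl, hl, mul_comm, mul_comm (algebraMap ℂ Ser2 (M 1 j))]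

/-- The jacobian ideal of a formal series. -/
def jacobianIdeal (h : Ser2) : Ideal Ser2 :=
  Ideal.span {MvPowerSeries.pderiv ℂ 0 h, MvPowerSeries.pderiv ℂ 1 h}

theorem colength_jacobianIdeal_linSubst (L : GL (Fin 2) ℂ) (h : Ser2) :
    colength (jacobianIdeal (linSubst L.1 h)) = colength (jacobianIdeal h) := by
  let T : GL (Fin 2) ℂ := ⟨L.1.transpose, (L⁻¹ : GL (Fin 2) ℂ).1.transpose,
    by rw [← Matrix.transpose_mul, inv_mul_coe, Matrix.transpose_one],
    by rw [← Matrix.transpose_mul, mul_inv_coe, Matrix.transpose_one]⟩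
  rw [← colength_map_equiv (linEquiv L) (jacobianIdeal h), jacobianIdeal, jacobianIdeal,
    Ideal.map_span, Set.image_pair, pderiv_linSubst, pderiv_linSubst]
  congr 1
  exact span_linear_eq T _ _

/-- The Milnor number of a branch, computed in the ring of formal power series. -/
theorem colength_jacobianIdeal {m : ℕ} (hm : 2 ≤ m) (L : GL (Fin 2) ℂ) {y : PowerSeries ℂ}
    (hy : ∀ n ≤ m, PowerSeries.coeff n y = 0) {N : ℕ} (hN : gcdBelow m y N = 1) {h : Ser2}
    (hord : h.order = m)
    (hh : MvPowerSeries.subst (puiseuxCurve m L y : Fin 2 → MvPowerSeries Unit ℂ) h = 0) :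
    colength (jacobianIdeal h) = gcdSum m y N := by
  have hcc := cc_of_exponents hy
  have hm0 : m ≠ 0 := by omega
  have h1 : curveEval (PowerSeries.X ^ m) y (linSubst L.1 h) = 0 := by
    rw [curveEval_linSubst (constantCoeff_X_pow_ser1 hm0) hcc, ← hh, curveEval]
    congr 1
    funext i
    fin_cases i <;> rfl
  have h2 := colength_jacobian_add hm0 hy ⟨N, hN⟩ ((order_linSubst L h).trans hord) h1
  rw [contactSum_eq_gcdSum_add hm hy hN] at h2
  rw [← colength_jacobianIdeal_linSubst L h]
  exact WithTop.add_right_cancel (ENat.natCast_ne_top _) h2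

/-! ### Ideals of finite colength -/

section FiniteColength

variable {A : Type} [CommRing A] [Algebra ℂ A]

theorem colength_add_one_le {I J : Ideal A} (h : I < J) : colength J + 1 ≤ colength I := by
  let g : (A ⧸ I) →ₗ[ℂ] (A ⧸ J) := (Submodule.factor h.le).restrictScalars ℂ
  have hg : Function.Surjective g := Submodule.factor_surjective h.le
  have h1 := Module.length_eq_add_of_exact (LinearMap.ker g).subtype g
    (Submodule.subtype_injective _) hg (LinearMap.exact_subtype_ker_map g)
  have h2 : Nontrivial (LinearMap.ker g) := by
    obtain ⟨x, hxJ, hxI⟩ := SetLike.exists_of_lt h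
    refine ⟨⟨⟨Ideal.Quotient.mk I x, Ideal.Quotient.eq_zero_iff_mem.2 hxJ⟩, 0, fun h0 => hxI ?_⟩⟩
    exact Ideal.Quotient.eq_zero_iff_mem.1 (congrArg Subtype.val h0)
  have h3 : (1 : ℕ∞) ≤ Module.length ℂ (LinearMap.ker g) := Order.one_le_iff_pos.2 Module.length_pos
  rw [colength, colength, h1, add_comm]
  exact add_le_add h3 le_rfl

/-- By Nakayama's lemma, the ideals `I + M ^ i` decrease strictly until `M ^ i` is contained in
`I`. -/
theorem pow_le_of_colength_le {M : Ideal A} (hfg : M.FG) (hM : M ≤ Ideal.jacobson ⊥) {I : Ideal A}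
    {d : ℕ} (hd : colength (I ⊔ M ^ (d + 1)) ≤ d) : M ^ d ≤ I := by
  by_contra hcon
  have h1 : ∀ i, i ≤ d → ¬ M ^ i ≤ I := fun i hi h => hcon ((Ideal.pow_le_pow_right hi).trans h)
  have h2 : ∀ i, i ≤ d → colength (I ⊔ M ^ i) + 1 ≤ colength (I ⊔ M ^ (i + 1)) := by
    intro i hi
    refine colength_add_one_le (lt_of_le_of_ne
      (sup_le_sup_left (Ideal.pow_le_pow_right (Nat.le_succ i)) I) fun h => h1 i hi ?_)
    refine Submodule.le_of_le_smul_of_le_jacobson_bot (hfg.pow (n := i)) hM ?_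
    rw [smul_eq_mul, ← pow_succ', h]
    exact le_sup_right
  have h3 : ∀ i, i ≤ d + 1 → (i : ℕ∞) ≤ colength (I ⊔ M ^ i) := by
    intro i
    induction i with
    | zero => simp
    | succ i ih =>
      intro hi
      rw [Nat.cast_add, Nat.cast_one]
      exact (add_le_add (ih (by omega)) le_rfl).trans (h2 i (by omega))
  have h4 := (h3 (d + 1) le_rfl).trans hd
  have h5 : d + 1 ≤ d := by exact_mod_cast h4
  omega

theorem colength_le_of_span_sup_eq_top {d : ℕ} {I : Ideal A} {e : Fin d → A}
    (h : Submodule.span ℂ (Set.range e) ⊔ I.restrictScalars ℂ = ⊤) : colength I ≤ d := by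
  let f : (Fin d → ℂ) →ₗ[ℂ] A ⧸ I := Fintype.linearCombination ℂ fun i => Ideal.Quotient.mk I (e i)
  have hf : Function.Surjective f := by
    intro x
    obtain ⟨x, rfl⟩ := Ideal.Quotient.mk_surjective x
    have hx : x ∈ Submodule.span ℂ (Set.range e) ⊔ I.restrictScalars ℂ := h ▸ Submodule.mem_top
    obtain ⟨a, ha, b, hb, rfl⟩ := Submodule.mem_sup.1 hx
    obtain ⟨c, rfl⟩ := (Submodule.mem_span_range_iff_exists_fun ℂ).1 ha
    refine ⟨c, ?_⟩
    have hb' : Ideal.Quotient.mk I b = 0 := Ideal.Quotient.eq_zero_iff_mem.2 hb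
    rw [map_add, hb', add_zero, map_sum, Fintype.linearCombination_apply]
    rfl
  have h1 := Module.length_le_of_surjective f hf
  rwa [Module.length_pi, show Module.length ℂ ℂ = 1 from Module.length_eq_one ℂ ℂ, mul_one, ENat.card_eq_coe_fintype_card,
    Fintype.card_fin] at h1

theorem exists_span_sup_eq_top {d : ℕ} {I : Ideal A} (h : colength I = d) :
    ∃ e : Fin d → A, Submodule.span ℂ (Set.range e) ⊔ I.restrictScalars ℂ = ⊤ := by
  rw [colength, Module.length_eq_rank] at h
  have h1 : Module.rank ℂ (A ⧸ I) = d := Cardinal.toENat_eq_natCast.1 h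
  have h2 : Module.Finite ℂ (A ⧸ I) := Module.rank_lt_aleph0_iff.1 (h1 ▸ Cardinal.natCast_lt_aleph0)
  have h3 : Module.finrank ℂ (A ⧸ I) = d := Module.finrank_eq_of_rank_eq h1
  let b := Module.finBasisOfFinrankEq ℂ (A ⧸ I) h3
  choose e he using fun i => Ideal.Quotient.mk_surjective (b i)
  refine ⟨e, eq_top_iff.2 fun x _ => ?_⟩
  have h4 := b.sum_repr (Ideal.Quotient.mk I x)
  refine Submodule.mem_sup.2 ⟨∑ i, b.repr (Ideal.Quotient.mk I x) i • e i,
    (Submodule.mem_span_range_iff_exists_fun ℂ).2 ⟨_, rfl⟩,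
    x - ∑ i, b.repr (Ideal.Quotient.mk I x) i • e i, ?_, by ring⟩
  refine Ideal.Quotient.eq_zero_iff_mem.1 ?_
  rw [map_sub, map_sum, sub_eq_zero]
  conv_lhs => rw [← h4]
  refine Finset.sum_congr rfl fun i _ => ?_
  rw [← he i]
  rfl

end FiniteColength

/-! ### The maximal ideal of `ℂ⟦x, y⟧` and semicontinuity of the colength -/

/-- The maximal ideal `(x, y)` of `ℂ⟦x, y⟧`. -/
def maxIdeal : Ideal Ser2 := Ideal.span {MvPowerSeries.X 0, MvPowerSeries.X 1}

theorem maxIdeal_fg : maxIdeal.FG := by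
  classical
  exact ⟨{MvPowerSeries.X 0, MvPowerSeries.X 1}, by simp [maxIdeal]⟩

theorem maxIdeal_le_jacobson : maxIdeal ≤ Ideal.jacobson ⊥ := by
  intro f hf
  rw [Ideal.mem_jacobson_bot]
  intro g
  obtain ⟨a, b, rfl⟩ := Ideal.mem_span_pair.1 hf
  rw [MvPowerSeries.isUnit_iff_constantCoeff]
  simp

theorem le_order_shiftX {K : ℕ} {g : Ser2} (h : ((K + 1 : ℕ) : ℕ∞) ≤ g.order) :
    (K : ℕ∞) ≤ (shiftX g).order := by
  refine MvPowerSeries.nat_le_order fun n hn => ?_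
  rw [eq_biexp n] at hn ⊢
  rw [degree_biexp] at hn
  rw [shiftX, coeff_ofCoeff]
  refine MvPowerSeries.coeff_of_lt_order (lt_of_lt_of_le ?_ h)
  rw [degree_biexp]
  exact_mod_cast (by omega)

theorem le_order_shiftY {K : ℕ} {g : Ser2} (h : ((K + 1 : ℕ) : ℕ∞) ≤ g.order) :
    (K : ℕ∞) ≤ (shiftY g).order := by
  refine MvPowerSeries.nat_le_order fun n hn => ?_
  rw [eq_biexp n] at hn ⊢
  rw [degree_biexp] at hn
  rw [shiftY, coeff_ofCoeff]
  split_ifs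
  · refine MvPowerSeries.coeff_of_lt_order (lt_of_lt_of_le ?_ h)
    rw [degree_biexp]
    exact_mod_cast (by omega)
  · rfl

theorem eq_shift_of_le_order {K : ℕ} {g : Ser2} (h : ((K + 1 : ℕ) : ℕ∞) ≤ g.order) :
    g = MvPowerSeries.X 0 * shiftX g + MvPowerSeries.X 1 * shiftY g := by
  have h0 : MvPowerSeries.coeff (biexp 0 0) g = 0 := by
    refine MvPowerSeries.coeff_of_lt_order (lt_of_lt_of_le ?_ h)
    rw [degree_biexp]
    exact_mod_cast (by omega)
  have h1 := eq_C_add_shift g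
  rwa [h0, map_zero, zero_add] at h1

theorem mem_maxIdeal_pow_of_le_order {K : ℕ} {g : Ser2} (h : (K : ℕ∞) ≤ g.order) :
    g ∈ maxIdeal ^ K := by
  induction K generalizing g with
  | zero => simp
  | succ K ih =>
    rw [eq_shift_of_le_order h, pow_succ']
    exact Ideal.add_mem _
      (Ideal.mul_mem_mul (Ideal.subset_span (by simp)) (ih (le_order_shiftX h)))
      (Ideal.mul_mem_mul (Ideal.subset_span (by simp)) (ih (le_order_shiftY h)))

/-- A finite set of exponents that contains all exponents of degree less than `K`. -/
def lowExponents (K : ℕ) : Finset (Fin 2 →₀ ℕ) :=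
  (Finset.range K ×ˢ Finset.range K).image fun p => biexp p.1 p.2

theorem mem_lowExponents {K : ℕ} {n : Fin 2 →₀ ℕ} (h : n.degree < K) : n ∈ lowExponents K := by
  have h1 := eq_biexp n
  rw [h1, degree_biexp] at h
  exact Finset.mem_image.2 ⟨(n 0, n 1), Finset.mem_product.2
    ⟨Finset.mem_range.2 (by omega), Finset.mem_range.2 (by omega)⟩, h1.symm⟩

/-- The colength of an ideal with two generators is upper semicontinuous in the generators: to
generate the quotient modulo `M ^ K` by given elements is an open condition. -/
theorem eventually_colength_le {T : Type} {l : Filter T} {p q : T → Ser2} {p₀ q₀ : Ser2}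
    (hp : ∀ n, Tendsto (fun t => MvPowerSeries.coeff n (p t)) l (𝓝 (MvPowerSeries.coeff n p₀)))
    (hq : ∀ n, Tendsto (fun t => MvPowerSeries.coeff n (q t)) l (𝓝 (MvPowerSeries.coeff n q₀)))
    {d : ℕ} (hd : colength (Ideal.span {p₀, q₀}) = d) :
    ∀ᶠ t in l, colength (Ideal.span {p t, q t}) ≤ d := by
  classical
  obtain ⟨e, he⟩ := exists_span_sup_eq_top hd
  set S := lowExponents (d + 1)
  have hrep : ∀ α : S, ∃ u ∈ Submodule.span ℂ (Set.range e), ∃ a b : Ser2,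
      u + (a * p₀ + b * q₀) = MvPowerSeries.monomial α.1 1 := by
    intro α
    have h1 : (MvPowerSeries.monomial α.1 1 : Ser2) ∈ Submodule.span ℂ (Set.range e) ⊔
      (Ideal.span {p₀, q₀}).restrictScalars ℂ := he ▸ Submodule.mem_top
    obtain ⟨u, hu, v, hv, huv⟩ := Submodule.mem_sup.1 h1
    obtain ⟨a, b, rfl⟩ := Ideal.mem_span_pair.1 hv
    exact ⟨u, hu, a, b, huv⟩
  choose u hu a b huab using hrep
  let r : T → S → Ser2 := fun t α => u α + (a α * p t + b α * q t)
  let R : T → Matrix S S ℂ := fun t => Matrix.of fun α β => MvPowerSeries.coeff β.1 (r t α)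
  have hR : Tendsto R l (𝓝 1) := by
    refine tendsto_pi_nhds.2 fun α => tendsto_pi_nhds.2 fun β => ?_
    have h1 : (1 : Matrix S S ℂ) α β = MvPowerSeries.coeff β.1 (u α + (a α * p₀ + b α * q₀)) := by
      rw [huab, MvPowerSeries.coeff_monomial, Matrix.one_apply]
      exact if_congr (by rw [Subtype.ext_iff, eq_comm]) rfl rfl
    rw [h1]
    simp only [R, r, Matrix.of_apply, map_add, MvPowerSeries.coeff_mul]
    refine tendsto_const_nhds.add (Tendsto.add ?_ ?_)
    · exact tendsto_finsetSum _ fun x _ => tendsto_const_nhds.mul (hp _)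
    · exact tendsto_finsetSum _ fun x _ => tendsto_const_nhds.mul (hq _)
  have hdet : Tendsto (fun t => (R t).det) l (𝓝 1) := by
    have h1 : Continuous fun M : Matrix S S ℂ => M.det := continuous_id.matrix_det
    have h2 := (h1.tendsto 1).comp hR
    rwa [Matrix.det_one] at h2
  filter_upwards [hdet.eventually_ne one_ne_zero] with t ht
  set I := Ideal.span {p t, q t}
  set U := Submodule.span ℂ (Set.range e) ⊔ (I ⊔ maxIdeal ^ (d + 1)).restrictScalars ℂ
  have hMU : ∀ g : Ser2, (∀ n ∈ S, MvPowerSeries.coeff n g = 0) → g ∈ U := by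
    intro g hg
    refine Submodule.mem_sup_right (Ideal.mem_sup_right (mem_maxIdeal_pow_of_le_order ?_))
    exact MvPowerSeries.nat_le_order fun n hn => hg n (mem_lowExponents hn)
  have hrU : ∀ α, r t α ∈ U := fun α => Submodule.add_mem_sup (hu α)
    (Ideal.mem_sup_left (Ideal.mem_span_pair.2 ⟨_, _, rfl⟩))
  have htop : U = ⊤ := by
    refine eq_top_iff.2 fun g _ => ?_
    -- the coefficients of `g` on `S` are matched by a combination of the `r t α`
    set c : S → ℂ := Matrix.vecMul (fun α => MvPowerSeries.coeff α.1 g) (R t)⁻¹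
    have h1 : Matrix.vecMul c (R t) = fun α : S => MvPowerSeries.coeff α.1 g := by
      rw [Matrix.vecMul_vecMul, Matrix.nonsing_inv_mul _ (isUnit_iff_ne_zero.2 ht),
        Matrix.vecMul_one]
    have h2 : g - ∑ α, c α • r t α ∈ U := by
      refine hMU _ fun n hn => ?_
      have h3 := congrFun h1 ⟨n, hn⟩
      simp only [Matrix.vecMul, dotProduct, R, Matrix.of_apply] at h3
      rw [map_sub, map_sum, ← h3, sub_eq_zero]
      exact Finset.sum_congr rfl fun α _ => by rw [map_smul, smul_eq_mul]
    have h4 := U.add_mem h2 (U.sum_mem fun α _ => U.smul_mem (c α) (hrU α) :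
      ∑ α, c α • r t α ∈ U)
    rwa [sub_add_cancel] at h4
  have h5 := colength_le_of_span_sup_eq_top htop
  have h6 := pow_le_of_colength_le maxIdeal_fg maxIdeal_le_jacobson h5
  rwa [sup_eq_left.2 ((Ideal.pow_le_pow_right (Nat.le_succ d)).trans h6)] at h5

/-! ### The local ring of convergent power series -/

theorem summable_pow_degree {x : ℝ} (h0 : 0 ≤ x) (h1 : x < 1) :
    Summable fun n : Fin 2 →₀ ℕ => x ^ n.degree := by
  have h2 := summable_geometric_of_lt_one h0 h1
  have h3 : Summable fun p : ℕ × ℕ => x ^ p.1 * x ^ p.2 :=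
    h2.mul_of_nonneg h2 (fun _ => by positivity) fun _ => by positivity
  let e : (Fin 2 →₀ ℕ) ≃ ℕ × ℕ := ⟨fun n => (n 0, n 1), fun p => biexp p.1 p.2,
    fun n => (eq_biexp n).symm, fun p => by simp⟩
  rw [← e.symm.summable_iff]
  refine h3.congr fun p => ?_
  change _ = x ^ (biexp p.1 p.2).degree
  rw [degree_biexp, pow_add]

/-- If the terms other than the constant one are small on a polydisc, then the coefficients of the
inverse satisfy Cauchy bounds there. -/
theorem norm_coeff_inv_le {f : Ser2} {s : ℝ} (hs : 0 < s)
    (hsum : Summable fun n : Fin 2 →₀ ℕ =>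
      if n = 0 then 0 else ‖MvPowerSeries.coeff n f‖ * s ^ n.degree)
    (hsmall : ∑' n : Fin 2 →₀ ℕ, (if n = 0 then 0 else ‖MvPowerSeries.coeff n f‖ * s ^ n.degree) ≤
      ‖MvPowerSeries.constantCoeff f‖) (n : Fin 2 →₀ ℕ) :
    ‖MvPowerSeries.coeff n f⁻¹‖ * s ^ n.degree ≤ ‖MvPowerSeries.constantCoeff f‖⁻¹ := by
  classical
  set c := MvPowerSeries.constantCoeff f
  set φ : (Fin 2 →₀ ℕ) → ℝ :=
    fun n => if n = 0 then 0 else ‖MvPowerSeries.coeff n f‖ * s ^ n.degree with hφ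
  have hφ0 : ∀ n, 0 ≤ φ n := fun n => by simp only [hφ]; split_ifs <;> positivity
  induction n using WellFoundedLT.induction with
  | ind n ih =>
    rw [MvPowerSeries.coeff_inv]
    split_ifs with hn
    · simp [hn, c]
    have h1 : ∀ x ∈ Finset.HasAntidiagonal.antidiagonal n,
        ‖if x.2 < n then MvPowerSeries.coeff x.1 f * MvPowerSeries.coeff x.2 f⁻¹ else 0‖ *
          s ^ n.degree ≤ φ x.1 * ‖c‖⁻¹ := by
      intro x hx
      rw [Finset.HasAntidiagonal.mem_antidiagonal] at hx
      split_ifs with hlt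
      · have hx1 : x.1 ≠ 0 := by
          rintro h0
          rw [h0, zero_add] at hx
          exact hlt.ne hx
        simp only [hφ, if_neg hx1]
        rw [norm_mul, ← hx, map_add, pow_add]
        calc _ = ‖MvPowerSeries.coeff x.1 f‖ * s ^ x.1.degree *
              (‖MvPowerSeries.coeff x.2 f⁻¹‖ * s ^ x.2.degree) := by ring
          _ ≤ _ := mul_le_mul_of_nonneg_left (ih _ hlt) (by positivity)
      · rw [norm_zero, zero_mul]
        exact mul_nonneg (hφ0 _) (by positivity)
    have h2 : ∑ x ∈ Finset.HasAntidiagonal.antidiagonal n, φ x.1 ≤ ‖c‖ := by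
      refine le_trans ?_ hsmall
      rw [← Finset.sum_image (f := φ) (g := fun x : (Fin 2 →₀ ℕ) × (Fin 2 →₀ ℕ) => x.1)]
      · exact hsum.sum_le_tsum _ fun i _ => hφ0 i
      · intro x hx y hy hxy
        have hx := Finset.HasAntidiagonal.mem_antidiagonal.1 hx
        have hy := Finset.HasAntidiagonal.mem_antidiagonal.1 hy
        refine Prod.ext hxy ?_
        rw [← hy, ← show x.1 = y.1 from hxy] at hx
        exact add_left_cancel hx
    rw [norm_mul, norm_neg, norm_inv, mul_assoc]
    refine mul_le_of_le_one_right (by positivity) ?_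
    refine (mul_le_mul_of_nonneg_right (norm_sum_le _ _) (by positivity)).trans ?_
    rw [Finset.sum_mul]
    refine (Finset.sum_le_sum h1).trans ?_
    rw [← Finset.sum_mul]
    exact (mul_le_mul_of_nonneg_right h2 (by positivity)).trans mul_inv_le_one

theorem IsConvergent.inv {f : Ser2} (hf : IsConvergent f)
    (h0 : MvPowerSeries.constantCoeff f ≠ 0) : IsConvergent f⁻¹ := by
  obtain ⟨r, hr, hsum⟩ := hf
  set S := ∑' n : Fin 2 →₀ ℕ, ‖MvPowerSeries.coeff n f‖ * r ^ n.degree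
  have hS : 0 ≤ S := tsum_nonneg fun n => by positivity
  have hc : 0 < ‖MvPowerSeries.constantCoeff f‖ := norm_pos_iff.2 h0
  set c := ‖MvPowerSeries.constantCoeff f‖
  -- on the polydisc of radius `s = ε * r` the nonconstant terms sum up to at most `c`
  obtain ⟨ε, hε, hε1, hεS⟩ : ∃ ε : ℝ, 0 < ε ∧ ε ≤ 1 ∧ ε * S ≤ c := by
    refine ⟨min 1 (c / (S + 1)), by positivity, min_le_left _ _, ?_⟩
    calc _ ≤ c / (S + 1) * S := mul_le_mul_of_nonneg_right (min_le_right _ _) hS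
      _ ≤ c / (S + 1) * (S + 1) := by gcongr; linarith
      _ = c := by field_simp
  have hle : ∀ n : Fin 2 →₀ ℕ,
      (if n = 0 then 0 else ‖MvPowerSeries.coeff n f‖ * (ε * r) ^ n.degree) ≤
        ε * (‖MvPowerSeries.coeff n f‖ * r ^ n.degree) := by
    intro n
    split_ifs with hn
    · positivity
    · have h1 : ε ^ n.degree ≤ ε := by
        refine pow_le_of_le_one hε.le hε1 ?_
        rwa [Ne, Finsupp.degree_eq_zero_iff]
      rw [mul_pow]
      calc _ = ε ^ n.degree * (‖MvPowerSeries.coeff n f‖ * r ^ n.degree) := by ring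
        _ ≤ _ := mul_le_mul_of_nonneg_right h1 (by positivity)
  have hsum' := (hsum.mul_left ε).of_nonneg_of_le
    (fun n => by split_ifs <;> positivity) hle
  have hbd := norm_coeff_inv_le (f := f) (s := ε * r) (by positivity) hsum'
    ((hsum'.tsum_le_tsum hle (hsum.mul_left ε)).trans (by rw [tsum_mul_left]; exact hεS))
  refine ⟨ε * r / 2, by positivity, ((summable_pow_degree (x := 1 / 2) (by norm_num)
    (by norm_num)).mul_left c⁻¹).of_nonneg_of_le (fun n => by positivity) fun n => ?_⟩
  calc _ = ‖MvPowerSeries.coeff n f⁻¹‖ * (ε * r) ^ n.degree * (1 / 2) ^ n.degree := by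
        rw [div_eq_mul_one_div (ε * r), mul_pow (ε * r)]; ring
    _ ≤ _ := mul_le_mul_of_nonneg_right (hbd n) (by positivity)

theorem isConvergent_of_finite {σ : Type} {f : MvPowerSeries σ ℂ} (S : Finset (σ →₀ ℕ))
    (h : ∀ n ∉ S, MvPowerSeries.coeff n f = 0) : IsConvergent f :=
  ⟨1, one_pos, summable_of_ne_finset_zero (s := S) fun n hn => by simp [h n hn]⟩

theorem isUnit_convSeries {f : ConvSeries} (h0 : MvPowerSeries.constantCoeff f.1 ≠ 0) :
    IsUnit f := by
  refine IsUnit.of_mul_eq_one ⟨f.1⁻¹, IsConvergent.inv f.2 h0⟩ (Subtype.ext ?_)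
  exact MvPowerSeries.mul_inv_cancel _ h0

theorem constantCoeff_ne_zero_of_isUnit {f : ConvSeries} (h : IsUnit f) :
    MvPowerSeries.constantCoeff f.1 ≠ 0 :=
  ((MvPowerSeries.isUnit_iff_constantCoeff).1 (h.map ConvSeries.val)).ne_zero

theorem isConvergent_X (i : Fin 2) : IsConvergent (MvPowerSeries.X i : Ser2) := by
  classical
  refine isConvergent_of_finite {Finsupp.single i 1} fun n hn => ?_
  rw [MvPowerSeries.coeff_X, if_neg (by simpa using hn)]

/-- The coordinates as convergent power series. -/
def convX (i : Fin 2) : ConvSeries := ⟨MvPowerSeries.X i, isConvergent_X i⟩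

/-- The maximal ideal `(x, y)` of `ℂ{x, y}`. -/
def convMaxIdeal : Ideal ConvSeries := Ideal.span {convX 0, convX 1}

theorem convMaxIdeal_fg : convMaxIdeal.FG := by
  classical
  exact ⟨{convX 0, convX 1}, by simp [convMaxIdeal]⟩

theorem convMaxIdeal_le_jacobson : convMaxIdeal ≤ Ideal.jacobson ⊥ := by
  intro f hf
  rw [Ideal.mem_jacobson_bot]
  intro g
  obtain ⟨a, b, rfl⟩ := Ideal.mem_span_pair.1 hf
  apply isUnit_convSeries
  change MvPowerSeries.constantCoeff
    ((a.1 * MvPowerSeries.X 0 + b.1 * MvPowerSeries.X 1) * g.1 + 1) ≠ 0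
  simp

theorem IsConvergent.of_shift {f g : Ser2} (hf : IsConvergent f) (i : Fin 2)
    (h : ∀ n, ‖MvPowerSeries.coeff n g‖ ≤ ‖MvPowerSeries.coeff (n + Finsupp.single i 1) f‖) :
    IsConvergent g := by
  obtain ⟨r, hr, hf⟩ := hf
  have hinj : Function.Injective fun n : Fin 2 →₀ ℕ => n + Finsupp.single i 1 :=
    fun a b h => add_right_cancel h
  refine ⟨r, hr, ((hf.comp_injective hinj).mul_left r⁻¹).of_nonneg_of_le
    (fun n => by positivity) fun n => ?_⟩
  simp only [Function.comp_apply, map_add, Finsupp.degree_single, pow_add, pow_one]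
  calc _ ≤ ‖MvPowerSeries.coeff (n + Finsupp.single i 1) f‖ * r ^ n.degree := by
        gcongr; exact h n
    _ = _ := by field_simp

theorem IsConvergent.shiftX {f : Ser2} (hf : IsConvergent f) : IsConvergent (shiftX f) := by
  refine hf.of_shift 0 fun n => le_of_eq ?_
  have h1 : n + Finsupp.single 0 1 = biexp (n 0 + 1) (n 1) := by
    ext j; fin_cases j <;> simp
  rw [h1]
  conv_lhs => rw [eq_biexp n]
  rw [PlaneCurve.shiftX, coeff_ofCoeff]

theorem IsConvergent.shiftY {f : Ser2} (hf : IsConvergent f) : IsConvergent (shiftY f) := by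
  refine hf.of_shift 1 fun n => ?_
  have h1 : n + Finsupp.single 1 1 = biexp (n 0) (n 1 + 1) := by
    ext j; fin_cases j <;> simp
  rw [h1]
  conv_lhs => rw [eq_biexp n]
  rw [PlaneCurve.shiftY, coeff_ofCoeff]
  split_ifs with h
  · rw [h]
  · simp

theorem mem_convMaxIdeal_pow_of_le_order {K : ℕ} {g : ConvSeries} (h : (K : ℕ∞) ≤ g.1.order) :
    g ∈ convMaxIdeal ^ K := by
  induction K generalizing g with
  | zero => simp
  | succ K ih =>
    have h1 : g = convX 0 * ⟨shiftX g.1, g.2.shiftX⟩ + convX 1 * ⟨shiftY g.1, g.2.shiftY⟩ :=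
      Subtype.ext (eq_shift_of_le_order h)
    rw [h1, pow_succ']
    exact Ideal.add_mem _
      (Ideal.mul_mem_mul (Ideal.subset_span (by simp)) (ih (g := ⟨_, _⟩) (le_order_shiftX h)))
      (Ideal.mul_mem_mul (Ideal.subset_span (by simp)) (ih (g := ⟨_, _⟩) (le_order_shiftY h)))

theorem le_order_of_mem_maxIdeal_pow {K : ℕ} {g : Ser2} (h : g ∈ maxIdeal ^ K) :
    (K : ℕ∞) ≤ g.order := by
  induction K generalizing g with
  | zero => simp
  | succ K ih =>
    rw [pow_succ', maxIdeal] at h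
    refine Submodule.mul_induction_on h (fun a ha b hb => ?_) fun a b ha hb =>
      (le_min ha hb).trans MvPowerSeries.min_order_le_add
    refine le_trans ?_ MvPowerSeries.le_order_mul
    rw [Nat.cast_add, add_comm]
    refine add_le_add (MvPowerSeries.one_le_order_iff_constCoeff_eq_zero.2 ?_) (ih hb)
    obtain ⟨c, d, rfl⟩ := Ideal.mem_span_pair.1 ha
    simp

theorem le_order_val_of_mem {K : ℕ} {g : ConvSeries} (h : g ∈ convMaxIdeal ^ K) :
    (K : ℕ∞) ≤ g.1.order := by
  refine le_order_of_mem_maxIdeal_pow ?_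
  have h1 := Ideal.mem_map_of_mem (ConvSeries.val : ConvSeries →+* Ser2) h
  rw [Ideal.map_pow, convMaxIdeal, Ideal.map_span, Set.image_pair] at h1
  exact h1

/-- The part of a series on `lowExponents K`. -/
def lowPart (K : ℕ) (g : Ser2) : Ser2 :=
  fun n => if n ∈ lowExponents K then MvPowerSeries.coeff n g else 0

theorem coeff_lowPart (K : ℕ) (g : Ser2) (n : Fin 2 →₀ ℕ) :
    MvPowerSeries.coeff n (lowPart K g) =
      if n ∈ lowExponents K then MvPowerSeries.coeff n g else 0 := rfl

theorem isConvergent_lowPart (K : ℕ) (g : Ser2) : IsConvergent (lowPart K g) := by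
  classical
  exact isConvergent_of_finite (lowExponents K) fun n hn => by rw [coeff_lowPart, if_neg hn]

theorem le_order_sub_lowPart (K : ℕ) (g : Ser2) : (K : ℕ∞) ≤ (g - lowPart K g).order := by
  classical
  refine MvPowerSeries.nat_le_order fun n hn => ?_
  rw [map_sub, coeff_lowPart, if_pos (mem_lowExponents hn), sub_self]

/-- Truncation shows that a convergent combination of convergent series with formal coefficients
is a combination with convergent coefficients up to high order. -/
theorem exists_sub_mem_convMaxIdeal_pow {p q f : ConvSeries}
    (h : f.1 ∈ Ideal.span {p.1, q.1}) (K : ℕ) :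
    ∃ g ∈ Ideal.span {p, q}, f - g ∈ convMaxIdeal ^ K := by
  obtain ⟨a, b, hab⟩ := Ideal.mem_span_pair.1 h
  refine ⟨⟨lowPart K a, isConvergent_lowPart K a⟩ * p + ⟨lowPart K b, isConvergent_lowPart K b⟩ * q,
    Ideal.mem_span_pair.2 ⟨_, _, rfl⟩, mem_convMaxIdeal_pow_of_le_order ?_⟩
  have h1 : (f - (⟨lowPart K a, isConvergent_lowPart K a⟩ * p +
      ⟨lowPart K b, isConvergent_lowPart K b⟩ * q)).1 =
      (a - lowPart K a) * p.1 + (b - lowPart K b) * q.1 := by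
    change f.1 - (lowPart K a * p.1 + lowPart K b * q.1) = _
    rw [← hab]; ring
  rw [h1]
  refine (le_min ?_ ?_).trans MvPowerSeries.min_order_le_add
  · exact (le_order_sub_lowPart K a).trans (le_self_add.trans MvPowerSeries.le_order_mul)
  · exact (le_order_sub_lowPart K b).trans (le_self_add.trans MvPowerSeries.le_order_mul)

/-- Finite colengths agree in `ℂ{x, y}` and in `ℂ⟦x, y⟧`. -/
theorem colength_conv {p q : ConvSeries} {d : ℕ}
    (hd : colength (Ideal.span {p.1, q.1}) = d) :
    colength (Ideal.span {p, q}) = d := by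
  set I := Ideal.span {p, q}
  set J : Ideal Ser2 := Ideal.span {p.1, q.1}
  have hJ : maxIdeal ^ d ≤ J := pow_le_of_colength_le maxIdeal_fg maxIdeal_le_jacobson
    ((colength_le_of_le le_sup_left).trans hd.le)
  have hI : convMaxIdeal ^ d ≤ I := by
    refine Submodule.le_of_le_smul_of_le_jacobson_bot (convMaxIdeal_fg.pow (n := d))
      convMaxIdeal_le_jacobson fun f hf => ?_
    rw [smul_eq_mul, ← pow_succ']
    obtain ⟨g, hg, hfg⟩ := exists_sub_mem_convMaxIdeal_pow
      (hJ (mem_maxIdeal_pow_of_le_order (le_order_val_of_mem hf))) (d + 1)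
    exact Submodule.mem_sup.2 ⟨g, hg, f - g, hfg, by ring⟩
  let φ : ConvSeries →ₐ[ℂ] Ser2 ⧸ J := (Ideal.Quotient.mkₐ ℂ J).comp ConvSeries.val
  have hφ : Function.Surjective φ := by
    intro x
    obtain ⟨g, rfl⟩ := Ideal.Quotient.mk_surjective x
    refine ⟨⟨lowPart d g, isConvergent_lowPart d g⟩, ?_⟩
    refine Ideal.Quotient.eq.2 ?_
    rw [← neg_sub]
    exact J.neg_mem (hJ (mem_maxIdeal_pow_of_le_order (le_order_sub_lowPart d g)))
  have hker : RingHom.ker φ = I := by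
    refine le_antisymm (fun f hf => ?_) ?_
    · have h1 : f.1 ∈ J := Ideal.Quotient.eq_zero_iff_mem.1 hf
      obtain ⟨g, hg, hfg⟩ := exists_sub_mem_convMaxIdeal_pow h1 d
      have := I.add_mem hg (hI hfg)
      rwa [add_sub_cancel] at this
    · rw [Ideal.span_le]
      rintro f (rfl | rfl)
      · exact Ideal.Quotient.eq_zero_iff_mem.2 (Ideal.subset_span (by simp))
      · exact Ideal.Quotient.eq_zero_iff_mem.2 (Ideal.subset_span (by simp))
  rw [← hd, ← hker]
  exact (Ideal.quotientKerAlgEquivOfSurjective hφ).toLinearEquiv.length_eq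

theorem milnorNumber_eq_colength {h : ConvSeries} {d : ℕ} (hd : colength (jacobianIdeal h.1) = d) :
    milnorNumber h = d := by
  rw [milnorNumber, ← Module.length_eq_rank]
  exact colength_conv (p := partialDeriv 0 h) (q := partialDeriv 1 h) hd

theorem milnorNumber_eq_gcdSum {m : ℕ} (hm : 2 ≤ m) {h : ConvSeries} {L : GL (Fin 2) ℂ}
    {y : PowerSeries ℂ} (hp : IsPuiseuxParametrization h m L y) {N : ℕ}
    (hN : gcdBelow m y N = 1) : milnorNumber h = gcdSum m y N :=
  milnorNumber_eq_colength
    (colength_jacobianIdeal hm L hp.exponents hN hp.multiplicity hp.vanishes)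

/-! ### Minimal Milnor numbers -/

/-- The series is a polynomial. -/
def HasBoundedSupport (f : Ser2) : Prop :=
  ∃ D, ∀ i j, MvPowerSeries.coeff (biexp i j) f ≠ 0 → i + j ≤ D

theorem HasBoundedSupport.mul {f g : Ser2} (hf : HasBoundedSupport f) (hg : HasBoundedSupport g) :
    HasBoundedSupport (f * g) := by
  classical
  obtain ⟨D, hD⟩ := hf
  obtain ⟨E, hE⟩ := hg
  refine ⟨D + E, fun i j h => ?_⟩
  rw [MvPowerSeries.coeff_mul] at h
  obtain ⟨x, hx, hx0⟩ := Finset.exists_ne_zero_of_sum_ne_zero h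
  rw [Finset.HasAntidiagonal.mem_antidiagonal] at hx
  have h1 := left_ne_zero_of_mul hx0
  have h2 := right_ne_zero_of_mul hx0
  rw [eq_biexp x.1] at h1
  rw [eq_biexp x.2] at h2
  have h3 := hD _ _ h1
  have h4 := hE _ _ h2
  have h5 := DFunLike.congr_fun hx 0
  have h6 := DFunLike.congr_fun hx 1
  simp only [Finsupp.add_apply, biexp_zero, biexp_one] at h5 h6
  omega

theorem HasBoundedSupport.isConvergent {f : Ser2} (hf : HasBoundedSupport f) :
    IsConvergent f := by
  obtain ⟨D, hD⟩ := hf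
  refine isConvergent_of_finite (lowExponents (D + 1)) fun n hn => ?_
  by_contra h
  rw [eq_biexp n] at h
  have h1 := hD _ _ h
  refine hn (mem_lowExponents ?_)
  rw [eq_biexp n, degree_biexp]
  omega

/-- The equation of a branch with polynomial parametrization is a polynomial. -/
theorem hasBoundedSupport_branchEq {m : ℕ} (hm : m ≠ 0) {y : PowerSeries ℂ} {N : ℕ}
    (hN : ∀ n, N ≤ n → PowerSeries.coeff n y = 0) : HasBoundedSupport (branchEq m y) := by
  have h1 : ∀ j, HasBoundedSupport (MvPowerSeries.X 1 - ser1 0 (conjugate m y j)) := by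
    refine fun j => ⟨N + 1, fun i k h => ?_⟩
    by_contra! hlt
    apply h
    have h2 : MvPowerSeries.coeff (biexp i k) (MvPowerSeries.X 1 : Ser2) = 0 := by
      classical
      rw [MvPowerSeries.coeff_X, if_neg fun h0 => ?_]
      have h3 := congrArg Finsupp.degree h0
      rw [degree_biexp, Finsupp.degree_single] at h3
      omega
    rw [map_sub, coeff_ser1_zero, h2]
    split_ifs with h3
    · rw [coeff_conjugate, hN i (by omega), mul_zero, sub_zero]
    · rw [sub_zero]
  have h2 : ∀ s : Finset ℕ,
      HasBoundedSupport (∏ j ∈ s, (MvPowerSeries.X 1 - ser1 0 (conjugate m y j))) := by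
    intro s
    induction s using Finset.cons_induction with
    | empty =>
      refine ⟨0, fun i j h => ?_⟩
      by_contra! hlt
      apply h
      rw [Finset.prod_empty, ← map_one MvPowerSeries.C, coeff_C_biexp, if_neg (by omega)]
    | cons a s ha ih => rw [Finset.prod_cons]; exact (h1 a).mul ih
  obtain ⟨D, hD⟩ := h2 (Finset.range m)
  refine ⟨D, fun i j h => ?_⟩
  have h3 := coeff_pullback m (branchEq m y) (m * i) j
  rw [pullback_branchEq hm, if_pos (dvd_mul_right _ _),
    Nat.mul_div_cancel_left _ (Nat.pos_of_ne_zero hm)] at h3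
  have h4 := hD (m * i) j (by rw [← conjProd, h3]; exact h)
  have h5 : i ≤ m * i := Nat.le_mul_of_pos_left _ (Nat.pos_of_ne_zero hm)
  omega

theorem order_branchEq {m : ℕ} {y : PowerSeries ℂ} (hy : ∀ n ≤ m, PowerSeries.coeff n y = 0) :
    (branchEq m y).order = m := by
  refine le_antisymm ?_ (le_order_branchEq fun n hn => hy n hn.le)
  have h1 : MvPowerSeries.coeff (biexp 0 m) (branchEq m y) ≠ 0 := by
    rw [coeff_branchEq (cc_of_exponents hy)]; exact one_ne_zero
  refine (MvPowerSeries.order_le h1).trans ?_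
  rw [degree_biexp, zero_add]

/-- A convergent series of order `m` that vanishes on a primitive parametrization of
multiplicity `m` is irreducible: one of two factors vanishes on the curve, hence it has order at
least `m`, and the other one is a unit. -/
theorem irreducible_of_curveEval_eq_zero {m : ℕ} (hm : m ≠ 0) {y : PowerSeries ℂ}
    (hy : ∀ n ≤ m, PowerSeries.coeff n y = 0) (hprim : ∃ n, gcdBelow m y n = 1) {h : ConvSeries}
    (hord : h.1.order = m) (hh : curveEval (PowerSeries.X ^ m) y h.1 = 0) : Irreducible h := by
  have hcc := cc_of_exponents hy
  have key : ∀ a b : ConvSeries, h = a * b → curveEval (PowerSeries.X ^ m) y a.1 = 0 →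
      IsUnit b := by
    intro a b hab ha
    obtain ⟨q, hq⟩ := branchEq_dvd hm hcc hprim ha
    have h1 : (m : ℕ∞) ≤ a.1.order := by
      rw [hq, ← order_branchEq hy]
      exact le_self_add.trans MvPowerSeries.le_order_mul
    refine isUnit_convSeries fun hb => ?_
    have h2 : (1 : ℕ∞) ≤ b.1.order := MvPowerSeries.one_le_order_iff_constCoeff_eq_zero.2 hb
    have h3 : ((m + 1 : ℕ) : ℕ∞) ≤ m := by
      rw [Nat.cast_add, Nat.cast_one, ← hord, hab]
      conv_lhs => rw [← hab, hord]
      exact (add_le_add h1 h2).trans MvPowerSeries.le_order_mul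
    have h4 : m + 1 ≤ m := by exact_mod_cast h3
    omega
  refine ⟨fun hu => ?_, fun a b hab => ?_⟩
  · have h1 := constantCoeff_ne_zero_of_isUnit hu
    apply h1
    rw [← MvPowerSeries.one_le_order_iff_constCoeff_eq_zero, hord]
    exact_mod_cast Nat.one_le_iff_ne_zero.2 hm
  · have h1 : curveEval (PowerSeries.X ^ m) y a.1 * curveEval (PowerSeries.X ^ m) y b.1 = 0 := by
      rw [← curveEval_mul (constantCoeff_X_pow_ser1 hm) hcc, ← hh, hab]; rfl
    rcases mul_eq_zero.1 h1 with h2 | h2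
    · exact Or.inr (key a b hab h2)
    · exact Or.inl (key b a (hab.trans (mul_comm a b)) h2)

theorem puiseuxCurve_one (m : ℕ) (y : PowerSeries ℂ) :
    puiseuxCurve m 1 y = ![PowerSeries.X ^ m, y] := by
  funext i
  fin_cases i <;> simp [puiseuxCurve]

theorem exists_branch_of_chain {m g : ℕ} (hm : 2 ≤ m) {f : ℕ → ℕ} (hf : IsDivisorChain m g f) :
    ∃ h ∈ Branches m (g + 1), milnorNumber h = ((m - 1) ^ 2 + chainWeight f g : ℕ) := by
  obtain ⟨y, N, hy, hfin, hN, hcard, hsum⟩ := exists_series_of_chain hf hm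
  have hm0 : m ≠ 0 := by omega
  have hcc := cc_of_exponents hy
  let h : ConvSeries := ⟨branchEq m y, (hasBoundedSupport_branchEq hm0 hfin).isConvergent⟩
  have hev : curveEval (PowerSeries.X ^ m) y h.1 = 0 := curveEval_branchEq hm0 hcc
  have hp : IsPuiseuxParametrization h m 1 y := by
    refine ⟨order_branchEq hy, ?_, hy, ⟨N, hN⟩, ?_⟩
    · refine isConvergent_of_finite ((Finset.range N).image fun n => Finsupp.single () n)
        fun n hn => ?_
      have h1 : n = Finsupp.single () (n ()) := by ext; simp
      rw [h1]
      refine hfin (n ()) ?_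
      by_contra! hlt
      exact hn (Finset.mem_image.2 ⟨n (), Finset.mem_range.2 hlt, h1.symm⟩)
    · rw [puiseuxCurve_one]; exact hev
  refine ⟨h, ⟨irreducible_of_curveEval_eq_zero hm0 hy ⟨N, hN⟩ (order_branchEq hy) hev,
    order_branchEq hy, m, 1, y, hp, hcard⟩, ?_⟩
  rw [milnorNumber_eq_gcdSum hm hp hN, hsum]

theorem HasMultiplicity.unique {h : ConvSeries} {m m' : ℕ} (h1 : HasMultiplicity h m)
    (h2 : HasMultiplicity h m') : m = m' := by
  rw [HasMultiplicity] at h1 h2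
  rw [h1] at h2
  exact_mod_cast h2

theorem exists_chain_of_mem_branches {m k : ℕ} (hm : 2 ≤ m) {h : ConvSeries}
    (hh : h ∈ Branches m k) : ∃ g f, k = g + 1 ∧ IsDivisorChain m g f ∧
      (((m - 1) ^ 2 + chainWeight f g : ℕ) : ℕ∞) ≤ milnorNumber h := by
  obtain ⟨-, hmul, m', L, y, hp, hcard⟩ := hh
  obtain rfl := hp.multiplicity.unique hmul
  obtain ⟨N, hN⟩ := hp.primitive
  have h1 := ncard_charExponents hp.exponents hN
  rw [hcard] at h1
  obtain ⟨f, hf, hle⟩ := exists_chain_le_gcdSum hm hp.exponents hN (hcard.trans h1)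
  refine ⟨_, f, h1, hf, ?_⟩
  rw [milnorNumber_eq_gcdSum hm hp hN]
  exact_mod_cast hle

theorem IsMuMinimal.exists_chain {m k : ℕ} (hm : 2 ≤ m) {h : ConvSeries}
    (hh : IsMuMinimal m k h) : ∃ g f, k = g + 1 ∧ IsDivisorChain m g f ∧
      milnorNumber h = ((m - 1) ^ 2 + chainWeight f g : ℕ) := by
  obtain ⟨g, f, rfl, hf, hle⟩ := exists_chain_of_mem_branches hm hh.1
  obtain ⟨h', hh', he⟩ := exists_branch_of_chain hm hf
  exact ⟨g, f, rfl, hf, le_antisymm ((hh.2 h' hh').trans he.le) hle⟩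

theorem IsMuMinimal.milnorNumber_eq {m k : ℕ} (hm : 2 ≤ m) (hk : 4 ≤ k) {h : ConvSeries}
    (hh : IsMuMinimal m k h) : milnorNumber h = ((m * (m - 2 + nestedDivisor m k 1) +
      ∑ j ∈ Finset.Icc 1 (k - 3),
        nestedDivisor m k j * (nestedDivisor m k (j + 1) - 1) : ℕ) : ℕ∞) := by
  obtain ⟨g, f, rfl, hf, he⟩ := hh.exists_chain hm
  rw [← nestedChain_formula hk (by simpa using hf.nestedChain), Nat.add_sub_cancel]
  refine le_antisymm ?_ ?_
  · obtain ⟨h', hh', he'⟩ := exists_branch_of_chain hm hf.nestedChain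
    exact (hh.2 h' hh').trans he'.le
  · rw [he]
    exact_mod_cast Nat.add_le_add_left hf.chainWeight_nestedChain_le _

theorem IsMuMinimal.milnorNumber_lt {m k k' : ℕ} (hm : 2 ≤ m) {X Y : ConvSeries}
    (hX : IsMuMinimal m k X) (hk : k < k') (hY : Y ∈ Branches m k') :
    milnorNumber X < milnorNumber Y := by
  obtain ⟨g, f, rfl, hf, -⟩ := hX.exists_chain hm
  obtain ⟨g', f', rfl, hf', hle⟩ := exists_chain_of_mem_branches hm hY
  have hg : 1 ≤ g := by
    by_contra! h
    obtain rfl : g = 0 := by omega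
    have := hf.last
    rw [hf.zero] at this
    omega
  obtain ⟨f'', hf'', hlt⟩ := hf'.exists_shorter hg (by omega)
  obtain ⟨h, hh, he⟩ := exists_branch_of_chain hm hf''
  refine lt_of_le_of_lt ((hX.2 h hh).trans he.le) (lt_of_lt_of_le ?_ hle)
  exact_mod_cast Nat.add_lt_add_left hlt _

/-! ### Reparametrization of curves -/

section Reparam

variable {ψ : PowerSeries ℂ} (hψ : MvPowerSeries.constantCoeff (σ := Unit) ψ = 0)

/-- The substitution `g(x, y) ↦ g(ψ(x), ψ(y))`. -/
def doubleSubst : Ser2 →ₐ[ℂ] Ser2 :=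
  substPair (constantCoeff_ser1 (i := 0) hψ) (constantCoeff_ser1 (i := 1) hψ)

include hψ in
theorem ser1_subst (i : Fin 2) (a : PowerSeries ℂ) :
    ser1 i (PowerSeries.subst ψ a) = PowerSeries.subst (ser1 i ψ) a := by
  have hs : PowerSeries.HasSubst ψ := PowerSeries.HasSubst.of_constantCoeff_zero hψ
  have hX : PowerSeries.HasSubst (MvPowerSeries.X i : Ser2) :=
    PowerSeries.HasSubst.of_constantCoeff_zero (by simp)
  rw [ser1, ser1, PowerSeries.toMvPowerSeries_eq_subst, PowerSeries.toMvPowerSeries_eq_subst,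
    PowerSeries.subst_comp_subst_apply hs hX]

theorem doubleSubst_ser1 (i : Fin 2) (a : PowerSeries ℂ) :
    doubleSubst hψ (ser1 i a) = ser1 i (PowerSeries.subst ψ a) := by
  rw [ser1_subst hψ, doubleSubst]
  obtain rfl | rfl : i = 0 ∨ i = 1 := by omega
  · exact substPair_ser1_zero _ _ a
  · exact substPair_ser1_one _ _ a

theorem doubleSubst_X (i : Fin 2) : doubleSubst hψ (MvPowerSeries.X i) = ser1 i ψ := by
  obtain rfl | rfl : i = 0 ∨ i = 1 := by omega
  · exact substPair_X_zero _ _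
  · exact substPair_X_one _ _

/-- The chain rule for difference quotients. -/
theorem diffQuot_subst (a : PowerSeries ℂ) :
    diffQuot (PowerSeries.subst ψ a) = diffQuot ψ * doubleSubst hψ (diffQuot a) := by
  apply mul_left_cancel₀ X_sub_X_ne_zero
  rw [sub_mul_diffQuot, ← mul_assoc, sub_mul_diffQuot, ← doubleSubst_X hψ, ← doubleSubst_X hψ,
    ← map_sub, ← map_mul, sub_mul_diffQuot, map_sub, doubleSubst_ser1, doubleSubst_ser1]

theorem doubleSubst_doubleSubst {χ : PowerSeries ℂ}
    (hχ : MvPowerSeries.constantCoeff (σ := Unit) χ = 0)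
    (h : PowerSeries.subst χ ψ = PowerSeries.X) (g : Ser2) :
    doubleSubst hχ (doubleSubst hψ g) = g := by
  have h1 : ∀ i, doubleSubst hχ (ser1 i ψ) = MvPowerSeries.X i := fun i => by
    rw [doubleSubst_ser1, h, ser1_X]
  refine (substAlgHom_substPair _ _ (hasSubst_pair (constantCoeff_ser1 (i := 0) hχ)
    (constantCoeff_ser1 (i := 1) hχ)) (by simp) (by simp) (h1 0) (h1 1) g).trans ?_
  rw [substPair, MvPowerSeries.coe_substAlgHom]
  have h2 : (![MvPowerSeries.X 0, MvPowerSeries.X 1] : Fin 2 → Ser2) = MvPowerSeries.X := by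
    funext i; fin_cases i <;> rfl
  rw [h2, MvPowerSeries.subst_self]; rfl

include hψ in
/-- The colength of the double point ideal does not depend on the parametrization. -/
theorem colength_doubleIdeal_subst (h1 : PowerSeries.coeff 1 ψ ≠ 0) (φ : Fin 2 → PowerSeries ℂ) :
    colength (doubleIdeal fun i => PowerSeries.subst ψ (φ i)) = colength (doubleIdeal φ) := by
  have hu : IsUnit (PowerSeries.coeff 1 ψ) := IsUnit.mk0 _ h1
  set χ := ψ.substInvOfIsUnit hu with hχdef
  have hχ : MvPowerSeries.constantCoeff (σ := Unit) χ = 0 := by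
    let := hu.invertible
    apply cc_mv
    rw [hχdef, PowerSeries.substInvOfIsUnit_eq_substInv]
    exact PowerSeries.constantCoeff_substInv ψ
  let e : Ser2 ≃ₐ[ℂ] Ser2 := AlgEquiv.ofAlgHom (doubleSubst hψ) (doubleSubst hχ)
    (AlgHom.ext fun g => doubleSubst_doubleSubst hχ hψ
      (PowerSeries.subst_substInvOfIsUnit_left ψ hψ hu) g)
    (AlgHom.ext fun g => doubleSubst_doubleSubst hψ hχ
      (PowerSeries.subst_substInvOfIsUnit_right ψ hψ hu) g)
  rw [← colength_map_equiv e (doubleIdeal φ), doubleIdeal, doubleIdeal, Ideal.map_span,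
    Set.image_pair, diffQuot_subst hψ, diffQuot_subst hψ]
  have hunit : IsUnit (diffQuot ψ) := by
    rw [MvPowerSeries.isUnit_iff_constantCoeff, ← MvPowerSeries.coeff_zero_eq_constantCoeff_apply]
    have h0 : (0 : Fin 2 →₀ ℕ) = biexp 0 0 := by simp [biexp]
    rw [h0, diffQuot, coeff_ofCoeff]
    exact hu
  obtain ⟨u, hu⟩ := hunit
  congr 1
  rw [← hu]
  refine le_antisymm ?_ ?_
  · rw [Ideal.span_le]
    rintro x (rfl | rfl)
    · exact Ideal.mul_mem_left _ _ (Ideal.subset_span (by left; rfl))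
    · exact Ideal.mul_mem_left _ _ (Ideal.subset_span (by right; rfl))
  · rw [Ideal.span_le]
    rintro x (rfl | rfl)
    · refine (Ideal.unit_mul_mem_iff_mem _ u.isUnit).1 (Ideal.subset_span (by left; rfl))
    · refine (Ideal.unit_mul_mem_iff_mem _ u.isUnit).1 (Ideal.subset_span (by right; rfl))

end Reparam

/-! ### Curves on which the equation of a branch vanishes -/

theorem subst_injective {α : PowerSeries ℂ} (hα : MvPowerSeries.constantCoeff (σ := Unit) α = 0)
    (hα0 : α ≠ 0) {f : PowerSeries ℂ} (h : PowerSeries.subst α f = 0) : f = 0 := by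
  by_contra hf
  have hs : PowerSeries.HasSubst α := PowerSeries.HasSubst.of_constantCoeff_zero hα
  -- `f` is a unit times a power of `X`
  obtain ⟨g, hg⟩ := PowerSeries.X_pow_order_dvd (φ := f)
  have hg0 : PowerSeries.constantCoeff g ≠ 0 := by
    intro h0
    have h1 : PowerSeries.X ^ (f.order.toNat + 1) ∣ f := by
      obtain ⟨g', rfl⟩ := PowerSeries.X_dvd_iff.2 h0
      exact ⟨g', by rw [pow_succ, mul_assoc]; exact hg⟩
    exact (PowerSeries.order_eq_nat.1 (PowerSeries.coe_toNat_order hf).symm).1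
      (PowerSeries.X_pow_dvd_iff.1 h1 _ (Nat.lt_succ_self _))
  have hu : IsUnit (PowerSeries.subst α g) := by
    have h1 : IsUnit g := PowerSeries.isUnit_iff_constantCoeff.2 (IsUnit.mk0 _ hg0)
    have := h1.map (PowerSeries.substAlgHom hs)
    rwa [PowerSeries.coe_substAlgHom] at this
  rw [hg, ← PowerSeries.coe_substAlgHom hs, map_mul, map_pow, PowerSeries.coe_substAlgHom,
    PowerSeries.subst_X hs] at h
  rcases mul_eq_zero.1 h with h | h
  · exact pow_ne_zero _ hα0 h
  · rw [h] at hu; exact not_isUnit_zero hu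

theorem curveEval_prod_branch {a b : PowerSeries ℂ}
    (ha : MvPowerSeries.constantCoeff (σ := Unit) a = 0)
    (hb : MvPowerSeries.constantCoeff (σ := Unit) b = 0) (m : ℕ) (y : PowerSeries ℂ) :
    curveEval a b (conjProd m y) =
      ∏ j ∈ Finset.range m, (b - PowerSeries.subst a (conjugate m y j)) := by
  rw [curveEval_eq ha hb, conjProd, map_prod]
  refine Finset.prod_congr rfl fun j _ => ?_
  rw [map_sub, substPair_X_one, substPair_ser1_zero]

theorem curveEval_pow_left {m : ℕ} (hm : m ≠ 0) {a b : PowerSeries ℂ}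
    (ha : MvPowerSeries.constantCoeff (σ := Unit) a = 0)
    (ham : MvPowerSeries.constantCoeff (σ := Unit) (a ^ m) = 0)
    (hb : MvPowerSeries.constantCoeff (σ := Unit) b = 0) (g : Ser2) :
    curveEval a b (pullback m g) = curveEval (a ^ m) b g := by
  rw [pullback_eq_substPair hm, curveEval_eq ha hb, curveEval_eq ham hb]
  rw [substPair, substAlgHom_substPair (constantCoeff_X_pow 0 hm) constantCoeff_X_one]
  · change substPair ha hb _ = _
    rw [map_pow, substPair_X_zero]
  · change substPair ha hb _ = _
    rw [substPair_X_one]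

theorem curveEval_expand {n : ℕ} (hn : n ≠ 0) {a b : PowerSeries ℂ}
    (ha : MvPowerSeries.constantCoeff (σ := Unit) a = 0)
    (hb : MvPowerSeries.constantCoeff (σ := Unit) b = 0) (g : Ser2) :
    PowerSeries.expand n hn (curveEval a b g) =
      curveEval (PowerSeries.expand n hn a) (PowerSeries.expand n hn b) g := by
  simp only [PowerSeries.expand_apply]
  exact substPair_curve_comp (constantCoeff_X_pow_ser1 hn) ha hb g

theorem expand_injective {n : ℕ} (hn : n ≠ 0) :
    Function.Injective (PowerSeries.expand n hn : PowerSeries ℂ → PowerSeries ℂ) := by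
  intro a b hab
  ext k
  rw [← PowerSeries.coeff_expand_mul n hn, hab, PowerSeries.coeff_expand_mul]

theorem rescale_expand {n : ℕ} (hn : n ≠ 0) {ω : ℂ} (hω : ω ^ n = 1) (a : PowerSeries ℂ) :
    PowerSeries.rescale ω (PowerSeries.expand n hn a) = PowerSeries.expand n hn a := by
  ext k
  rw [PowerSeries.coeff_rescale, PowerSeries.coeff_expand]
  split_ifs with h
  · obtain ⟨c, rfl⟩ := h
    rw [pow_mul, hω, one_pow, one_mul]
  · rw [mul_zero]

/-- A series that is invariant under the `n`-th roots of unity is a series in `s ^ n`. -/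
theorem exists_expand_of_rescale {n : ℕ} (hn : n ≠ 0) {α : PowerSeries ℂ}
    (h : PowerSeries.rescale (unityRoot n) α = α) :
    ∃ ψ, α = PowerSeries.expand n hn ψ := by
  refine ⟨PowerSeries.mk fun k => PowerSeries.coeff (n * k) α, ?_⟩
  ext k
  rw [PowerSeries.coeff_expand]
  split_ifs with hk
  · obtain ⟨c, rfl⟩ := hk
    rw [Nat.mul_div_cancel_left _ (Nat.pos_of_ne_zero hn), PowerSeries.coeff_mk]
  · have h1 := congrArg (PowerSeries.coeff k) h
    rw [PowerSeries.coeff_rescale] at h1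
    by_contra h0
    exact hk (((isPrimitiveRoot_unityRoot hn).pow_eq_one_iff_dvd k).1 (mul_right_cancel₀ h0
      (h1.trans (one_mul _).symm)))

theorem subst_rescale {α : PowerSeries ℂ} (hα : MvPowerSeries.constantCoeff (σ := Unit) α = 0)
    (ω : ℂ) (y : PowerSeries ℂ) :
    PowerSeries.subst α (PowerSeries.rescale ω y) =
      PowerSeries.subst (PowerSeries.C ω * α) y := by
  have hs : PowerSeries.HasSubst α := PowerSeries.HasSubst.of_constantCoeff_zero hα
  rw [PowerSeries.rescale_eq_subst, PowerSeries.subst_comp_subst_apply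
    (PowerSeries.HasSubst.smul_X' ω) hs, PowerSeries.smul_eq_C_mul,
    ← PowerSeries.coe_substAlgHom hs, map_mul, PowerSeries.coe_substAlgHom,
    PowerSeries.subst_X hs]
  congr 2
  have := (PowerSeries.substAlgHom hs).commutes ω
  rw [PowerSeries.coe_substAlgHom] at this
  exact this

theorem rescale_subst {α : PowerSeries ℂ} (hα : MvPowerSeries.constantCoeff (σ := Unit) α = 0)
    (ω : ℂ) (y : PowerSeries ℂ) :
    PowerSeries.rescale ω (PowerSeries.subst α y) =
      PowerSeries.subst (PowerSeries.rescale ω α) y := by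
  have hs : PowerSeries.HasSubst α := PowerSeries.HasSubst.of_constantCoeff_zero hα
  rw [PowerSeries.rescale_eq_subst, PowerSeries.subst_comp_subst_apply hs
    (PowerSeries.HasSubst.smul_X' ω), PowerSeries.rescale_eq_subst]

/-- Every curve on which the equation of a branch vanishes factors through the primitive
parametrization of the branch. The factor `ψ` is found after a base change `x = s ^ n`, as the
`m`-th root `α` of the first component for which the second component is `y(α)`; as the
parametrization is primitive, `α` is invariant under the `n`-th roots of unity. -/
theorem exists_factor_parametrization {m : ℕ} (hm : m ≠ 0) {y : PowerSeries ℂ}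
    (hprim : ∃ n, gcdBelow m y n = 1) {a b : PowerSeries ℂ} (ha : MvPowerSeries.constantCoeff (σ := Unit) a = 0)
    (hb : MvPowerSeries.constantCoeff (σ := Unit) b = 0) (ha0 : a ≠ 0)
    (h : curveEval a b (branchEq m y) = 0) :
    ∃ ψ : PowerSeries ℂ, MvPowerSeries.constantCoeff (σ := Unit) ψ = 0 ∧ a = ψ ^ m ∧
      b = PowerSeries.subst ψ y := by
  obtain ⟨n, hn, hsplit⟩ := exists_ramify_splits (Polynomial.X ^ m - Polynomial.C a)
    (Polynomial.monic_X_pow_sub_C a hm)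
  set a' := PowerSeries.expand n hn a with ha'
  set b' := PowerSeries.expand n hn b with hb'
  have hcc : ∀ {c : PowerSeries ℂ}, MvPowerSeries.constantCoeff (σ := Unit) c = 0 →
      MvPowerSeries.constantCoeff (σ := Unit) (PowerSeries.expand n hn c) = 0 := fun {c} hc =>
    (PowerSeries.constantCoeff_expand n hn c).trans hc
  obtain ⟨α₀, hα₀⟩ : ∃ α₀ : PowerSeries ℂ, α₀ ^ m = a' := by
    rw [Polynomial.map_sub, Polynomial.map_pow, Polynomial.map_X, Polynomial.map_C] at hsplit
    obtain ⟨α₀, h0⟩ := hsplit.exists_eval_eq_zero (by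
      rw [Polynomial.degree_X_pow_sub_C (Nat.pos_of_ne_zero hm)]
      exact_mod_cast hm)
    refine ⟨α₀, ?_⟩
    simpa [sub_eq_zero] using h0
  have hcc' : ∀ {c : PowerSeries ℂ}, c ^ m = a' →
      MvPowerSeries.constantCoeff (σ := Unit) c = 0 := by
    intro c hc
    have h1 := congrArg (MvPowerSeries.constantCoeff (σ := Unit) (R := ℂ)) hc
    rw [hcc ha] at h1
    exact (pow_eq_zero_iff hm).1
      ((map_pow (MvPowerSeries.constantCoeff (σ := Unit) (R := ℂ)) c m).symm.trans h1)
  -- among the `m`-th roots of `a'` there is one, `α`, with `b' = y(α)`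
  obtain ⟨α, hα, hbα⟩ : ∃ α : PowerSeries ℂ, α ^ m = a' ∧ b' = PowerSeries.subst α y := by
    have h1 : curveEval α₀ b' (conjProd m y) = 0 := by
      have h2 := curveEval_pow_left hm (hcc' hα₀) (by rw [hα₀]; exact hcc ha) (hcc hb)
        (branchEq m y)
      rw [pullback_branchEq hm, hα₀] at h2
      rw [h2, ← curveEval_expand hn ha hb, h, map_zero]
    rw [curveEval_prod_branch (hcc' hα₀) (hcc hb), Finset.prod_eq_zero_iff] at h1
    obtain ⟨j, -, h2⟩ := h1
    refine ⟨PowerSeries.C (unityRoot m ^ j) * α₀, ?_, ?_⟩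
    · rw [mul_pow, hα₀, ← map_pow, ← pow_mul, mul_comm j, pow_mul,
        (isPrimitiveRoot_unityRoot hm).pow_eq_one, one_pow, map_one, one_mul]
    · rw [← subst_rescale (hcc' hα₀)]
      exact sub_eq_zero.1 h2
  have hα0 : α ≠ 0 := by
    rintro rfl
    rw [zero_pow hm] at hα
    exact ha0 (expand_injective hn (hα.symm.trans (map_zero _).symm))
  have hαc := hcc' hα
  -- `α` is invariant under the `n`-th roots of unity
  have hinv : PowerSeries.rescale (unityRoot n) α = α := by
    have hω := (isPrimitiveRoot_unityRoot hn).pow_eq_one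
    have h1 : PowerSeries.rescale (unityRoot n) α ^ m = α ^ m := by
      rw [← map_pow, hα, rescale_expand hn hω]
    obtain ⟨ω', hω', h2⟩ : ∃ ω' : ℂ, ω' ^ m = 1 ∧
        PowerSeries.rescale (unityRoot n) α = PowerSeries.C ω' * α := by
      have hζ : IsPrimitiveRoot (PowerSeries.C (unityRoot m) : PowerSeries ℂ) m :=
        (isPrimitiveRoot_unityRoot hm).map_of_injective PowerSeries.C_injective
      have h3 := hζ.pow_sub_pow_eq_prod_sub_mul (PowerSeries.rescale (unityRoot n) α) α
        (Nat.pos_of_ne_zero hm)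
      rw [h1, sub_self, eq_comm, Finset.prod_eq_zero_iff] at h3
      obtain ⟨c, hc, h4⟩ := h3
      rw [Polynomial.mem_nthRootsFinset (Nat.pos_of_ne_zero hm)] at hc
      have : NeZero m := ⟨hm⟩
      obtain ⟨i, -, rfl⟩ := hζ.eq_pow_of_pow_eq_one hc
      refine ⟨unityRoot m ^ i, ?_, ?_⟩
      · rw [← pow_mul, mul_comm, pow_mul, (isPrimitiveRoot_unityRoot hm).pow_eq_one, one_pow]
      · rw [map_pow]; exact sub_eq_zero.1 h4
    have h5 : PowerSeries.rescale ω' y = y := by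
      have h6 : PowerSeries.subst α (PowerSeries.rescale ω' y) = PowerSeries.subst α y := by
        rw [subst_rescale hαc, ← h2, ← rescale_subst hαc, ← hbα, rescale_expand hn hω]
      have hs : PowerSeries.HasSubst α := PowerSeries.HasSubst.of_constantCoeff_zero hαc
      rw [← sub_eq_zero]
      apply subst_injective hαc hα0
      rw [← PowerSeries.coe_substAlgHom hs] at h6 ⊢
      rw [map_sub, h6, sub_self]
    have h7 : ω' = 1 := by
      obtain ⟨N, hN⟩ := hprim
      have h8 := (pow_gcdBelow_eq_one_iff hω' y N).2 fun k _ hk => by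
        have h9 := congrArg (PowerSeries.coeff k) h5
        rw [PowerSeries.coeff_rescale] at h9
        exact mul_right_cancel₀ hk (h9.trans (one_mul _).symm)
      rwa [hN, pow_one] at h8
    rw [h2, h7, map_one, one_mul]
  obtain ⟨ψ, rfl⟩ := exists_expand_of_rescale hn hinv
  have hψ : MvPowerSeries.constantCoeff (σ := Unit) ψ = 0 :=
    (PowerSeries.constantCoeff_expand n hn ψ).symm.trans hαc
  refine ⟨ψ, hψ, expand_injective hn ?_, expand_injective hn ?_⟩
  · rw [map_pow, hα]
  · refine hbα.trans ?_
    simp only [PowerSeries.expand_apply]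
    exact (PowerSeries.subst_comp_subst_apply (PowerSeries.HasSubst.of_constantCoeff_zero hψ)
      (PowerSeries.HasSubst.of_constantCoeff_zero (constantCoeff_X_pow_ser1 hn)) y).symm

theorem eq_zero_of_curveEval_zero_branchEq {m : ℕ} (hm : m ≠ 0) {y : PowerSeries ℂ}
    (hy : MvPowerSeries.constantCoeff (σ := Unit) y = 0) {b : PowerSeries ℂ}
    (hb : MvPowerSeries.constantCoeff (σ := Unit) b = 0)
    (h : curveEval 0 b (branchEq m y) = 0) : b = 0 := by
  have h0 : MvPowerSeries.constantCoeff (σ := Unit) (0 : PowerSeries ℂ) = 0 := map_zero _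
  have h1 := curveEval_pow_left hm h0 (by rw [zero_pow hm]; exact h0) hb (branchEq m y)
  rw [pullback_branchEq hm, zero_pow hm, h, curveEval_prod_branch h0 hb,
    Finset.prod_eq_zero_iff] at h1
  obtain ⟨j, -, h2⟩ := h1
  obtain ⟨z, hz⟩ := X_dvd_of_cc (constantCoeff_conjugate (m := m) hy j)
  have hs : PowerSeries.HasSubst (0 : PowerSeries ℂ) :=
    PowerSeries.HasSubst.of_constantCoeff_zero h0
  rwa [hz, ← PowerSeries.coe_substAlgHom hs, map_mul, PowerSeries.coe_substAlgHom,
    PowerSeries.subst_X hs, zero_mul, sub_zero] at h2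

theorem X_pow_dvd_subst {ψ y : PowerSeries ℂ} {k : ℕ}
    (hψ : MvPowerSeries.constantCoeff (σ := Unit) ψ = 0) (hy : PowerSeries.X ^ k ∣ y) :
    ψ ^ k ∣ PowerSeries.subst ψ y := by
  have hs : PowerSeries.HasSubst ψ := PowerSeries.HasSubst.of_constantCoeff_zero hψ
  obtain ⟨z, rfl⟩ := hy
  rw [← PowerSeries.coe_substAlgHom hs, map_mul, map_pow, PowerSeries.coe_substAlgHom,
    PowerSeries.subst_X hs]
  exact dvd_mul_right _ _

/-- The Milnor number can be read off from every curve `γ` on which the equation vanishes, if `γ`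
is not traversed more than once, which is ensured by a nonzero coefficient of degree `m`. -/
theorem milnorNumber_eq_colength_doubleIdeal {m : ℕ} (hm : 2 ≤ m) {h : ConvSeries}
    {L : GL (Fin 2) ℂ} {y : PowerSeries ℂ} (hp : IsPuiseuxParametrization h m L y)
    {γ : Fin 2 → PowerSeries ℂ}
    (hγ : ∀ i, MvPowerSeries.constantCoeff (σ := Unit) (γ i) = 0)
    (hγm : ∃ i, PowerSeries.coeff m (γ i) ≠ 0) (hh : curveEval (γ 0) (γ 1) h.1 = 0) :
    milnorNumber h = colength (doubleIdeal γ) := by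
  have hm0 : m ≠ 0 := by omega
  have hcc := cc_of_exponents hp.exponents
  obtain ⟨N, hN⟩ := hp.primitive
  -- the curve in the linear coordinates of the parametrization
  set M := (L⁻¹ : GL (Fin 2) ℂ).1 with hM
  set c : Fin 2 → PowerSeries ℂ :=
    fun i => PowerSeries.C (M i 0) * γ 0 + PowerSeries.C (M i 1) * γ 1 with hc
  have hcc0 : ∀ i, MvPowerSeries.constantCoeff (σ := Unit) (c i) = 0 := fun i =>
    constantCoeff_linear (hγ 0) (hγ 1) _ _
  have hLM : L.1 * M = 1 := mul_inv_coe L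
  have hγc : ∀ i, γ i = PowerSeries.C (L.1 i 0) * c 0 + PowerSeries.C (L.1 i 1) * c 1 := by
    intro i
    have e : ∀ j, L.1 i 0 * M 0 j + L.1 i 1 * M 1 j = (1 : Matrix (Fin 2) (Fin 2) ℂ) i j := by
      intro j; rw [← hLM, Matrix.mul_apply, Fin.sum_univ_two]
    have e' : ∀ j, PowerSeries.C (L.1 i 0) * PowerSeries.C (M 0 j) +
        PowerSeries.C (L.1 i 1) * PowerSeries.C (M 1 j) =
          PowerSeries.C ((1 : Matrix (Fin 2) (Fin 2) ℂ) i j) := by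
      intro j; rw [← e, map_add, map_mul, map_mul]
    have h1 : PowerSeries.C (L.1 i 0) * c 0 + PowerSeries.C (L.1 i 1) * c 1 =
        PowerSeries.C ((1 : Matrix (Fin 2) (Fin 2) ℂ) i 0) * γ 0 +
          PowerSeries.C ((1 : Matrix (Fin 2) (Fin 2) ℂ) i 1) * γ 1 := by
      rw [← e', ← e']; simp only [hc]; ring
    rw [h1]
    obtain rfl | rfl : i = 0 ∨ i = 1 := by omega
    all_goals simp
  have hev : curveEval (PowerSeries.X ^ m) y (linSubst L.1 h.1) = 0 := by
    rw [curveEval_linSubst (constantCoeff_X_pow_ser1 hm0) hcc, ← hp.vanishes, curveEval]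
    congr 1
    funext i
    fin_cases i <;> rfl
  obtain ⟨q, hq, hbq⟩ := exists_unit_mul_branchEq hm0 hp.exponents ⟨N, hN⟩
    ((order_linSubst L h.1).trans hp.multiplicity) hev
  have hcb : curveEval (c 0) (c 1) (branchEq m y) = 0 := by
    have h1 : curveEval (c 0) (c 1) (linSubst L.1 h.1) = 0 := by
      rw [curveEval_linSubst (hcc0 0) (hcc0 1), ← hγc, ← hγc, hh]
    rw [hbq, curveEval_mul (hcc0 0) (hcc0 1)] at h1
    refine (mul_eq_zero.1 h1).resolve_right fun h2 => hq ?_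
    have hu : IsUnit (substPair (hcc0 0) (hcc0 1) q) :=
      (MvPowerSeries.isUnit_iff_constantCoeff.2 (IsUnit.mk0 _ hq)).map _
    rw [← curveEval_eq (hcc0 0) (hcc0 1), h2] at hu
    exact absurd hu not_isUnit_zero
  have hc0 : c 0 ≠ 0 := by
    intro h0
    rw [h0] at hcb
    have h1 := eq_zero_of_curveEval_zero_branchEq hm0 hcc (hcc0 1) hcb
    obtain ⟨i, hi⟩ := hγm
    rw [hγc, h0, h1, mul_zero, mul_zero, add_zero, map_zero] at hi
    exact hi rfl
  obtain ⟨ψ, hψ, h0, h1⟩ := exists_factor_parametrization hm0 ⟨N, hN⟩ (hcc0 0) (hcc0 1) hc0 hcb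
  have hs : PowerSeries.HasSubst ψ := PowerSeries.HasSubst.of_constantCoeff_zero hψ
  have hψ1 : PowerSeries.coeff 1 ψ ≠ 0 := by
    intro hψ1
    have h2 : PowerSeries.X ^ 2 ∣ ψ := by
      rw [PowerSeries.X_pow_dvd_iff]
      intro k hk
      obtain rfl | rfl : k = 0 ∨ k = 1 := by omega
      · exact (PowerSeries.coeff_zero_eq_constantCoeff_apply ψ).trans hψ
      · exact hψ1
    have h3 : PowerSeries.X ^ (m + 1) ∣ ψ ^ m := by
      refine (pow_dvd_pow PowerSeries.X (show m + 1 ≤ 2 * m by omega)).trans ?_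
      rw [pow_mul]
      exact pow_dvd_pow_of_dvd h2 m
    have h4 : PowerSeries.X ^ (m + 1) ∣ PowerSeries.subst ψ y := by
      refine h3.trans (X_pow_dvd_subst hψ (PowerSeries.X_pow_dvd_iff.2 fun k hk => ?_))
      exact hp.exponents k hk.le
    obtain ⟨i, hi⟩ := hγm
    apply hi
    refine PowerSeries.X_pow_dvd_iff.1 ?_ m (Nat.lt_succ_self m)
    rw [hγc, h0, h1]
    exact dvd_add (h3.mul_left _) (h4.mul_left _)
  have hγψ : γ = fun i => PowerSeries.subst ψ (puiseuxCurve m L y i) := by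
    funext i
    have hC : ∀ r : ℂ, PowerSeries.substAlgHom hs (PowerSeries.C r) = PowerSeries.C r :=
      fun r => (PowerSeries.substAlgHom hs).commutes r
    rw [hγc, h0, h1, puiseuxCurve, ← PowerSeries.coe_substAlgHom hs, map_add, map_mul, map_mul,
      map_pow, hC, hC, PowerSeries.coe_substAlgHom, PowerSeries.subst_X hs]
  rw [hγψ, colength_doubleIdeal_subst hψ hψ1, colength_doubleIdeal hm L hp.exponents hN,
    milnorNumber_eq_gcdSum hm hp hN]

/-! ### Taylor expansions -/

/-- The function `g` agrees with the power series `γ` near `0` up to order `K`. -/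
def Expands (K : ℕ) (g : ℂ → ℂ) (γ : PowerSeries ℂ) : Prop :=
  ∃ p : Polynomial ℂ, PowerSeries.X ^ K ∣ γ - (p : PowerSeries ℂ) ∧ (fun v => g v - p.eval v) =O[𝓝 0] fun v => v ^ K

theorem isBigO_one_eval (p : Polynomial ℂ) :
    (fun v => p.eval v) =O[𝓝 0] fun _ : ℂ => (1 : ℂ) :=
  (p.continuous.tendsto 0).isBigO_one ℂ

theorem Expands.isBigO_one {K : ℕ} {g : ℂ → ℂ} {γ : PowerSeries ℂ} (h : Expands K g γ) :
    g =O[𝓝 0] fun _ : ℂ => (1 : ℂ) := by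
  obtain ⟨p, -, hp⟩ := h
  have h1 : (fun v : ℂ => v ^ K) =O[𝓝 0] fun _ : ℂ => (1 : ℂ) :=
    ((continuous_pow K).tendsto 0).isBigO_one ℂ
  simpa using (hp.trans h1).add (isBigO_one_eval p)

theorem expands_const (K : ℕ) (c : ℂ) : Expands K (fun _ => c) (PowerSeries.C c) :=
  ⟨Polynomial.C c, by simp, by simpa using isBigO_zero _ _⟩

theorem Expands.add {K : ℕ} {g g' : ℂ → ℂ} {γ γ' : PowerSeries ℂ} (h : Expands K g γ)
    (h' : Expands K g' γ') : Expands K (fun v => g v + g' v) (γ + γ') := by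
  obtain ⟨p, hp, hp'⟩ := h
  obtain ⟨q, hq, hq'⟩ := h'
  refine ⟨p + q, ?_, ?_⟩
  · have : γ + γ' - ((p + q : Polynomial ℂ) : PowerSeries ℂ) = (γ - (p : PowerSeries ℂ)) + (γ' - (q : PowerSeries ℂ)) := by
      rw [Polynomial.coe_add]; ring
    rw [this]; exact dvd_add hp hq
  · refine (hp'.add hq').congr_left fun v => ?_
    rw [Polynomial.eval_add]; ring

theorem Expands.mul {K : ℕ} {g g' : ℂ → ℂ} {γ γ' : PowerSeries ℂ} (h : Expands K g γ)
    (h' : Expands K g' γ') : Expands K (fun v => g v * g' v) (γ * γ') := by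
  have hb := h.isBigO_one
  obtain ⟨p, hp, hp'⟩ := h
  obtain ⟨q, hq, hq'⟩ := h'
  refine ⟨p * q, ?_, ?_⟩
  · have : γ * γ' - ((p * q : Polynomial ℂ) : PowerSeries ℂ) = γ * (γ' - (q : PowerSeries ℂ)) + (γ - (p : PowerSeries ℂ)) * (q : PowerSeries ℂ) := by
      rw [Polynomial.coe_mul]; ring
    rw [this]; exact dvd_add (hq.mul_left _) (hp.mul_right _)
  · have h1 := hb.mul hq'
    have h2 := hp'.mul (isBigO_one_eval q)
    simp only [one_mul, mul_one] at h1 h2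
    refine (h1.add h2).congr_left fun v => ?_
    rw [Polynomial.eval_mul]; ring

theorem Expands.pow {K : ℕ} {g : ℂ → ℂ} {γ : PowerSeries ℂ} (h : Expands K g γ) (n : ℕ) :
    Expands K (fun v => g v ^ n) (γ ^ n) := by
  induction n with
  | zero => simpa using expands_const K 1
  | succ n ih => simpa only [pow_succ] using ih.mul h

theorem Expands.sum {K : ℕ} {ι : Type} (s : Finset ι) {g : ι → ℂ → ℂ} {γ : ι → PowerSeries ℂ}
    (h : ∀ i ∈ s, Expands K (g i) (γ i)) :
    Expands K (fun v => ∑ i ∈ s, g i v) (∑ i ∈ s, γ i) := by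
  induction s using Finset.cons_induction with
  | empty => simpa using expands_const K 0
  | cons a s ha ih =>
    simp only [Finset.sum_cons]
    exact (h a (by simp)).add (ih fun i hi => h i (by simp [hi]))

theorem eq_zero_of_forall_X_pow_dvd {a : PowerSeries ℂ} (h : ∀ N, PowerSeries.X ^ N ∣ a) :
    a = 0 := by
  ext n
  exact PowerSeries.X_pow_dvd_iff.1 (h (n + 1)) n (Nat.lt_succ_self n)

theorem X_pow_dvd_of_isBigO {K : ℕ} {p : Polynomial ℂ}
    (h : (fun v => p.eval v) =O[𝓝 0] fun v : ℂ => v ^ K) : Polynomial.X ^ K ∣ p := by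
  by_contra hcon
  have hp0 : p ≠ 0 := by rintro rfl; exact hcon (dvd_zero _)
  -- split off the exact power of `X`, which is less than `K`
  obtain ⟨q, hq, hroot⟩ := Polynomial.exists_eq_pow_rootMultiplicity_mul_and_not_dvd p hp0 0
  rw [map_zero, sub_zero] at hq hroot
  set j := p.rootMultiplicity 0
  have hj : j < K := by
    by_contra! hle
    exact hcon (hq ▸ (pow_dvd_pow _ hle).mul_right q)
  have hq0 : q.eval 0 ≠ 0 := by
    rwa [Ne, ← Polynomial.coeff_zero_eq_eval_zero, ← Polynomial.X_dvd_iff]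
  have h1 : (fun v => q.eval v) =O[𝓝[≠] 0] fun v : ℂ => v ^ (K - j) := by
    obtain ⟨C, hC⟩ := (h.mono (nhdsWithin_le_nhds (s := {0}ᶜ))).bound
    refine IsBigO.of_bound C ?_
    filter_upwards [hC, self_mem_nhdsWithin] with v hv hv0
    have hv1 : 0 < ‖v‖ ^ j := pow_pos (norm_pos_iff.2 hv0) j
    rw [hq] at hv
    simp only [Polynomial.eval_mul, Polynomial.eval_pow, Polynomial.eval_X, norm_mul, norm_pow]
      at hv ⊢
    obtain ⟨c, rfl⟩ : ∃ c, K = j + c := ⟨K - j, by omega⟩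
    rw [pow_add] at hv
    rw [Nat.add_sub_cancel_left]
    refine le_of_mul_le_mul_left ?_ hv1
    linarith
  have h2 : Tendsto (fun v : ℂ => v ^ (K - j)) (𝓝[≠] 0) (𝓝 0) := by
    have := (continuous_pow (M := ℂ) (K - j)).tendsto 0
    rw [zero_pow (by omega)] at this
    exact this.mono_left nhdsWithin_le_nhds
  have h3 := h1.trans_tendsto h2
  have h4 : Tendsto (fun v => q.eval v) (𝓝[≠] 0) (𝓝 (q.eval 0)) :=
    (q.continuous.tendsto 0).mono_left nhdsWithin_le_nhds
  exact hq0 (tendsto_nhds_unique h4 h3)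

theorem Expands.X_pow_dvd {K : ℕ} {g : ℂ → ℂ} {γ : PowerSeries ℂ} (h : Expands K g γ)
    (hg : g =O[𝓝 0] fun v => v ^ K) : PowerSeries.X ^ K ∣ γ := by
  obtain ⟨p, hp, hp'⟩ := h
  have h1 : (fun v => p.eval v) =O[𝓝 0] fun v : ℂ => v ^ K :=
    (hg.sub hp').congr_left fun v => by ring
  obtain ⟨q, hq⟩ := X_pow_dvd_of_isBigO h1
  have h2 : (PowerSeries.X ^ K : PowerSeries ℂ) ∣ (p : PowerSeries ℂ) :=
    ⟨q, by rw [hq, Polynomial.coe_mul, Polynomial.coe_pow, Polynomial.coe_X]⟩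
  have := dvd_add hp h2
  rwa [sub_add_cancel] at this

/-- The Taylor series of an analytic function. -/
theorem exists_expands {g : ℂ → ℂ} {z : ℂ} (hg : AnalyticAt ℂ g z) (K : ℕ) :
    Expands K (fun v => g (z + v))
      (PowerSeries.mk fun n => iteratedDeriv n g z / (n.factorial : ℂ)) := by
  have h1 := hg.hasFPowerSeriesAt.isBigO_sub_partialSum_pow K
  set γ : PowerSeries ℂ := PowerSeries.mk fun n => iteratedDeriv n g z / (n.factorial : ℂ)
  set p : Polynomial ℂ :=
    ∑ n ∈ Finset.range K, Polynomial.monomial n (PowerSeries.coeff n γ) with hp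
  refine ⟨p, PowerSeries.X_pow_dvd_iff.2 fun k hk => ?_, ?_⟩
  · rw [map_sub, Polynomial.coeff_coe, hp, Polynomial.finsetSum_coeff]
    simp only [Polynomial.coeff_monomial]
    rw [Finset.sum_ite_eq', if_pos (Finset.mem_range.2 hk), sub_self]
  · have h2 : ∀ v, p.eval v = (FormalMultilinearSeries.ofScalars ℂ
        fun n => iteratedDeriv n g z / (n.factorial : ℂ)).partialSum K v := by
      intro v
      rw [hp, Polynomial.eval_finsetSum, FormalMultilinearSeries.partialSum]
      refine Finset.sum_congr rfl fun n _ => ?_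
      rw [Polynomial.eval_monomial, PowerSeries.coeff_mk,
        FormalMultilinearSeries.ofScalars_apply_eq, smul_eq_mul]
    simp only [h2]
    exact h1.trans (IsBigO.of_bound 1 (by simp))

/-- A convergent series of order at least `K` is bounded by `|p| ^ K`. -/
theorem norm_evalAt_le {h : Ser2} (hc : IsConvergent h) {K : ℕ} (hK : (K : ℕ∞) ≤ h.order) :
    ∃ C r : ℝ, 0 < r ∧ ∀ p : Fin 2 → ℂ, ‖p‖ ≤ r → ‖evalAt h p‖ ≤ C * ‖p‖ ^ K := by
  obtain ⟨r, hr, hs⟩ := hc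
  refine ⟨(∑' n : Fin 2 →₀ ℕ, ‖MvPowerSeries.coeff n h‖ * r ^ n.degree) / r ^ K, r, hr,
    fun p hp => ?_⟩
  have hle : ∀ n : Fin 2 →₀ ℕ, ‖MvPowerSeries.coeff n h * ∏ i, p i ^ n i‖ ≤
      ‖MvPowerSeries.coeff n h‖ * r ^ n.degree * (‖p‖ / r) ^ K := by
    intro n
    by_cases h0 : MvPowerSeries.coeff n h = 0
    · simp [h0]
    have hKn : K ≤ n.degree := by
      by_contra! hlt
      exact h0 (MvPowerSeries.coeff_of_lt_order (lt_of_lt_of_le (by exact_mod_cast hlt) hK))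
    rw [norm_mul, norm_prod, mul_assoc]
    refine mul_le_mul_of_nonneg_left ?_ (norm_nonneg _)
    have h1 : ∏ i, ‖p i ^ n i‖ ≤ ‖p‖ ^ n.degree := by
      rw [eq_biexp n, degree_biexp, Fin.prod_univ_two, biexp_zero, biexp_one, norm_pow, norm_pow,
        pow_add]
      gcongr <;> exact norm_le_pi_norm p _
    refine h1.trans ?_
    calc ‖p‖ ^ n.degree = r ^ n.degree * (‖p‖ / r) ^ n.degree := by
          rw [← mul_pow, mul_div_cancel₀ _ hr.ne']
      _ ≤ _ := mul_le_mul_of_nonneg_left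
          (pow_le_pow_of_le_one (by positivity) ((div_le_one hr).2 hp) hKn) (by positivity)
  have h2 := tsum_of_norm_bounded (hs.mul_right ((‖p‖ / r) ^ K)).hasSum hle
  refine h2.trans (le_of_eq ?_)
  rw [tsum_mul_right, div_pow]
  ring

theorem summable_evalAt {h : Ser2} (hc : IsConvergent h) :
    ∀ᶠ p in 𝓝 (0 : Fin 2 → ℂ), Summable fun n : Fin 2 →₀ ℕ =>
      MvPowerSeries.coeff n h * ∏ i, p i ^ n i := by
  obtain ⟨r, hr, hs⟩ := hc
  filter_upwards [Metric.closedBall_mem_nhds (0 : Fin 2 → ℂ) hr] with p hp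
  rw [mem_closedBall_zero_iff] at hp
  refine hs.of_norm_bounded fun n => ?_
  rw [norm_mul, norm_prod]
  refine mul_le_mul_of_nonneg_left ?_ (norm_nonneg _)
  rw [eq_biexp n, degree_biexp, Fin.prod_univ_two, biexp_zero, biexp_one, norm_pow, norm_pow,
    pow_add]
  gcongr <;> exact (norm_le_pi_norm p _).trans hp

theorem lowPart_eq_sum (K : ℕ) (h : Ser2) :
    lowPart K h = ∑ n ∈ lowExponents K, MvPowerSeries.C (MvPowerSeries.coeff n h) *
      MvPowerSeries.X 0 ^ n 0 * MvPowerSeries.X 1 ^ n 1 := by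
  classical
  ext n
  simp only [← monomial_biexp, ← eq_biexp]
  rw [coeff_lowPart, map_sum]
  simp only [MvPowerSeries.coeff_monomial]
  rw [Finset.sum_ite_eq]

theorem evalAt_lowPart (K : ℕ) (h : Ser2) (p : Fin 2 → ℂ) :
    evalAt (lowPart K h) p =
      ∑ n ∈ lowExponents K, MvPowerSeries.coeff n h * (p 0 ^ n 0 * p 1 ^ n 1) := by
  rw [evalAt, tsum_eq_sum (s := lowExponents K)]
  · refine Finset.sum_congr rfl fun n hn => ?_
    rw [coeff_lowPart, if_pos hn, Fin.prod_univ_two]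
  · intro n hn
    rw [coeff_lowPart, if_neg hn, zero_mul]

/-- If a convergent series vanishes along an analytic curve, it vanishes formally along the Taylor
series of the curve. Up to any given order, the series can be replaced by a polynomial. -/
theorem curveEval_eq_zero_of_evalAt {h : Ser2} (hc : IsConvergent h) {g : ℂ → Fin 2 → ℂ}
    {γ : Fin 2 → PowerSeries ℂ} (hγ : ∀ i, MvPowerSeries.constantCoeff (σ := Unit) (γ i) = 0)
    (hexp : ∀ i K, Expands K (fun v => g v i) (γ i))
    (hz : ∀ᶠ v in 𝓝 (0 : ℂ), evalAt h (g v) = 0) : curveEval (γ 0) (γ 1) h = 0 := by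
  refine eq_zero_of_forall_X_pow_dvd fun K => ?_
  have hP : Expands K (fun v => evalAt (lowPart K h) (g v)) (curveEval (γ 0) (γ 1) (lowPart K h)) := by
    have h1 : curveEval (γ 0) (γ 1) (lowPart K h) = ∑ n ∈ lowExponents K,
        PowerSeries.C (MvPowerSeries.coeff n h) * (γ 0 ^ n 0 * γ 1 ^ n 1) := by
      rw [curveEval_eq (hγ 0) (hγ 1), lowPart_eq_sum, map_sum]
      refine Finset.sum_congr rfl fun n _ => ?_
      rw [map_mul, map_mul, map_pow, map_pow, substPair_X_zero, substPair_X_one, map_C, mul_assoc]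
      rfl
    rw [h1]
    simp only [evalAt_lowPart]
    exact Expands.sum _ fun n _ =>
      (expands_const K _).mul (((hexp 0 K).pow _).mul ((hexp 1 K).pow _))
  have hg1 : g =O[𝓝 0] fun v : ℂ => v := by
    rw [isBigO_pi]
    intro i
    obtain ⟨p, hp, hp'⟩ := hexp i 1
    rw [pow_one] at hp
    simp only [pow_one] at hp'
    have h1 : Polynomial.X ∣ p := by
      rw [Polynomial.X_dvd_iff]
      have h2 := PowerSeries.X_dvd_iff.1 hp
      rw [map_sub, sub_eq_zero, ← PowerSeries.coeff_zero_eq_constantCoeff_apply,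
        ← PowerSeries.coeff_zero_eq_constantCoeff_apply, Polynomial.coeff_coe] at h2
      rw [← h2]
      exact (PowerSeries.coeff_zero_eq_constantCoeff_apply _).trans (hγ i)
    obtain ⟨q, rfl⟩ := h1
    have h2 : (fun v => (Polynomial.X * q).eval v) =O[𝓝 0] fun v : ℂ => v := by
      have := (isBigO_refl (fun v : ℂ => v) (𝓝 0)).mul (isBigO_one_eval q)
      simpa using this
    simpa using hp'.add h2
  have hg0 : Tendsto g (𝓝 0) (𝓝 0) := hg1.trans_tendsto tendsto_id
  have hR : (fun v => evalAt (lowPart K h) (g v)) =O[𝓝 0] fun v => v ^ K := by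
    have hcR : IsConvergent (h - lowPart K h) :=
      (ConvSeries.sub_mem hc (isConvergent_lowPart K h) : h - lowPart K h ∈ ConvSeries)
    obtain ⟨C, r, hr, hC⟩ := norm_evalAt_le hcR (le_order_sub_lowPart K h)
    have h1 : (fun v => evalAt (h - lowPart K h) (g v)) =O[𝓝 0] fun v => ‖g v‖ ^ K := by
      refine IsBigO.of_bound C ?_
      filter_upwards [hg0.eventually (Metric.closedBall_mem_nhds (0 : Fin 2 → ℂ) hr)] with v hv
      rw [norm_pow, norm_norm]
      exact hC _ (mem_closedBall_zero_iff.1 hv)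
    have h2 := h1.trans (hg1.norm_left.pow K)
    refine (h2.neg_left).congr' ?_ (by rfl)
    filter_upwards [hz, hg0.eventually (summable_evalAt hc),
      hg0.eventually (summable_evalAt (isConvergent_lowPart K h))] with v hv hs hs'
    have h3 : evalAt (h - lowPart K h) (g v) = evalAt h (g v) - evalAt (lowPart K h) (g v) := by
      simp only [evalAt, map_sub, sub_mul]
      exact hs.tsum_sub hs'
    rw [h3, hv, zero_sub, neg_neg]
  have h1 := hP.X_pow_dvd hR
  have h2 : PowerSeries.X ^ K ∣ curveEval (γ 0) (γ 1) (h - lowPart K h) := by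
    have h3 := mem_maxIdeal_pow_of_le_order (le_order_sub_lowPart K h)
    have h4 := Ideal.mem_map_of_mem (substPair (hγ 0) (hγ 1) : Ser2 →+* PowerSeries ℂ) h3
    rw [Ideal.map_pow, maxIdeal, Ideal.map_span, Set.image_pair] at h4
    have h5 : Ideal.span {(substPair (hγ 0) (hγ 1) : Ser2 →+* PowerSeries ℂ) (MvPowerSeries.X 0),
        (substPair (hγ 0) (hγ 1) : Ser2 →+* PowerSeries ℂ) (MvPowerSeries.X 1)} ≤
        Ideal.span {PowerSeries.X} := by
      rw [Ideal.span_le]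
      rintro x (rfl | rfl)
      · refine Ideal.mem_span_singleton.2 ?_
        have := substPair_X_zero (hγ 0) (hγ 1)
        exact (X_dvd_of_cc (hγ 0)).trans (dvd_of_eq this.symm)
      · refine Ideal.mem_span_singleton.2 ?_
        have := substPair_X_one (hγ 0) (hγ 1)
        exact (X_dvd_of_cc (hγ 1)).trans (dvd_of_eq this.symm)
    have h6 := Ideal.pow_right_mono h5 K h4
    rw [Ideal.span_singleton_pow, Ideal.mem_span_singleton] at h6
    rw [curveEval_eq (hγ 0) (hγ 1)]
    exact h6
  have h7 : curveEval (γ 0) (γ 1) h =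
      curveEval (γ 0) (γ 1) (h - lowPart K h) + curveEval (γ 0) (γ 1) (lowPart K h) := by
    simp only [curveEval_eq (hγ 0) (hγ 1)]
    rw [← sub_add_cancel h (lowPart K h)]
    exact (map_add (substPair (hγ 0) (hγ 1)) _ _).trans (by rw [sub_add_cancel])
  rw [h7]
  exact dvd_add h2 h1

/-! ### Unfoldings -/

/-- The partial derivative with respect to the first variable. -/
def fstDeriv (f : ℂ × ℂ → ℂ) (z : ℂ × ℂ) : ℂ := fderiv ℂ f z (1, 0)

theorem analyticAt_fstDeriv {f : ℂ × ℂ → ℂ} {z : ℂ × ℂ} (h : AnalyticAt ℂ f z) :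
    AnalyticAt ℂ (fstDeriv f) z :=
  ((ContinuousLinearMap.apply ℂ ℂ ((1, 0) : ℂ × ℂ)).analyticAt _).comp h.fderiv

theorem analyticAt_iterate_fstDeriv {f : ℂ × ℂ → ℂ} {z : ℂ × ℂ} (h : AnalyticAt ℂ f z) (n : ℕ) :
    AnalyticAt ℂ (fstDeriv^[n] f) z := by
  induction n with
  | zero => exact h
  | succ n ih => rw [Function.iterate_succ_apply']; exact analyticAt_fstDeriv ih

theorem iteratedDeriv_eq_iterate_fstDeriv {f : ℂ × ℂ → ℂ} (n : ℕ) {u t : ℂ}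
    (h : AnalyticAt ℂ f (u, t)) :
    iteratedDeriv n (fun w => f (w, t)) u = fstDeriv^[n] f (u, t) := by
  induction n generalizing u with
  | zero => rw [iteratedDeriv_zero]; rfl
  | succ n ih =>
    have hpair : ∀ w, HasDerivAt (fun w : ℂ => (w, t)) (1, 0) w := fun w =>
      (hasDerivAt_id w).prodMk (hasDerivAt_const w t)
    have hev : ∀ᶠ w in 𝓝 u, iteratedDeriv n (fun w => f (w, t)) w = fstDeriv^[n] f (w, t) := by
      have h1 := (hpair u).continuousAt.eventually h.eventually_analyticAt
      exact h1.mono fun w hw => ih hw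
    rw [iteratedDeriv_succ, EventuallyEq.deriv_eq hev, Function.iterate_succ_apply']
    have h2 := (analyticAt_iterate_fstDeriv h n).differentiableAt.hasFDerivAt
    exact (h2.comp_hasDerivAt u (hpair u)).deriv

/-- The Taylor series at `u` of the curve `w ↦ F (w, t)`. -/
def taylorCurve (F : ℂ × ℂ → Fin 2 → ℂ) (u t : ℂ) (i : Fin 2) : PowerSeries ℂ :=
  PowerSeries.mk fun n => iteratedDeriv n (fun w => F (w, t) i) u / (n.factorial : ℂ)

theorem tendsto_coeff_taylorCurve {F : ℂ × ℂ → Fin 2 → ℂ} (hF : AnalyticAt ℂ F (0, 0))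
    {u : ℂ → ℂ} (hu : Tendsto u (𝓝 0) (𝓝 0)) (i : Fin 2) (n : ℕ) :
    Tendsto (fun t => PowerSeries.coeff n (taylorCurve F (u t) t i)) (𝓝 0)
      (𝓝 (PowerSeries.coeff n (taylorCurve F 0 0 i))) := by
  have hFi : AnalyticAt ℂ (fun z => F z i) (0, 0) := analyticAt_pi_iff.1 hF i
  have hut : Tendsto (fun t => (u t, t)) (𝓝 0) (𝓝 ((0, 0) : ℂ × ℂ)) :=
    hu.prodMk_nhds tendsto_id
  simp only [taylorCurve, PowerSeries.coeff_mk]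
  refine Tendsto.div_const ?_ _
  rw [iteratedDeriv_eq_iterate_fstDeriv n hFi]
  refine ((analyticAt_iterate_fstDeriv hFi n).continuousAt.tendsto.comp hut).congr' ?_
  filter_upwards [hut.eventually hFi.eventually_analyticAt] with t ht
  exact (iteratedDeriv_eq_iterate_fstDeriv n ht).symm

theorem isConvergent_puiseuxCurve {m : ℕ} (L : GL (Fin 2) ℂ) {y : PowerSeries ℂ}
    (hy : IsConvergent (σ := Unit) y) (i : Fin 2) :
    IsConvergent (σ := Unit) (puiseuxCurve m L y i) := by
  classical
  have hX : IsConvergent (σ := Unit) (PowerSeries.X ^ m : PowerSeries ℂ) := by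
    refine isConvergent_of_finite {Finsupp.single () m} fun n hn => ?_
    have h1 : n = Finsupp.single () (n ()) := by ext; simp
    rw [h1]
    change PowerSeries.coeff (n ()) (PowerSeries.X ^ m : PowerSeries ℂ) = 0
    rw [PowerSeries.coeff_X_pow, if_neg]
    rintro rfl
    exact hn (by rw [Finset.mem_singleton]; exact h1)
  exact ((isConvergent_algebraMap _).mul hX).add ((isConvergent_algebraMap _).mul hy)

/-- A convergent series in one variable is the power series expansion of its sum. -/
theorem hasFPowerSeriesAt_evalAt {a : PowerSeries ℂ} (ha : IsConvergent (σ := Unit) a)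
    {g : ℂ → ℂ} (hg : ∀ᶠ u in 𝓝 (0 : ℂ), g u = evalAt (σ := Unit) a fun _ => u) :
    HasFPowerSeriesAt g
      (FormalMultilinearSeries.ofScalars ℂ fun n => PowerSeries.coeff n a) 0 := by
  rw [hasFPowerSeriesAt_iff]
  obtain ⟨r, hr, hs⟩ := ha
  filter_upwards [hg, Metric.closedBall_mem_nhds (0 : ℂ) hr] with u hu hur
  rw [mem_closedBall_zero_iff] at hur
  have h1 : Summable fun n : Unit →₀ ℕ =>
      MvPowerSeries.coeff n (a : MvPowerSeries Unit ℂ) * ∏ i, u ^ n i := by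
    refine hs.of_norm_bounded fun n => ?_
    rw [norm_mul, Fintype.prod_unique, norm_pow]
    refine mul_le_mul_of_nonneg_left ?_ (norm_nonneg _)
    have h2 : n.degree = n default := by
      rw [Finsupp.degree_eq_sum, Fintype.sum_unique]
    rw [h2]
    gcongr
  have h3 := h1.hasSum
  let e : ℕ ≃ (Unit →₀ ℕ) := ⟨fun n => Finsupp.single () n, fun n => n (), fun n => by simp,
    fun n => by ext; simp⟩
  rw [zero_add, hu, evalAt]
  refine ((e.hasSum_iff).2 h3).congr_fun fun n => ?_
  rw [FormalMultilinearSeries.coeff_ofScalars, smul_eq_mul, mul_comm]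
  simp only [Function.comp_apply, Fintype.prod_unique]
  simp [e, PowerSeries.coeff]

theorem taylorCurve_zero {m : ℕ} {L : GL (Fin 2) ℂ} {y : PowerSeries ℂ}
    (hy : IsConvergent (σ := Unit) y) {F : ℂ × ℂ → Fin 2 → ℂ}
    (hF : IsUnfolding (puiseuxCurve m L y) F) (i : Fin 2) :
    taylorCurve F 0 0 i = puiseuxCurve m L y i := by
  have h1 := hasFPowerSeriesAt_evalAt (isConvergent_puiseuxCurve L hy i)
    (hF.2.mono fun u hu => hu i)
  have h2 : AnalyticAt ℂ (fun u => F (u, 0) i) 0 := ⟨_, h1⟩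
  have h3 := h2.hasFPowerSeriesAt.eq_formalMultilinearSeries h1
  ext n
  have h4 := congrArg (fun p => FormalMultilinearSeries.coeff p n) h3
  simp only [FormalMultilinearSeries.coeff_ofScalars] at h4
  rw [taylorCurve, PowerSeries.coeff_mk, h4]

theorem exists_coeff_puiseuxCurve_ne_zero {m : ℕ} (L : GL (Fin 2) ℂ) {y : PowerSeries ℂ}
    (hy : PowerSeries.coeff m y = 0) : ∃ i, PowerSeries.coeff m (puiseuxCurve m L y i) ≠ 0 := by
  have h1 : ∀ i, PowerSeries.coeff m (puiseuxCurve m L y i) = L.1 i 0 := by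
    intro i
    rw [puiseuxCurve, map_add, PowerSeries.coeff_C_mul, PowerSeries.coeff_C_mul, hy,
      PowerSeries.coeff_X_pow_self]
    simp
  by_contra! h
  have h2 := inv_mul_coe L
  have h3 := congrFun (congrFun h2 0) 0
  rw [Matrix.mul_apply, Fin.sum_univ_two, ← h1, ← h1, h, h] at h3
  simp at h3

/-- The zeros of the perturbed curve in a small disc tend to the origin. -/
theorem eventually_norm_lt_of_zero {F : ℂ × ℂ → Fin 2 → ℂ} {ε : ℝ}
    (hF : ∀ u ∈ Metric.closedBall (0 : ℂ) ε, ContinuousAt F (u, 0))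
    (h0 : ∀ u ∈ Metric.closedBall (0 : ℂ) ε, F (u, 0) = 0 → u = 0) {η : ℝ} (hη : 0 < η) :
    ∀ᶠ t in 𝓝 (0 : ℂ), ∀ u ∈ Metric.ball (0 : ℂ) ε, F (u, t) = 0 → ‖u‖ < η := by
  set A := Metric.closedBall (0 : ℂ) ε \ Metric.ball 0 η with hA
  have hAc : IsCompact A := (isCompact_closedBall 0 ε).diff Metric.isOpen_ball
  have h1 : ∀ᶠ t in 𝓝 (0 : ℂ), ∀ u ∈ A, F (u, t) ≠ 0 := by
    refine hAc.eventually_forall_of_forall_eventually fun u hu => ?_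
    have h1 : ContinuousAt (fun z : ℂ × ℂ => F (z.2, z.1)) (0, u) :=
      ContinuousAt.comp' (f := Prod.swap) (x := ((0, u) : ℂ × ℂ)) (hF u hu.1)
        continuous_swap.continuousAt
    refine h1.eventually_ne fun h2 => hu.2 ?_
    rw [h0 u hu.1 h2]
    exact Metric.mem_ball_self hη
  filter_upwards [h1] with t ht u hu hz
  by_contra! hle
  refine ht u ⟨Metric.ball_subset_closedBall hu, fun h2 => ?_⟩ hz
  rw [mem_ball_zero_iff] at h2
  exact absurd h2 (not_lt.2 hle)

theorem evalAt_zero {h : Ser2} : evalAt h 0 = MvPowerSeries.constantCoeff h := by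
  rw [evalAt, tsum_eq_single 0]
  · simp
  · intro n hn
    obtain ⟨i, hi⟩ := Finsupp.ne_iff.1 hn
    rw [Finset.prod_eq_zero (Finset.mem_univ i), mul_zero]
    exact zero_pow hi

theorem eventually_isolated_zero {m : ℕ} {L : GL (Fin 2) ℂ} {y : PowerSeries ℂ}
    (hy : IsConvergent (σ := Unit) y) (hm : PowerSeries.coeff m y = 0) {F : ℂ × ℂ → Fin 2 → ℂ}
    (hF : IsUnfolding (puiseuxCurve m L y) F) :
    ∀ᶠ u in 𝓝 (0 : ℂ), F (u, 0) = 0 → u = 0 := by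
  obtain ⟨i, hi⟩ := exists_coeff_puiseuxCurve_ne_zero L hm
  have h1 := hasFPowerSeriesAt_evalAt (isConvergent_puiseuxCurve L hy i)
    (hF.2.mono fun u hu => hu i)
  have h2 : AnalyticAt ℂ (fun u => F (u, 0) i) 0 := ⟨_, h1⟩
  rcases h2.eventually_eq_zero_or_eventually_ne_zero with h3 | h3
  · exfalso
    apply hi
    have h4 : iteratedDeriv m (fun u => F (u, 0) i) 0 = 0 := by
      have h5 : (fun u => F (u, 0) i) =ᶠ[𝓝 0] fun _ => (0 : ℂ) := h3
      rw [h5.iteratedDeriv_eq]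
      simp
    rw [← taylorCurve_zero hy hF, taylorCurve, PowerSeries.coeff_mk, h4, zero_div]
  · rw [eventually_nhdsWithin_iff] at h3
    filter_upwards [h3] with u hu hz
    by_contra hne
    exact hu hne (congrFun hz i)

/-- Along an unfolding with constant multiplicity, the number of characteristic exponents does not
exceed that of a minimal branch: the Milnor number is upper semicontinuous, and branches with more
characteristic exponents have a larger Milnor number. -/
theorem IsMuMinimal.numCharExponents_le {m k : ℕ} (hm : 2 ≤ m) {X : ConvSeries}
    (hX : IsMuMinimal m k X) {L : GL (Fin 2) ℂ} {y : PowerSeries ℂ}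
    (hp : IsPuiseuxParametrization X m L y) {F : ℂ × ℂ → Fin 2 → ℂ}
    (hF : IsUnfolding (puiseuxCurve m L y) F) :
    ∀ᶠ ε in 𝓝[>] (0 : ℝ), ∀ Xt : ℂ → ConvSeries,
      (∀ᶠ t in 𝓝 (0 : ℂ), Irreducible (Xt t) ∧
        IsGermOf ((fun u => F (u, t)) '' Metric.ball 0 ε) (Xt t) ∧
        HasMultiplicity (Xt t) m) →
      ∀ᶠ t in 𝓝 (0 : ℂ), ∀ c : ℕ, HasNumCharExponents (Xt t) c → c ≤ k := by
  classical
  obtain ⟨N, hN⟩ := hp.primitive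
  have hym : PowerSeries.coeff m y = 0 := hp.exponents m le_rfl
  have hloc : ∀ᶠ u in 𝓝 (0 : ℂ), (F (u, 0) = 0 → u = 0) ∧ ContinuousAt F (u, 0) := by
    refine (eventually_isolated_zero hp.convergent hym hF).and ?_
    have h1 : ContinuousAt (fun u : ℂ => (u, (0 : ℂ))) 0 := by fun_prop
    exact (h1.eventually hF.1.eventually_analyticAt).mono fun u hu => hu.continuousAt
  obtain ⟨ε₀, hε₀, hball⟩ := Metric.eventually_nhds_iff_ball.1 hloc
  filter_upwards [Ioo_mem_nhdsGT hε₀] with ε hε Xt hXt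
  have hsub : Metric.closedBall (0 : ℂ) ε ⊆ Metric.ball 0 ε₀ :=
    Metric.closedBall_subset_ball hε.2
  -- a preimage of the origin, which exists whenever the origin lies on the perturbed curve
  let u : ℂ → ℂ := fun t =>
    if h : ∃ w ∈ Metric.ball (0 : ℂ) ε, F (w, t) = 0 then h.choose else 0
  have hu0 : ∀ t, (∃ w ∈ Metric.ball (0 : ℂ) ε, F (w, t) = 0) →
      u t ∈ Metric.ball (0 : ℂ) ε ∧ F (u t, t) = 0 := by
    intro t h
    simp only [u, dif_pos h]
    exact h.choose_spec
  have hu : Tendsto u (𝓝 0) (𝓝 0) := by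
    refine Metric.tendsto_nhds.2 fun η hη => ?_
    filter_upwards [eventually_norm_lt_of_zero (fun w hw => (hball w (hsub hw)).2)
      (fun w hw => (hball w (hsub hw)).1) hη] with t ht
    rw [dist_zero_right]
    by_cases h : ∃ w ∈ Metric.ball (0 : ℂ) ε, F (w, t) = 0
    · exact ht _ (hu0 t h).1 (hu0 t h).2
    · simp only [u, dif_neg h, norm_zero]
      exact hη
  have hcoef := tendsto_coeff_taylorCurve hF.1 hu
  simp only [taylorCurve_zero hp.convergent hF] at hcoef
  obtain ⟨i, hi⟩ := exists_coeff_puiseuxCurve_ne_zero L hym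
  have hdiff : ∀ (i : Fin 2) (n : Fin 2 →₀ ℕ), Tendsto
      (fun t => MvPowerSeries.coeff n (diffQuot (taylorCurve F (u t) t i))) (𝓝 0)
      (𝓝 (MvPowerSeries.coeff n (diffQuot (puiseuxCurve m L y i)))) := by
    intro i n
    rw [eq_biexp n]
    simp only [diffQuot, coeff_ofCoeff]
    exact hcoef i _
  have hcol := eventually_colength_le (hdiff 0) (hdiff 1)
    (colength_doubleIdeal hm L hp.exponents hN)
  have hut : Tendsto (fun t => (u t, t)) (𝓝 0) (𝓝 ((0, 0) : ℂ × ℂ)) := hu.prodMk_nhds tendsto_id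
  filter_upwards [hXt, hcol, (hcoef i m).eventually_ne hi, hut.eventually hF.1.eventually_analyticAt]
    with t ⟨hirr, hgerm, hmul⟩ hle hne han c hc
  by_contra! hlt
  have hzero : MvPowerSeries.constantCoeff (Xt t).1 = 0 := by
    rw [← MvPowerSeries.one_le_order_iff_constCoeff_eq_zero, show (Xt t).1.order = m from hmul]
    exact_mod_cast (by omega : 1 ≤ m)
  obtain ⟨hub, huF⟩ : u t ∈ Metric.ball (0 : ℂ) ε ∧ F (u t, t) = 0 := by
    refine hu0 t ?_
    have h1 := hgerm.self_of_nhds.2 (evalAt_zero.trans hzero)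
    exact h1
  have hγ : ∀ i, MvPowerSeries.constantCoeff (σ := Unit) (taylorCurve F (u t) t i) = 0 := by
    intro i
    apply cc_mv
    rw [← PowerSeries.coeff_zero_eq_constantCoeff_apply, taylorCurve, PowerSeries.coeff_mk,
      iteratedDeriv_zero, huF]
    simp
  have hpair : AnalyticAt ℂ (fun w : ℂ => F (w, t)) (u t) :=
    han.comp₂ analyticAt_id analyticAt_const
  have hvan : curveEval (taylorCurve F (u t) t 0) (taylorCurve F (u t) t 1) (Xt t).1 = 0 := by
    refine curveEval_eq_zero_of_evalAt (Xt t).2 (g := fun v => F (u t + v, t)) hγ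
      (fun i K => exists_expands (analyticAt_pi_iff.1 hpair i) K) ?_
    have h1 : Tendsto (fun v : ℂ => u t + v) (𝓝 0) (𝓝 (u t)) := by
      have : ContinuousAt (fun v : ℂ => u t + v) 0 := by fun_prop
      simpa [ContinuousAt] using this
    have h2 : Tendsto (fun v : ℂ => F (u t + v, t)) (𝓝 0) (𝓝 0) := by
      have := hpair.continuousAt.tendsto.comp h1
      rwa [huF] at this
    filter_upwards [h2.eventually hgerm, h1.eventually (Metric.isOpen_ball.mem_nhds hub)]
      with v hv hv'
    exact hv.1 ⟨_, hv', rfl⟩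
  obtain ⟨m', L', y', hp', hcard⟩ := hc
  obtain rfl := hp'.multiplicity.unique hmul
  have h3 := milnorNumber_eq_colength_doubleIdeal hm hp' hγ ⟨i, hne⟩ hvan
  have h4 := hX.milnorNumber_lt hm hlt ⟨hirr, hmul, _, L', y', hp', hcard⟩
  rw [h3, milnorNumber_eq_gcdSum hm hp hN] at h4
  exact absurd hle (not_le.2 h4)

end PlaneCurve

end


theorem mainTheorem5 (m k : ℕ) (hm : 2 ≤ m) (X : ConvSeries) (hX : IsMuMinimal m k X) :
    (¬ m.Prime → 4 ≤ k →
      milnorNumber X = ((m * (m - 2 + nestedDivisor m k 1) +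
        ∑ j ∈ Finset.Icc 1 (k - 3),
          nestedDivisor m k j * (nestedDivisor m k (j + 1) - 1) : ℕ) : ℕ∞)) ∧
    (∀ (k' : ℕ) (Y : ConvSeries), k < k' → Y ∈ Branches m k' →
      milnorNumber X < milnorNumber Y) ∧
    (∀ (L : GL (Fin 2) ℂ) (y : PowerSeries ℂ), IsPuiseuxParametrization X m L y →
      ∀ F : ℂ × ℂ → Fin 2 → ℂ, IsUnfolding (puiseuxCurve m L y) F →
      ∀ᶠ ε in 𝓝[>] (0 : ℝ), ∀ Xt : ℂ → ConvSeries,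
        (∀ᶠ t in 𝓝 (0 : ℂ), Irreducible (Xt t) ∧
          IsGermOf ((fun u => F (u, t)) '' Metric.ball 0 ε) (Xt t) ∧
          HasMultiplicity (Xt t) m) →
        ∀ᶠ t in 𝓝 (0 : ℂ), ∀ c : ℕ, HasNumCharExponents (Xt t) c → c ≤ k) := by
  exact ⟨fun _ hk => hX.milnorNumber_eq hm hk, fun _ _ hk hY => hX.milnorNumber_lt hm hk hY,
    fun _ _ hp _ hF => hX.numCharExponents_le hm hp hF⟩
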